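/- **Notation.** Let $1\le p,q<\infty$, $\lambda>-1$, $\mathbb R_+=(0,\infty)$, $\Pi=\{x+iy: x\in\mathbb R,\ y>0\}$, and $$d\nu_\lambda(y)=(\lambda+1)(2y)^\lambda\,dy\ \text{ on }\mathbb R_+,\qquad d\mu_\lambda(x+iy)=\tfrac1\pi(\lambda+1)(2y)^\lambda\,dx\,dy\ \text{ on }\Pi .$$ Let $\mathcal D_t(\Pi)=\mathcal S(\mathbb R)\,\widehat\otimes\,C_c^\infty(\mathbb R_+)$, let $\mathcal D_t(\Pi)'$ be its dual (the distributions on $\Pi$ that are tempered in $x$), and let $\widehat f$ be the distributional Fourier transform of $f\in\mathcal D_t(\Pi)'$ in the first variable, for the normalization $(F\varphi)(u)=(2\pi)^{-1/2}\int_{\mathbb R}e^{-iux}\varphi(x)\,dx$. Let $\mathcal L^{q,p}_\lambda(\Pi)$ be the space of those $f\in\mathcal D_t(\Pi)'$ for which $\widehat f$ belongs to $L^{q}(\mathbb R,L^p(\mathbb R_+,\nu_\lambda))$, with the norm $$\|f\|=\Big(\int_{\mathbb R}\big\|\tfrac1{\sqrt\pi}\widehat f(\xi,\cdot)\big\|_{L^p(\mathbb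 R_+,\nu_\lambda)}^q\,d\xi\Big)^{1/q},$$ and let $\mathcal A^{q,p}_\lambda(\Pi)$ be the subspace of those elements of $\mathcal L^{q,p}_\lambda(\Pi)$ that are analytic functions in $\Pi$. Put $U_{1,\lambda}f=\pi^{-1/2}\widehat f$, $$\theta_{\lambda,p}(x)=\Big(\frac{p^{\lambda+1}x^{\lambda+1}}{2^\lambda\Gamma(\lambda+2)}\Big)^{1/p}\ (x\ge0),\qquad \psi_\lambda(x,t)=\ln\frac{\Gamma(\lambda+1)}{\Gamma(\lambda+1,pxt)}\ (x,t>0),$$ where $\Gamma(a,s)=\int_s^\infty t^{a-1}e^{-t}\,dt$; for $x>0$ let $\beta_\lambda(x,\cdot):\mathbb R_+\to\mathbb R_+$ be the inverse of the bijection $\psi_\lambda(x,\cdot)$, and put $$(U_{2,\lambda}g)(x,y)=\theta_{\lambda,p}(|x|)^{-1}e^{-y/p+|x|\beta_\lambda(|x|,y)}g(x,\beta_\lambda(|x|,y)),\qquad U_\lambda=U_{2,\lambda}U_{1,\lambda},$$ $$(R_0\varphi)(x,y)=\chi_+(x)\varphi(x)e^{-y/p},\qquad (R_0^{-1}g)(x)=\chi_+(x)\int_{\mathbb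 R_+}g(x,y)\,e^{-y(p-1)/p}\,dy ,$$ where $\chi_+$ is the indicator function of $\mathbb R_+$. **Theorem (Paley–Wiener-type theorem).** For every $\varphi\in L^q(\mathbb R_+)$ the integral $$(R_\lambda^{-1}\varphi)(z)=\frac{p^{(\lambda+1)/p}}{\sqrt2\,\big(2^\lambda\Gamma(\lambda+2)\big)^{1/p}}\int_{\mathbb R_+}\varphi(\xi)\,\xi^{(\lambda+1)/p}e^{i\xi z}\,d\xi,\qquad z\in\Pi,$$ converges absolutely and defines an analytic function in $\Pi$. The map $\varphi\mapsto R_\lambda^{-1}\varphi$ is a linear isometric isomorphism of $L^q(\mathbb R_+)$ onto $\mathcal A^{q,p}_\lambda(\Pi)$, and $R_\lambda^{-1}=U_\lambda^{-1}R_0$, that is, $f=R_\lambda^{-1}\varphi$ is the unique $f\in\mathcal L^{q,p}_\lambda(\Pi)$ with $U_\lambda f=R_0\varphi$. The inverse isomorphism is $R_\lambda=R_0^{-1}U_\lambda:\mathcal A^{q,p}_\lambda(\Pi)\to L^q(\mathbb R_+)$, and for every $f\in\mathcal A^{q,p}_\lambda(\Pi)$ and almost every $x>0$ $$(R_\lambda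 f)(x)=\frac1{\sqrt2}\,\theta_{\lambda,p}^{p-1}(x)\int_{\Pi}f(\omega)\,e^{-ix\overline\omega}\,e^{-x(p-2)\operatorname{Im}\omega}\,d\mu_\lambda(\omega).$$ Here the integral over $\Pi$ is understood as the iterated integral $$\frac1\pi\int_{\mathbb R_+}\Big(\int_{\mathbb R}f(\xi+i\eta)e^{-ix\xi}\,d\xi\Big)e^{-x\eta}e^{-x(p-2)\eta}\,d\nu_\lambda(\eta),$$ in which the inner integral stands for $\sqrt{2\pi}\,\widehat f(x,\eta)$; the outer integral then converges absolutely for almost every $x>0$. If $f(\cdot+i\eta)\in L^1(\mathbb R)$ for almost every $\eta>0$, the formula holds for almost every $x>0$ with the inner integral taken as a Lebesgue integral (and the outer one convergent absolutely). Moreover, for almost every $x>0$ the following is true: if $f(\omega)e^{-ix\overline\omega}e^{-x(p-2)\operatorname{Im}\omega}$ is $\mu_\lambda$-integrable over $\Pi$, the formula holds at $x$ with the integral over $\Pi$ taken as a Lebesgue integral. -/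

import Mathlib

open MeasureTheory Set TopologicalSpace
open scoped ENNReal SchwartzMap Distributions

namespace MixedFourier

noncomputable section

/-- Real exponents `1 ≤ p < ∞` are admissible exponents of Lebesgue spaces. -/
instance factOneLeOfReal (p : ℝ) [hp : Fact (1 ≤ p)] : Fact (1 ≤ ENNReal.ofReal p) :=
  ⟨by simpa using ENNReal.ofReal_le_ofReal hp.out⟩

/-- The open half-line `ℝ₊ = (0, ∞)`. -/
def halfLine : Opens ℝ := ⟨Ioi 0, isOpen_Ioi⟩

/-- The open upper half-plane `Π` in `ℂ`. -/
def halfPlane : Set ℂ := {z : ℂ | 0 < z.im}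

/-! ### The measures and the Lebesgue spaces -/

/-- The density `(λ + 1) (2 y) ^ λ`. -/
def nuDensity (lam y : ℝ) : ℝ := (lam + 1) * (2 * y) ^ lam

/-- The measure `dν_λ(y) = (λ + 1) (2 y) ^ λ dy` on `ℝ₊`. -/
def nu (lam : ℝ) : Measure ℝ :=
  (volume.restrict (Ioi 0)).withDensity fun y => ENNReal.ofReal (nuDensity lam y)

/-- The measure `dμ_λ(z) = π⁻¹ (λ + 1) (2 y) ^ λ dx dy` on `Π`. -/
def mu (lam : ℝ) : Measure ℂ :=
  (volume.restrict halfPlane).withDensity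
    fun z => ENNReal.ofReal (Real.pi⁻¹ * nuDensity lam z.im)

/-- The complex space `L^q(ℝ₊)`. -/
abbrev LqHalfLine (q : ℝ) : Type :=
  Lp ℂ (ENNReal.ofReal q) ((volume : Measure ℝ).restrict (Ioi 0))

/-- The complex space `X = L^p(ℝ₊, ν_λ)`. -/
abbrev XSpace (p lam : ℝ) : Type := Lp ℂ (ENNReal.ofReal p) (nu lam)

/-- The mixed norm space `L^{q,p}_λ(Π) = L^q(ℝ, L^p(ℝ₊, ν_λ))` of (Bochner measurable) functions,
with the norm `‖ ‖g‖_{L^p(ℝ₊, ν_λ)} ‖_{L^q(ℝ)}`. -/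
abbrev MixedLp (q p lam : ℝ) [Fact (1 ≤ p)] : Type :=
  Lp (XSpace p lam) (ENNReal.ofReal q) (volume : Measure ℝ)

/-! ### Distributions on `Π`, tempered in the first variable -/

/-- The dual of `𝒟_t(Π) = 𝒮(ℝ) ⊗ C_c^∞(ℝ₊)` (completed tensor product), i.e.
the space of continuous bilinear forms `(φ, h) ↦ u(φ ⊗ h)` on `𝒮(ℝ) × C_c^∞(ℝ₊)`. -/
def dtForms : Submodule ℂ (𝓢(ℝ, ℂ) →ₗ[ℂ] 𝓓(halfLine, ℂ) →ₗ[ℂ] ℂ) where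
  carrier := {u | Continuous fun a : 𝓢(ℝ, ℂ) × 𝓓(halfLine, ℂ) => u a.1 a.2}
  add_mem' := fun {u v} hu hv => by
    exact Continuous.add hu hv
  zero_mem' := by
    simpa using (continuous_const : Continuous fun _ : 𝓢(ℝ, ℂ) × 𝓓(halfLine, ℂ) => (0 : ℂ))
  smul_mem' := fun c u hu => by
    exact Continuous.const_smul hu c

/-- The space of distributions `𝒟_t(Π)'`. -/
def DtDual : Type := dtForms

instance : AddCommGroup DtDual := inferInstanceAs (AddCommGroup dtForms)

instance : Module ℂ DtDual := inferInstanceAs (Module ℂ dtForms)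

/-- The value `u(φ ⊗ h)`. -/
def DtDual.eval (u : DtDual) (φ : 𝓢(ℝ, ℂ)) (h : 𝓓(halfLine, ℂ)) : ℂ := u.1 φ h

theorem DtDual.ext {u v : DtDual} (huv : ∀ φ h, u.eval φ h = v.eval φ h) : u = v :=
  Subtype.ext (LinearMap.ext fun φ => LinearMap.ext fun h => huv φ h)

/-- The dilation `x ↦ x / (2π)` of the line. -/
def dilation : ℝ ≃L[ℝ] ℝ :=
  ContinuousLinearEquiv.unitsEquivAut ℝ (Units.mk0 (2 * Real.pi)⁻¹ (by positivity))

/-- The Fourier transform `(F φ)(u) = (2π)^{-1/2} ∫ e^{-iux} φ(x) dx` on `𝒮(ℝ)`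
(see `fourierS_apply`). -/
def fourierS : 𝓢(ℝ, ℂ) →L[ℂ] 𝓢(ℝ, ℂ) :=
  ((Real.sqrt (2 * Real.pi) : ℂ)⁻¹) •
    (SchwartzMap.compCLMOfContinuousLinearEquiv ℂ dilation ∘L
      FourierTransform.fourierCLM ℂ 𝓢(ℝ, ℂ))

theorem fourierS_apply (φ : 𝓢(ℝ, ℂ)) (u : ℝ) :
    fourierS φ u = (Real.sqrt (2 * Real.pi) : ℂ)⁻¹ *
      ∫ x : ℝ, Complex.exp (-(Complex.I * u * x)) * φ x := by
  have h : fourierS φ u = (Real.sqrt (2 * Real.pi) : ℂ)⁻¹ *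
      (FourierTransform.fourier (φ : ℝ → ℂ)) (u * (2 * Real.pi)⁻¹) := by
    simp [fourierS, dilation, SchwartzMap.fourier_coe, mul_comm, -Nat.ofNat_nonneg, -Real.sqrt_mul]
  rw [h, Real.fourier_eq']
  congr 1
  refine integral_congr_ae (Filter.Eventually.of_forall fun x => ?_)
  simp only [smul_eq_mul]
  congr 2
  have : (Real.pi : ℂ) ≠ 0 := by exact_mod_cast Real.pi_ne_zero
  simp
  field_simp

theorem fourierS_surjective : Function.Surjective fourierS := by
  intro φ
  have hc : (Real.sqrt (2 * Real.pi) : ℂ) ≠ 0 := by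
    have : Real.sqrt (2 * Real.pi) ≠ 0 := by positivity
    exact_mod_cast this
  refine ⟨(FourierTransform.fourierCLE ℂ 𝓢(ℝ, ℂ)).symm
    (SchwartzMap.compCLMOfContinuousLinearEquiv ℂ dilation.symm
      ((Real.sqrt (2 * Real.pi) : ℂ) • φ)), ?_⟩
  ext x
  have key : fourierS ((FourierTransform.fourierCLE ℂ 𝓢(ℝ, ℂ)).symm
    (SchwartzMap.compCLMOfContinuousLinearEquiv ℂ dilation.symm
      ((Real.sqrt (2 * Real.pi) : ℂ) • φ))) x
      = (Real.sqrt (2 * Real.pi) : ℂ)⁻¹ * ((Real.sqrt (2 * Real.pi) : ℂ) * φ x) := by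
    simp only [fourierS, smul_apply, ContinuousLinearMap.comp_apply,
      FourierTransform.fourierCLM_apply, FourierTransform.fourierCLE_symm_apply,
      FourierTransform.fourier_fourierInv_eq, smul_eq_mul,
      SchwartzMap.compCLMOfContinuousLinearEquiv_apply, Function.comp_apply,
      ContinuousLinearEquiv.symm_apply_apply]
  rw [key, inv_mul_cancel_left₀ hc]

/-- The distributional Fourier transform in the first variable, `û(φ ⊗ h) = u(Fφ ⊗ h)`. -/
def partialFourier : DtDual →ₗ[ℂ] DtDual where
  toFun u := ⟨u.1 ∘ₗ (fourierS : 𝓢(ℝ, ℂ) →ₗ[ℂ] 𝓢(ℝ, ℂ)), by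
    have hu : Continuous fun a : 𝓢(ℝ, ℂ) × 𝓓(halfLine, ℂ) => u.1 a.1 a.2 := u.2
    exact hu.comp ((fourierS.continuous.comp continuous_fst).prodMk continuous_snd)⟩
  map_add' u v := rfl
  map_smul' c u := rfl

theorem partialFourier_injective : Function.Injective partialFourier := by
  intro u v h
  refine DtDual.ext fun φ k => ?_
  obtain ⟨ψ, rfl⟩ := fourierS_surjective φ
  have := congrArg (fun w : DtDual => w.eval ψ k) h
  exact this

/-! ### Elements of the mixed norm space as distributions -/

/-- An element `v` of `L^p(ℝ₊, ν_λ)` as a distribution on `ℝ₊`: `⟨v, h⟩ = ∫ v(y) h(y) dy`. -/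
def pairX {p lam : ℝ} (v : XSpace p lam) (h : 𝓓(halfLine, ℂ)) : ℂ :=
  ∫ y in Ioi (0 : ℝ), v y * h y

/-- An element `g` of `L^q(ℝ, L^p(ℝ₊, ν_λ))` as a distribution on `Π`:
`⟨g, φ ⊗ h⟩ = ∫ φ(x) (∫ g(x, y) h(y) dy) dx`. -/
def pairMixed {q p lam : ℝ} [Fact (1 ≤ p)] (g : MixedLp q p lam)
    (φ : 𝓢(ℝ, ℂ)) (h : 𝓓(halfLine, ℂ)) : ℂ :=
  ∫ x : ℝ, φ x * pairX (g x) h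

theorem nuDensity_pos {lam y : ℝ} (hlam : -1 < lam) (hy : 0 < y) : 0 < nuDensity lam y :=
  mul_pos (by linarith) (Real.rpow_pos_of_pos (by linarith) _)

theorem measurable_nuDensity (lam : ℝ) : Measurable (nuDensity lam) := by
  unfold nuDensity; fun_prop

theorem continuousOn_nuDensity (lam : ℝ) : ContinuousOn (nuDensity lam) (Ioi 0) := by
  unfold nuDensity
  refine continuousOn_const.mul (ContinuousOn.rpow_const (by fun_prop) ?_)
  intro y hy
  left
  have : (0 : ℝ) < y := hy
  positivity

/-- The test function `h` divided by the density of `ν_λ`. -/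
def divDensity (lam : ℝ) (h : 𝓓(halfLine, ℂ)) (y : ℝ) : ℂ := h y * ((nuDensity lam y)⁻¹ : ℝ)

theorem nu_lt_top (lam : ℝ) {K : Set ℝ} (hK : IsCompact K) (hsub : K ⊆ Ioi 0) :
    nu lam K < ∞ := by
  have hint : IntegrableOn (nuDensity lam) K :=
    ((continuousOn_nuDensity lam).mono hsub).integrableOn_compact hK
  rw [nu, withDensity_apply _ hK.measurableSet]
  refine lt_of_le_of_lt (lintegral_mono' (Measure.restrict_mono le_rfl
    Measure.restrict_le_self) (le_refl _)) ?_
  refine lt_of_le_of_lt (lintegral_mono fun y => ?_) hint.2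
  exact Real.ofReal_le_enorm _

theorem memLp_divDensity {lam : ℝ} (hlam : -1 < lam) (r : ℝ≥0∞) (h : 𝓓(halfLine, ℂ)) :
    MemLp (divDensity lam h) r (nu lam) := by
  have hsub : tsupport h ⊆ Ioi 0 := h.tsupport_subset
  have hsupp : ∀ y, y ∉ tsupport h → divDensity lam h y = 0 := fun y hy => by
    simp [divDensity, image_eq_zero_of_notMem_tsupport hy]
  have hts : tsupport (divDensity lam h) ⊆ tsupport h := by
    refine closure_minimal (fun y hy => ?_) (isClosed_tsupport h)
    by_contra hcon
    exact hy (hsupp y hcon)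
  have hcont : Continuous (divDensity lam h) := by
    refine continuous_of_tsupport fun y hy => ?_
    have hy0 : y ∈ Ioi (0 : ℝ) := hsub (hts hy)
    have h1 : ContinuousAt (nuDensity lam) y :=
      (continuousOn_nuDensity lam).continuousAt (isOpen_Ioi.mem_nhds hy0)
    have h2 := h1.inv₀ (nuDensity_pos hlam hy0).ne'
    exact h.continuous.continuousAt.mul (Complex.continuous_ofReal.continuousAt.comp h2)
  have hcs : HasCompactSupport (divDensity lam h) :=
    HasCompactSupport.of_support_subset_isCompact h.hasCompactSupport
      ((subset_tsupport _).trans hts)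
  obtain ⟨C, hC⟩ := hcont.bounded_above_of_compact_support hcs
  have hK : MeasurableSet (tsupport h) := (isClosed_tsupport h).measurableSet
  have hfin : nu lam (tsupport h) < ∞ := nu_lt_top lam h.hasCompactSupport hsub
  have heq : divDensity lam h = (tsupport h).indicator (divDensity lam h) := by
    ext y
    by_cases hy : y ∈ tsupport h
    · simp [hy]
    · simp [hy, hsupp y hy]
  rw [heq, memLp_indicator_iff_restrict hK]
  have : IsFiniteMeasure ((nu lam).restrict (tsupport h)) := ⟨by simpa using hfin⟩
  exact MemLp.of_bound hcont.aestronglyMeasurable C (Filter.Eventually.of_forall hC)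

theorem integral_nu {lam : ℝ} (hlam : -1 < lam) (f : ℝ → ℂ) :
    ∫ y, f y ∂(nu lam) = ∫ y in Ioi (0 : ℝ), ((nuDensity lam y : ℝ) : ℂ) * f y := by
  rw [nu, integral_withDensity_eq_integral_toReal_smul₀
    (measurable_nuDensity lam).ennreal_ofReal.aemeasurable
    (Filter.Eventually.of_forall fun _ => ENNReal.ofReal_lt_top)]
  refine setIntegral_congr_fun measurableSet_Ioi fun y hy => ?_
  simp [ENNReal.toReal_ofReal (nuDensity_pos hlam hy).le]

/-- `v ↦ ⟨v, h⟩` is a continuous linear functional on `L^p(ℝ₊, ν_λ)`. -/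
theorem exists_pairX_clm {p lam : ℝ} [Fact (1 ≤ p)] (hlam : -1 < lam) (h : 𝓓(halfLine, ℂ)) :
    ∃ T : XSpace p lam →L[ℂ] ℂ, ∀ v, T v = pairX v h := by
  let r : ℝ≥0∞ := (1 - (ENNReal.ofReal p)⁻¹)⁻¹
  have hr : (ENNReal.ofReal p).HolderConjugate r :=
    ENNReal.HolderConjugate.inv_one_sub_inv' (factOneLeOfReal p).out
  have hr1 : Fact (1 ≤ r) := by simp [fact_iff, r]
  let B : XSpace p lam →L[ℂ] Lp ℂ r (nu lam) →L[ℂ] ℂ :=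
    (ContinuousLinearMap.mul ℂ ℂ).lpPairing (nu lam) (ENNReal.ofReal p) r
  refine ⟨B.flip ((memLp_divDensity hlam r h).toLp _), fun v => ?_⟩
  rw [ContinuousLinearMap.flip_apply, ContinuousLinearMap.lpPairing_eq_integral]
  have h1 : ∫ y, (ContinuousLinearMap.mul ℂ ℂ) (v y)
      ((memLp_divDensity hlam r h).toLp _ y) ∂(nu lam)
      = ∫ y, v y * divDensity lam h y ∂(nu lam) := by
    refine integral_congr_ae ?_
    filter_upwards [(memLp_divDensity hlam r h).coeFn_toLp] with y hy
    simp [hy]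
  rw [h1, integral_nu hlam, pairX]
  refine setIntegral_congr_fun measurableSet_Ioi fun y hy => ?_
  have hne : ((nuDensity lam y : ℝ) : ℂ) ≠ 0 := by
    exact_mod_cast (nuDensity_pos hlam hy).ne'
  simp only [divDensity, Complex.ofReal_inv]
  field_simp

/-- An element of `L^p(ℝ₊, ν_λ)` is determined by the distribution it defines. -/
theorem eq_zero_of_pairX {p lam : ℝ} [Fact (1 ≤ p)] (hlam : -1 < lam) (v : XSpace p lam)
    (hv : ∀ h, pairX v h = 0) : v = 0 := by
  have hloc : LocallyIntegrableOn v (Ioi (0 : ℝ)) volume := by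
    rw [locallyIntegrableOn_iff isOpen_Ioi.isLocallyClosed]
    intro K hsub hK
    have hfin : IsFiniteMeasure ((nu lam).restrict K) := ⟨by simpa using nu_lt_top lam hK hsub⟩
    have h1 : Integrable v ((nu lam).restrict K) :=
      memLp_one_iff_integrable.1
        (((Lp.memLp v).restrict K).mono_exponent (factOneLeOfReal p).out)
    have hnu : (nu lam).restrict K = (volume.restrict K).withDensity
        fun y => ENNReal.ofReal (nuDensity lam y) := by
      rw [nu, restrict_withDensity hK.measurableSet, Measure.restrict_restrict hK.measurableSet,
        inter_eq_left.2 hsub]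
    rw [hnu, integrable_withDensity_iff_integrable_smul'
      (measurable_nuDensity lam).ennreal_ofReal
      (Filter.Eventually.of_forall fun _ => ENNReal.ofReal_lt_top)] at h1
    have h2 : ContinuousOn (fun y => (nuDensity lam y)⁻¹) K :=
      ((continuousOn_nuDensity lam).mono hsub).inv₀ fun y hy => (nuDensity_pos hlam (hsub hy)).ne'
    have h3 := IntegrableOn.continuousOn_smul (μ := volume) h1 h2 hK
    refine h3.congr_fun (fun y hy => ?_) hK.measurableSet
    have hpos := nuDensity_pos hlam (hsub hy)
    simp only [ENNReal.toReal_ofReal hpos.le]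
    rw [inv_smul_smul₀ hpos.ne']
  have hae := isOpen_Ioi.ae_eq_zero_of_integral_contDiff_smul_eq_zero hloc (by
    intro k hk hkc hks
    let h : 𝓓(halfLine, ℂ) :=
      ⟨fun y => (k y : ℂ), Complex.ofRealCLM.contDiff.comp hk,
        hkc.comp_left (g := fun t : ℝ => (t : ℂ)) (by simp),
        (closure_mono (fun y (hy : (k y : ℂ) ≠ 0) (hcon : k y = 0) => hy (by simp [hcon]))).trans hks⟩
    have h0 := hv h
    rw [pairX] at h0
    rw [← h0, setIntegral_eq_integral_of_forall_compl_eq_zero]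
    · refine integral_congr_ae (Filter.Eventually.of_forall fun y => ?_)
      change k y • v y = v y * (k y : ℂ)
      rw [Complex.real_smul, mul_comm]
    · intro y hy
      have hk0 : k y = 0 := image_eq_zero_of_notMem_tsupport fun hcon => hy (hks hcon)
      change v y * (k y : ℂ) = 0
      simp [hk0])
  rw [Lp.eq_zero_iff_ae_eq_zero]
  have hac : nu lam ≪ volume.restrict (Ioi (0 : ℝ)) := withDensity_absolutelyContinuous _ _
  exact hac.ae_le ((ae_restrict_iff' measurableSet_Ioi).2 hae)

theorem integrable_smul_mixed {q p lam : ℝ} [Fact (1 ≤ q)] [Fact (1 ≤ p)]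
    (g : MixedLp q p lam) (φ : 𝓢(ℝ, ℂ)) : Integrable fun x => φ x • g x := by
  have hr : (ENNReal.ofReal q).HolderConjugate ((1 - (ENNReal.ofReal q)⁻¹)⁻¹) :=
    ENNReal.HolderConjugate.inv_one_sub_inv' (factOneLeOfReal q).out
  have hr' := hr.symm
  have h1 := φ.memLp ((1 - (ENNReal.ofReal q)⁻¹)⁻¹) volume
  have h2 : MemLp (fun x => φ x • g x) 1 volume := (Lp.memLp g).smul h1
  exact memLp_one_iff_integrable.1 h2

theorem pairMixed_eq {q p lam : ℝ} [Fact (1 ≤ q)] [Fact (1 ≤ p)] (hlam : -1 < lam)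
    (g : MixedLp q p lam) (φ : 𝓢(ℝ, ℂ)) (h : 𝓓(halfLine, ℂ)) :
    pairMixed g φ h = pairX (∫ x, φ x • g x) h := by
  obtain ⟨T, hT⟩ := exists_pairX_clm (p := p) hlam h
  rw [← hT, ← T.integral_comp_comm (integrable_smul_mixed g φ), pairMixed]
  refine integral_congr_ae (Filter.Eventually.of_forall fun x => ?_)
  change φ x * pairX (g x) h = T (φ x • g x)
  rw [map_smul, hT, smul_eq_mul]

theorem pairMixed_add {q p lam : ℝ} [Fact (1 ≤ q)] [Fact (1 ≤ p)] (hlam : -1 < lam)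
    (g₁ g₂ : MixedLp q p lam) (φ : 𝓢(ℝ, ℂ)) (h : 𝓓(halfLine, ℂ)) :
    pairMixed (g₁ + g₂) φ h = pairMixed g₁ φ h + pairMixed g₂ φ h := by
  obtain ⟨T, hT⟩ := exists_pairX_clm (p := p) hlam h
  simp only [pairMixed_eq hlam]
  rw [← hT, ← hT, ← hT, ← map_add,
    ← integral_add (integrable_smul_mixed g₁ φ) (integrable_smul_mixed g₂ φ)]
  congr 1
  refine integral_congr_ae ?_
  filter_upwards [Lp.coeFn_add g₁ g₂] with x hx
  rw [hx, Pi.add_apply, smul_add]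

theorem pairMixed_smul {q p lam : ℝ} [Fact (1 ≤ q)] [Fact (1 ≤ p)] (hlam : -1 < lam)
    (c : ℂ) (g : MixedLp q p lam) (φ : 𝓢(ℝ, ℂ)) (h : 𝓓(halfLine, ℂ)) :
    pairMixed (c • g) φ h = c * pairMixed g φ h := by
  obtain ⟨T, hT⟩ := exists_pairX_clm (p := p) hlam h
  simp only [pairMixed_eq hlam]
  rw [← hT, ← hT, ← smul_eq_mul, ← map_smul, ← integral_smul]
  congr 1
  refine integral_congr_ae ?_
  filter_upwards [Lp.coeFn_smul c g] with x hx
  rw [hx, Pi.smul_apply, smul_comm]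

/-- An element of the mixed norm space is determined by the distribution it defines. -/
theorem eq_zero_of_pairMixed {q p lam : ℝ} [hq : Fact (1 ≤ q)] [Fact (1 ≤ p)] (hlam : -1 < lam)
    (g : MixedLp q p lam) (hg : ∀ φ h, pairMixed g φ h = 0) : g = 0 := by
  rw [Lp.eq_zero_iff_ae_eq_zero]
  refine ae_eq_zero_of_integral_contDiff_smul_eq_zero
    ((Lp.memLp g).locallyIntegrable (factOneLeOfReal q).out) fun k hk hkc => ?_
  have hk1 : HasCompactSupport (Complex.ofRealCLM ∘ k) := hkc.comp_left rfl
  have hk2 : ContDiff ℝ ((⊤ : ℕ∞) : WithTop ℕ∞) (Complex.ofRealCLM ∘ k) :=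
    Complex.ofRealCLM.contDiff.comp hk
  have h0 : ∫ x, (hk1.toSchwartzMap hk2) x • g x = 0 :=
    eq_zero_of_pairX hlam _ fun h => by rw [← pairMixed_eq hlam]; exact hg _ _
  rw [← h0]
  refine integral_congr_ae (Filter.Eventually.of_forall fun x => ?_)
  change k x • g x = (k x : ℂ) • g x
  exact (Complex.coe_smul (k x) (g x)).symm

/-! ### The mixed-Fourier-norm space -/

/-- The mixed-Fourier-norm space `ℒ^{q,p}_λ(Π)`: those `u ∈ 𝒟_t(Π)'` for which
`π^{-1/2} û` is (the distribution defined by) an element of `L^q(ℝ, L^p(ℝ₊, ν_λ))`. -/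
def FourierSpace (q p lam : ℝ) [Fact (1 ≤ q)] [Fact (1 ≤ p)] [hlam : Fact (-1 < lam)] :
    Submodule ℂ DtDual where
  carrier := {u | ∃ g : MixedLp q p lam, ∀ φ h,
    (Real.sqrt Real.pi : ℂ)⁻¹ * (partialFourier u).eval φ h = pairMixed g φ h}
  add_mem' := by
    rintro u v ⟨g₁, h₁⟩ ⟨g₂, h₂⟩
    refine ⟨g₁ + g₂, fun φ h => ?_⟩
    rw [pairMixed_add hlam.out, ← h₁, ← h₂, ← mul_add, map_add]
    rfl
  zero_mem' := ⟨0, fun φ h => by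
    have h0 := pairMixed_smul hlam.out 0 (0 : MixedLp q p lam) φ h
    rw [smul_zero, zero_mul] at h0
    rw [h0, map_zero]
    exact mul_zero _⟩
  smul_mem' := by
    rintro c u ⟨g, hg⟩
    refine ⟨c • g, fun φ h => ?_⟩
    rw [pairMixed_smul hlam.out, ← hg, map_smul, mul_left_comm]
    rfl

section

variable {q p lam : ℝ} [Fact (1 ≤ q)] [Fact (1 ≤ p)] [hlam : Fact (-1 < lam)]

theorem eq_of_pairMixed {g₁ g₂ : MixedLp q p lam}
    (h : ∀ φ k, pairMixed g₁ φ k = pairMixed g₂ φ k) : g₁ = g₂ := by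
  have h0 : g₁ + (-1 : ℂ) • g₂ = 0 := eq_zero_of_pairMixed hlam.out _ fun φ k => by
    rw [pairMixed_add hlam.out, pairMixed_smul hlam.out, h]
    ring
  rw [neg_one_smul] at h0
  exact add_neg_eq_zero.1 h0

/-- The operator `U_{1,λ} u = π^{-1/2} û`, from `ℒ^{q,p}_λ(Π)` to `L^q(ℝ, L^p(ℝ₊, ν_λ))`. It is
characterized by `U1_spec`. -/
def U1 : FourierSpace q p lam →ₗ[ℂ] MixedLp q p lam where
  toFun u := u.2.choose
  map_add' u v := eq_of_pairMixed fun φ h => by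
    rw [pairMixed_add hlam.out, ← (u + v).2.choose_spec, ← u.2.choose_spec, ← v.2.choose_spec,
      ← mul_add, Submodule.coe_add, map_add]
    rfl
  map_smul' c u := eq_of_pairMixed fun φ h => by
    rw [RingHom.id_apply, pairMixed_smul hlam.out, ← (c • u).2.choose_spec,
      ← u.2.choose_spec, Submodule.coe_smul, map_smul, mul_left_comm]
    rfl

theorem U1_spec (u : FourierSpace q p lam) (φ : 𝓢(ℝ, ℂ)) (h : 𝓓(halfLine, ℂ)) :
    pairMixed (U1 u) φ h =
      (Real.sqrt Real.pi : ℂ)⁻¹ * (partialFourier (u : DtDual)).eval φ h :=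
  (u.2.choose_spec φ h).symm

theorem U1_injective : Function.Injective (U1 : FourierSpace q p lam →ₗ[ℂ] MixedLp q p lam) := by
  intro u v huv
  have hc : (Real.sqrt Real.pi : ℂ) ≠ 0 := by
    have : Real.sqrt Real.pi ≠ 0 := by positivity
    exact_mod_cast this
  apply Subtype.ext
  apply partialFourier_injective
  refine DtDual.ext fun φ h => ?_
  have h1 := U1_spec u φ h
  rw [huv, U1_spec v φ h] at h1
  exact (mul_left_cancel₀ (inv_ne_zero hc) h1).symm

/-- The norm of `ℒ^{q,p}_λ(Π)` is `‖u‖ = ‖π^{-1/2} û‖_{L^q(ℝ, L^p(ℝ₊, ν_λ))}`. -/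
instance : NormedAddCommGroup (FourierSpace q p lam) :=
  NormedAddCommGroup.induced (FourierSpace q p lam) (MixedLp q p lam)
    (U1 : FourierSpace q p lam →ₗ[ℂ] MixedLp q p lam) U1_injective

instance : NormedSpace ℂ (FourierSpace q p lam) :=
  NormedSpace.induced ℂ (FourierSpace q p lam) (MixedLp q p lam)
    (U1 : FourierSpace q p lam →ₗ[ℂ] MixedLp q p lam)

theorem norm_fourierSpace (u : FourierSpace q p lam) : ‖u‖ = ‖U1 u‖ := rfl

end

/-! ### Analytic elements -/

/-- The distribution `u` is given on `Π` by the function `F`, i.e. `u(φ ⊗ h) = ∫ F (φ ⊗ h)` for all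
test functions `φ ⊗ h` with compact support in `Π`. -/
def IsGivenBy (u : DtDual) (F : ℂ → ℂ) : Prop :=
  ∀ (φ : 𝓢(ℝ, ℂ)) (h : 𝓓(halfLine, ℂ)), HasCompactSupport φ →
    u.eval φ h = ∫ z in halfPlane, F z * (φ z.re * h z.im)

theorem integrableOn_test {F : ℂ → ℂ} (hF : ContinuousOn F halfPlane) (φ : 𝓢(ℝ, ℂ))
    (h : 𝓓(halfLine, ℂ)) (hφ : HasCompactSupport φ) :
    IntegrableOn (fun z : ℂ => F z * (φ z.re * h z.im)) halfPlane := by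
  have hK : IsCompact (tsupport φ ×ℂ tsupport h) := hφ.isCompact.reProdIm h.hasCompactSupport
  have hsub : tsupport φ ×ℂ tsupport h ⊆ halfPlane := fun z hz =>
    h.tsupport_subset hz.2
  have hcont : ContinuousOn (fun z : ℂ => F z * (φ z.re * h z.im)) (tsupport φ ×ℂ tsupport h) :=
    (hF.mono hsub).mul (Continuous.continuousOn
      ((φ.continuous.comp Complex.continuous_re).mul (h.continuous.comp Complex.continuous_im)))
  have h1 := hcont.integrableOn_compact hK (μ := volume)
  refine (integrableOn_iff_integrable_of_support_subset fun z hz => ?_).1 h1 |>.integrableOn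
  refine ⟨subset_tsupport _ fun h0 => hz ?_, subset_tsupport _ fun h0 => hz ?_⟩
  · change F z * (φ z.re * h z.im) = 0
    rw [h0, zero_mul, mul_zero]
  · change F z * (φ z.re * h z.im) = 0
    rw [h0, mul_zero, mul_zero]

/-- The space `𝒜^{q,p}_λ(Π) = Hol(Π) ∩ ℒ^{q,p}_λ(Π)` of those elements of `ℒ^{q,p}_λ(Π)` which are
analytic in `Π`, with the norm of `ℒ^{q,p}_λ(Π)`. -/
def AnalyticSpace (q p lam : ℝ) [Fact (1 ≤ q)] [Fact (1 ≤ p)] [Fact (-1 < lam)] :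
    Submodule ℂ (FourierSpace q p lam) where
  carrier := {u | ∃ F : ℂ → ℂ, DifferentiableOn ℂ F halfPlane ∧ IsGivenBy (u : DtDual) F}
  add_mem' := by
    rintro u v ⟨F, hF, hu⟩ ⟨G, hG, hv⟩
    refine ⟨F + G, hF.add hG, fun φ h hφ => ?_⟩
    have h1 : ((u + v : FourierSpace q p lam) : DtDual).eval φ h
        = (u : DtDual).eval φ h + (v : DtDual).eval φ h := rfl
    rw [h1, hu φ h hφ, hv φ h hφ, ← integral_add (integrableOn_test hF.continuousOn φ h hφ)
      (integrableOn_test hG.continuousOn φ h hφ)]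
    simp only [Pi.add_apply, add_mul]
  zero_mem' := ⟨0, differentiableOn_const 0, fun φ h _ => by
    have h1 : ((0 : FourierSpace q p lam) : DtDual).eval φ h = 0 := rfl
    simpa using h1⟩
  smul_mem' := by
    rintro c u ⟨F, hF, hu⟩
    refine ⟨c • F, hF.const_smul c, fun φ h hφ => ?_⟩
    have h1 : ((c • u : FourierSpace q p lam) : DtDual).eval φ h = c * (u : DtDual).eval φ h := rfl
    rw [h1, hu φ h hφ, ← integral_const_mul]
    simp only [Pi.smul_apply, smul_eq_mul, mul_assoc]

/-! ### The operators -/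

/-- `θ_{λ,p}(x) = (p^{λ+1} x^{λ+1} / (2^λ Γ(λ+2)))^{1/p}`, for `x ≥ 0`. -/
def theta (p lam x : ℝ) : ℝ :=
  (p ^ (lam + 1) * x ^ (lam + 1) / (2 ^ lam * Real.Gamma (lam + 2))) ^ (1 / p)

/-- The upper incomplete gamma function `Γ(a, s) = ∫_s^∞ t^{a-1} e^{-t} dt`. -/
def upperGamma (a s : ℝ) : ℝ := ∫ t in Ioi s, t ^ (a - 1) * Real.exp (-t)

/-- `ψ_λ(x, t) = ln (Γ(λ+1) / Γ(λ+1, p x t))`, for `x, t > 0`. -/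
def psi (p lam x t : ℝ) : ℝ :=
  Real.log (Real.Gamma (lam + 1) / upperGamma (lam + 1) (p * x * t))

/-- For `x > 0`, `β_λ(x, ·)` is the inverse of the bijection `ψ_λ(x, ·)` of `(0, ∞)`. -/
def beta (p lam x y : ℝ) : ℝ := Function.invFunOn (psi p lam x) (Ioi 0) y

/-- The operator
`(U_{2,λ} g)(x, y) = θ_{λ,p}(|x|)⁻¹ e^{-y/p + |x| β_λ(|x|, y)} g(x, β_λ(|x|, y))`. -/
def U2 (p lam : ℝ) (g : ℝ → ℝ → ℂ) (x y : ℝ) : ℂ :=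
  (((theta p lam |x|)⁻¹ * Real.exp (-y / p + |x| * beta p lam |x| y) : ℝ) : ℂ) *
    g x (beta p lam |x| y)

/-- The operator `(R_0 φ)(x, y) = χ_+(x) φ(x) e^{-y/p}`. -/
def R0 (p : ℝ) (φ : ℝ → ℂ) (x y : ℝ) : ℂ :=
  (Ioi (0 : ℝ)).indicator φ x * (Real.exp (-y / p) : ℂ)

/-- The operator `(R_0^{-1} g)(x) = χ_+(x) ∫ g(x, y) (e^{-y/p})^{p-1} dy`. -/
def R0inv (p : ℝ) (g : ℝ → ℝ → ℂ) : ℝ → ℂ :=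
  (Ioi (0 : ℝ)).indicator fun x =>
    ∫ y in Ioi (0 : ℝ), g x y * ((Real.exp (-y / p) ^ (p - 1) : ℝ) : ℂ)

/-- The integral `c ∫ φ(ξ) ξ^{(λ+1)/p} e^{iξz} dξ` over `ℝ₊`, with
`c = p^{(λ+1)/p} / (√2 (2^λ Γ(λ+2))^{1/p})`. -/
def paleyWiener (p lam : ℝ) (φ : ℝ → ℂ) (z : ℂ) : ℂ :=
  ((p ^ ((lam + 1) / p) /
      (Real.sqrt 2 * (2 ^ lam * Real.Gamma (lam + 2)) ^ (1 / p)) : ℝ) : ℂ) *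
    ∫ ξ in Ioi (0 : ℝ), φ ξ * ((ξ ^ ((lam + 1) / p) : ℝ) : ℂ) * Complex.exp (Complex.I * ξ * z)

/-- The kernel `e^{-ix \bar ω} e^{-x (p-2) Im ω}`. -/
def inverseKernel (p x : ℝ) (ω : ℂ) : ℂ :=
  Complex.exp (-(Complex.I * x * (starRingEnd ℂ) ω)) *
    (Real.exp (-(x * (p - 2) * ω.im)) : ℂ)

section

variable {q p lam : ℝ} [Fact (1 ≤ q)] [Fact (1 ≤ p)] [Fact (-1 < lam)]

/-- The operator `U_λ = U_{2,λ} U_{1,λ}`. -/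
def Ulam (u : FourierSpace q p lam) : ℝ → ℝ → ℂ := U2 p lam fun x y => U1 u x y

/-- The operator `R_λ = R_0^{-1} U_λ`. -/
def Rlam (u : FourierSpace q p lam) : ℝ → ℂ := R0inv p (Ulam u)

/-- `√(2π) û(x, η)`, where `û` is the distributional Fourier transform of `u` in the first variable:
the meaning, for a general `u` in `ℒ^{q,p}_λ(Π)`, of the integral `∫ u(ξ + iη) e^{-ixξ} dξ`. -/
def lineIntegral (u : FourierSpace q p lam) (x η : ℝ) : ℂ :=
  (Real.sqrt (2 * Real.pi) : ℂ) * ((Real.sqrt Real.pi : ℂ) * U1 u x η)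

end

end

end MixedFourier

open MixedFourier

namespace MixedFourier

noncomputable section

/-! ### The measure `ν_λ` and the exponentials in `L^p(ℝ₊, ν_λ)` -/

/-! The Fourier transform in the first variable turns the Cauchy–Riemann equation into an ordinary
differential equation on each vertical line: if `f` is analytic, then for almost every `x` the fibre
`v = π^{-1/2} f̂(x, ·)` satisfies `v' = -x v` weakly on `ℝ₊`, so `v(y) = c(x) e^{-xy}`. The measure
`ν_λ` is infinite, so for `x ≤ 0` membership in `L^p(ℝ₊, ν_λ)` forces `c(x) = 0`. For `x > 0` the
exponential has norm `θ_{λ,p}(x)⁻¹`, by a Gamma integral. Writing `c = φ θ_{λ,p}` therefore gives a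
fibre of norm `|φ(x)|`, and the `ℒ^{q,p}_λ` norm of `f` is the `L^q(ℝ₊)` norm of `φ`.

Conversely, `φ ↦ φ(x) θ_{λ,p}(x) e^{-xy}` embeds `L^q(ℝ₊)` isometrically into the mixed norm space
(`rayEmbedding`), and `U1` is an isometry onto that space (`U1_surjective`). Fourier inversion on
horizontal lines shows that the resulting distribution is given by the Paley–Wiener integral
(`isGivenBy_paleyWiener`), which is analytic. That every analytic element arises in this way is
`exists_rayEmbedding_eq_U1`. It rests on the weak equation for a fixed test function
(`ae_mul_pairX_eq`), on a null set of `x` common to all test functions (`ae_forall_testFunction`),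
and on solving the equation (`exists_ae_eq_mul_exp`).

The substitution in `U2` takes `θ_{λ,p}(|x|) e^{-|x|t}` to `e^{-y/p}` on each line, and it preserves
null sets in both directions because `ψ_λ(x, ·)` has a positive derivative. This gives `U_λ f = R_0
φ`, and `∫ e^{-y} dy = 1` then gives `R_λ`. The integral formula is the identity `∫ e^{-pxη} dν_λ(η)
= θ_{λ,p}(x)^{-p}`. For its Lebesgue versions the distributional transform is compared with the
classical one by `L¹` inversion on each line; continuity of the classical transform makes the null
set of `x` independent of the line (`ae_forall_integral_line_eq`). -/

theorem ae_nu_iff {lam : ℝ} (hlam : -1 < lam) {P : ℝ → Prop} :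
    (∀ᵐ y ∂(nu lam), P y) ↔ ∀ᵐ y ∂(volume.restrict (Ioi (0 : ℝ))), P y := by
  rw [nu, ae_withDensity_iff (measurable_nuDensity lam).ennreal_ofReal]
  refine ⟨fun h => ?_, fun h => h.mono fun y hy _ => hy⟩
  filter_upwards [h, ae_restrict_mem measurableSet_Ioi] with y hy hy0
  exact hy (by simpa using nuDensity_pos hlam hy0)

theorem integrable_nu_iff {E : Type*} [NormedAddCommGroup E] [NormedSpace ℝ E] {lam : ℝ}
    (hlam : -1 < lam) (f : ℝ → E) :
    Integrable f (nu lam) ↔ IntegrableOn (fun y => nuDensity lam y • f y) (Ioi 0) := by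
  rw [nu, integrable_withDensity_iff_integrable_smul'
    (measurable_nuDensity lam).ennreal_ofReal
    (Filter.Eventually.of_forall fun _ => ENNReal.ofReal_lt_top)]
  refine integrableOn_congr_fun (fun y hy => ?_) measurableSet_Ioi
  simp only [ENNReal.toReal_ofReal (nuDensity_pos hlam hy).le]

theorem integral_nu_smul {E : Type*} [NormedAddCommGroup E] [NormedSpace ℝ E] {lam : ℝ}
    (hlam : -1 < lam) (f : ℝ → E) :
    ∫ y, f y ∂(nu lam) = ∫ y in Ioi (0 : ℝ), nuDensity lam y • f y := by
  rw [nu, integral_withDensity_eq_integral_toReal_smul₀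
    (measurable_nuDensity lam).ennreal_ofReal.aemeasurable
    (Filter.Eventually.of_forall fun _ => ENNReal.ofReal_lt_top)]
  refine setIntegral_congr_fun measurableSet_Ioi fun y hy => ?_
  simp only [ENNReal.toReal_ofReal (nuDensity_pos hlam hy).le]

theorem nuDensity_mul_exp {lam : ℝ} (c : ℝ) {y : ℝ} (hy : y ∈ Ioi (0 : ℝ)) :
    nuDensity lam y • Real.exp (-(c * y)) =
      ((lam + 1) * 2 ^ lam) * (y ^ (lam + 1 - 1) * Real.exp (-(c * y))) := by
  have hy : (0 : ℝ) ≤ y := le_of_lt hy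
  rw [nuDensity, Real.mul_rpow zero_le_two hy, add_sub_cancel_right, smul_eq_mul]
  ring

theorem integrable_exp_nu {lam c : ℝ} (hlam : -1 < lam) (hc : 0 < c) :
    Integrable (fun y => Real.exp (-(c * y))) (nu lam) := by
  rw [integrable_nu_iff hlam, integrableOn_congr_fun (fun y hy => nuDensity_mul_exp c hy)
    measurableSet_Ioi]
  have h := integrableOn_rpow_mul_exp_neg_mul_rpow hlam one_pos hc
  simp only [Real.rpow_one, neg_mul] at h
  rw [add_sub_cancel_right]
  exact h.const_mul _

theorem integral_exp_nu {lam c : ℝ} (hlam : -1 < lam) (hc : 0 < c) :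
    ∫ y, Real.exp (-(c * y)) ∂(nu lam) = 2 ^ lam * Real.Gamma (lam + 2) / c ^ (lam + 1) := by
  rw [integral_nu_smul hlam,
    setIntegral_congr_fun measurableSet_Ioi fun y hy => nuDensity_mul_exp c hy,
    integral_const_mul, Real.integral_rpow_mul_exp_neg_mul_Ioi (by linarith) hc,
    show lam + 2 = (lam + 1) + 1 by ring,
    Real.Gamma_add_one (s := lam + 1) (by linarith),
    one_div, Real.inv_rpow hc.le]
  ring

/-- The density is a multiple of `y ^ λ`, which is not integrable at infinity for `λ > -1`. This is
what excludes frequencies `x ≤ 0`, the constant at `x = 0` included. -/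
theorem nu_univ {lam : ℝ} (hlam : -1 < lam) : nu lam univ = ∞ := by
  by_contra h
  have hfin : IsFiniteMeasure (nu lam) := ⟨lt_top_iff_ne_top.2 h⟩
  have h1 : Integrable (fun _ : ℝ => (1 : ℝ)) (nu lam) := integrable_const 1
  rw [integrable_nu_iff hlam] at h1
  have h2 : IntegrableOn (fun y : ℝ => y ^ lam) (Ioi 1) := by
    refine IntegrableOn.congr_fun ((h1.mono_set (Ioi_subset_Ioi zero_le_one)).const_mul
      ((lam + 1) * 2 ^ lam)⁻¹) (fun y hy => ?_) measurableSet_Ioi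
    have hy : (0 : ℝ) ≤ y := zero_le_one.trans (le_of_lt hy)
    have h2 : (0 : ℝ) < 2 ^ lam := by positivity
    have h3 : lam + 1 ≠ 0 := by linarith
    simp only [nuDensity, Real.mul_rpow zero_le_two hy, smul_eq_mul]
    field_simp
  rw [integrableOn_Ioi_rpow_iff one_pos] at h2
  linarith

theorem theta_pos {p lam x : ℝ} (hp : 1 ≤ p) (hlam : -1 < lam) (hx : 0 < x) :
    0 < theta p lam x := by
  have := Real.Gamma_pos_of_pos (show 0 < lam + 2 by linarith)
  unfold theta
  positivity

theorem theta_eq {p lam x : ℝ} (hp : 1 ≤ p) (hlam : -1 < lam) (hx : 0 < x) :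
    theta p lam x = p ^ ((lam + 1) / p) / (2 ^ lam * Real.Gamma (lam + 2)) ^ (1 / p) *
      x ^ ((lam + 1) / p) := by
  have := Real.Gamma_pos_of_pos (show 0 < lam + 2 by linarith)
  have hp0 : 0 < p := by linarith
  rw [theta, Real.div_rpow (by positivity) (by positivity),
    Real.mul_rpow (by positivity) (by positivity), ← Real.rpow_mul hp0.le, ← Real.rpow_mul hx.le,
    mul_one_div]
  ring

theorem theta_rpow {p lam x : ℝ} (hp : 1 ≤ p) (hlam : -1 < lam) (hx : 0 < x) :
    theta p lam x ^ p = (p * x) ^ (lam + 1) / (2 ^ lam * Real.Gamma (lam + 2)) := by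
  have := Real.Gamma_pos_of_pos (show 0 < lam + 2 by linarith)
  have hp0 : 0 < p := by linarith
  rw [theta, ← Real.rpow_mul (by positivity), one_div, inv_mul_cancel₀ hp0.ne', Real.rpow_one,
    Real.mul_rpow hp0.le hx.le]

/-- The source of the normalization `θ_{λ,p}`: it makes `θ_{λ,p}(x) e^{-x·}` a unit vector of
`L^p(ℝ₊, ν_λ)`. -/
theorem integral_exp_nu_eq_theta {p lam x : ℝ} (hp : 1 ≤ p) (hlam : -1 < lam) (hx : 0 < x) :
    ∫ y, Real.exp (-(p * x * y)) ∂(nu lam) = (theta p lam x ^ p)⁻¹ := by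
  rw [integral_exp_nu hlam (by positivity), theta_rpow hp hlam hx, inv_div]

theorem norm_exp_rpow (p x y : ℝ) :
    ‖(Real.exp (-(x * y)) : ℂ)‖ ^ p = Real.exp (-(p * x * y)) := by
  rw [Complex.norm_real, Real.norm_eq_abs, Real.abs_exp, ← Real.exp_mul]
  ring_nf

theorem memLp_exp {p lam x : ℝ} (hp : 1 ≤ p) (hlam : -1 < lam) (hx : 0 < x) :
    MemLp (fun y : ℝ => (Real.exp (-(x * y)) : ℂ)) (ENNReal.ofReal p) (nu lam) := by
  have hp0 : 0 < p := by linarith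
  rw [← integrable_norm_rpow_iff (by fun_prop) (by simpa using hp0) ENNReal.ofReal_ne_top,
    ENNReal.toReal_ofReal hp0.le]
  simp only [norm_exp_rpow]
  exact integrable_exp_nu hlam (by positivity)

/-- The exponential `y ↦ e^{-xy}` in `L^p(ℝ₊, ν_λ)`, for `x > 0`; zero for `x ≤ 0`. -/
def expVec (p lam : ℝ) [hp : Fact (1 ≤ p)] [hlam : Fact (-1 < lam)] (x : ℝ) : XSpace p lam :=
  if hx : 0 < x then (memLp_exp hp.out hlam.out hx).toLp _ else 0

section

variable {p lam : ℝ} [hp : Fact (1 ≤ p)] [hlam : Fact (-1 < lam)]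

theorem coeFn_expVec {x : ℝ} (hx : 0 < x) :
    ∀ᵐ y ∂(nu lam), expVec p lam x y = (Real.exp (-(x * y)) : ℂ) := by
  rw [expVec, dif_pos hx]
  exact MemLp.coeFn_toLp _

theorem expVec_of_nonpos {x : ℝ} (hx : x ≤ 0) : expVec p lam x = 0 := dif_neg hx.not_gt

theorem norm_expVec {x : ℝ} (hx : 0 < x) : ‖expVec p lam x‖ = (theta p lam x)⁻¹ := by
  have hp0 : 0 < p := by linarith [hp.out]
  have hth := theta_pos hp.out hlam.out hx
  rw [expVec, dif_pos hx, Lp.norm_toLp, MemLp.eLpNorm_eq_integral_rpow_norm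
    (by simpa using hp0) ENNReal.ofReal_ne_top (memLp_exp hp.out hlam.out hx),
    ENNReal.toReal_ofReal hp0.le]
  simp only [norm_exp_rpow]
  rw [integral_exp_nu_eq_theta hp.out hlam.out hx, ENNReal.toReal_ofReal (by positivity),
    ← Real.inv_rpow hth.le, ← Real.rpow_mul (by positivity), mul_inv_cancel₀ hp0.ne',
    Real.rpow_one]

/-- The mean value bound `|a - b| y e^{-cy}`, in which half of the decay is spent on the factor `y`
through `y e^{-cy/2} ≤ 2/c`. The other half remains as a function in `L^p(ℝ₊, ν_λ)`. -/
theorem abs_exp_sub_exp_le {a b c y : ℝ} (hc : 0 < c) (ha : c ≤ a) (hb : c ≤ b) (hy : 0 < y) :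
    |Real.exp (-(a * y)) - Real.exp (-(b * y))| ≤
      |a - b| * (2 / c) * Real.exp (-(c / 2 * y)) := by
  wlog hab : a ≤ b generalizing a b
  · rw [abs_sub_comm, abs_sub_comm a]
    exact this hb ha (le_of_not_ge hab)
  have h1 : Real.exp (-(b * y)) = Real.exp (-(a * y)) * Real.exp (-((b - a) * y)) := by
    rw [← Real.exp_add]; ring_nf
  have h2 : 1 - (b - a) * y ≤ Real.exp (-((b - a) * y)) := by
    have := Real.add_one_le_exp (-((b - a) * y)); linarith
  have h3 : Real.exp (-(a * y)) ≤ Real.exp (-(c / 2 * y)) * Real.exp (-(c / 2 * y)) := by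
    rw [← Real.exp_add]
    exact Real.exp_le_exp.2 (by nlinarith)
  have h4 : y * Real.exp (-(c / 2 * y)) ≤ 2 / c := by
    have h5 := Real.add_one_le_exp (c / 2 * y)
    have h6 : Real.exp (c / 2 * y) * Real.exp (-(c / 2 * y)) = 1 := by
      rw [← Real.exp_add]; simp
    have h7 : c / 2 * y * Real.exp (-(c / 2 * y)) ≤ 1 := by
      rw [← h6]; gcongr; linarith
    rw [le_div_iff₀ hc]; linarith
  have h8 : Real.exp (-((b - a) * y)) ≤ 1 :=
    Real.exp_le_one_iff.2 (by nlinarith)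
  rw [h1, ← mul_one_sub, abs_mul, Real.abs_exp, abs_of_nonneg (by linarith), abs_sub_comm,
    abs_of_nonneg (by linarith : 0 ≤ b - a)]
  have hE := Real.exp_pos (-(c / 2 * y))
  calc Real.exp (-(a * y)) * (1 - Real.exp (-((b - a) * y)))
      ≤ (Real.exp (-(c / 2 * y)) * Real.exp (-(c / 2 * y))) * ((b - a) * y) := by
        gcongr
        linarith
    _ = (b - a) * (y * Real.exp (-(c / 2 * y))) * Real.exp (-(c / 2 * y)) := by ring
    _ ≤ _ := by
        have : 0 ≤ b - a := by linarith
        gcongr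

/-- Local Lipschitz continuity. It supplies the strong measurability needed to regard `x ↦ φ(x) θ(x)
e^{-x·}` as a Bochner measurable function. -/
theorem continuousOn_expVec : ContinuousOn (expVec p lam) (Ioi 0) := by
  have key : ∀ {a b c : ℝ}, 0 < c → c ≤ a → c ≤ b →
      ‖expVec p lam a - expVec p lam b‖ ≤ |a - b| * (2 / c) * ‖expVec p lam (c / 2)‖ := by
    intro a b c hc ha hb
    refine Lp.norm_le_mul_norm_of_ae_le_mul ?_
    have hpos : ∀ᵐ y ∂(nu lam), 0 < y :=
      (ae_nu_iff hlam.out).2 (ae_restrict_mem measurableSet_Ioi)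
    filter_upwards [Lp.coeFn_sub (expVec p lam a) (expVec p lam b),
      coeFn_expVec (p := p) (lam := lam) (hc.trans_le ha),
      coeFn_expVec (p := p) (lam := lam) (hc.trans_le hb),
      coeFn_expVec (p := p) (lam := lam) (half_pos hc), hpos] with y h1 h2 h3 h4 hy
    rw [h1, Pi.sub_apply, h2, h3, h4, ← Complex.ofReal_sub, Complex.norm_real, Complex.norm_real,
      Real.norm_eq_abs, Real.norm_eq_abs, Real.abs_exp]
    exact abs_exp_sub_exp_le hc ha hb hy
  intro b hb
  have hb : 0 < b := hb
  refine ContinuousAt.continuousWithinAt ?_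
  rw [ContinuousAt, tendsto_iff_norm_sub_tendsto_zero]
  have hlim : Filter.Tendsto (fun a => |a - b| * (2 / (b / 2)) * ‖expVec p lam (b / 2 / 2)‖)
      (nhds b) (nhds 0) := by
    have : Continuous fun a => |a - b| * (2 / (b / 2)) * ‖expVec p lam (b / 2 / 2)‖ := by fun_prop
    simpa using this.tendsto b
  refine squeeze_zero' (Filter.Eventually.of_forall fun _ => norm_nonneg _) ?_ hlim
  filter_upwards [lt_mem_nhds (half_lt_self hb)] with a ha
  exact key (half_pos hb) ha.le (half_lt_self hb).le

end

/-! ### The change of variables `y = ψ_λ(x, t)` -/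

theorem integrableOn_upperGamma {a s : ℝ} (ha : 0 < a) (hs : 0 ≤ s) :
    IntegrableOn (fun t => t ^ (a - 1) * Real.exp (-t)) (Ioi s) := by
  have h := Real.GammaIntegral_convergent ha
  simp only [mul_comm (Real.exp _)] at h
  exact h.mono_set (Ioi_subset_Ioi hs)

theorem upperGamma_zero (a : ℝ) (ha : 0 < a) : upperGamma a 0 = Real.Gamma a := by
  simp only [upperGamma, Real.Gamma_eq_integral ha, mul_comm]

theorem upperGamma_eq_sub {a s : ℝ} (ha : 0 < a) (hs : 0 ≤ s) :
    upperGamma a s = Real.Gamma a - ∫ t in (0 : ℝ)..s, t ^ (a - 1) * Real.exp (-t) := by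
  rw [← upperGamma_zero a ha, ← intervalIntegral.integral_Ioi_sub_Ioi
    (integrableOn_upperGamma ha le_rfl) hs]
  simp only [upperGamma, sub_sub_cancel]

theorem intervalIntegrable_upperGamma {a s : ℝ} (ha : 0 < a) (hs : 0 ≤ s) :
    IntervalIntegrable (fun t => t ^ (a - 1) * Real.exp (-t)) volume 0 s := by
  rw [intervalIntegrable_iff_integrableOn_Ioc_of_le hs]
  exact (integrableOn_upperGamma ha le_rfl).mono_set Ioc_subset_Ioi_self

theorem hasDerivAt_upperGamma {a s : ℝ} (ha : 0 < a) (hs : 0 < s) :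
    HasDerivAt (upperGamma a) (-(s ^ (a - 1) * Real.exp (-s))) s := by
  have hcont : ContinuousAt (fun t : ℝ => t ^ (a - 1) * Real.exp (-t)) s :=
    (Real.continuousAt_rpow_const _ _ (Or.inl hs.ne')).mul (by fun_prop)
  have hmeas : Measurable (fun t : ℝ => t ^ (a - 1) * Real.exp (-t)) := by fun_prop
  have h := (intervalIntegral.integral_hasDerivAt_right
    (intervalIntegrable_upperGamma ha hs.le)
    (hmeas.stronglyMeasurable.stronglyMeasurableAtFilter) hcont).const_sub (Real.Gamma a)
  refine h.congr_of_eventuallyEq ?_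
  filter_upwards [lt_mem_nhds hs] with t ht
  exact upperGamma_eq_sub ha ht.le

theorem upperGamma_pos {a s : ℝ} (ha : 0 < a) (hs : 0 ≤ s) : 0 < upperGamma a s := by
  refine (setIntegral_pos_iff_support_of_nonneg_ae ?_ (integrableOn_upperGamma ha hs)).2 ?_
  · filter_upwards [ae_restrict_mem measurableSet_Ioi] with t ht
    have : 0 < t := hs.trans_lt ht
    simp only [Pi.zero_apply]
    positivity
  · have : (Function.support fun t : ℝ => t ^ (a - 1) * Real.exp (-t)) ∩ Ioi s = Ioi s := by
      refine inter_eq_right.2 fun t ht => ?_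
      have : 0 < t := hs.trans_lt ht
      exact (by positivity : (0 : ℝ) < t ^ (a - 1) * Real.exp (-t)).ne'
    rw [this]
    simp

theorem continuousOn_upperGamma {a : ℝ} (ha : 0 < a) (s : ℝ) :
    ContinuousOn (upperGamma a) (Icc 0 s) := by
  have h : ContinuousOn (fun u => ∫ t in Icc 0 u, t ^ (a - 1) * Real.exp (-t)) (Icc 0 s) := by
    refine intervalIntegral.continuousOn_primitive_Icc ?_
    rw [integrableOn_Icc_iff_integrableOn_Ioc]
    exact (integrableOn_upperGamma ha le_rfl).mono_set Ioc_subset_Ioi_self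
  refine ((continuousOn_const (c := Real.Gamma a)).sub h).congr fun u hu => ?_
  simp only [Pi.sub_apply, upperGamma_eq_sub ha hu.1, intervalIntegral.integral_of_le hu.1,
    integral_Icc_eq_integral_Ioc]

theorem tendsto_upperGamma {a : ℝ} (ha : 0 < a) :
    Filter.Tendsto (upperGamma a) Filter.atTop (nhds 0) := by
  have h := (intervalIntegral_tendsto_integral_Ioi 0 (integrableOn_upperGamma ha le_rfl)
    Filter.tendsto_id).const_sub (Real.Gamma a)
  have h0 : Real.Gamma a - ∫ t in Ioi (0 : ℝ), t ^ (a - 1) * Real.exp (-t) = 0 := by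
    rw [sub_eq_zero]; exact (upperGamma_zero a ha).symm
  rw [h0] at h
  refine h.congr' ?_
  filter_upwards [Filter.eventually_ge_atTop 0] with s hs
  exact (upperGamma_eq_sub ha hs).symm

theorem upperGamma_lt_Gamma {a s : ℝ} (ha : 0 < a) (hs : 0 < s) :
    upperGamma a s < Real.Gamma a := by
  rw [upperGamma_eq_sub ha hs.le]
  refine sub_lt_self _ ?_
  refine intervalIntegral.intervalIntegral_pos_of_pos_on
    (intervalIntegrable_upperGamma ha hs.le) (fun t ht => ?_) hs
  have : 0 < t := ht.1
  positivity

section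

variable {p lam x : ℝ} (hp : 1 ≤ p) (hlam : -1 < lam) (hx : 0 < x)
include hp hlam hx

theorem exists_hasDerivAt_psi {t : ℝ} (ht : 0 < t) :
    ∃ d, 0 < d ∧ HasDerivAt (psi p lam x) d t := by
  have ha : 0 < lam + 1 := by linarith
  have hp0 : 0 < p := by linarith
  have hs : 0 < p * x * t := by positivity
  have hG := upperGamma_pos ha hs.le
  have hG0 := Real.Gamma_pos_of_pos ha
  have h1 : HasDerivAt (fun t => upperGamma (lam + 1) (p * x * t))
      (-((p * x * t) ^ (lam + 1 - 1) * Real.exp (-(p * x * t))) * (p * x)) t := by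
    have h2 : HasDerivAt (fun t => p * x * t) (p * x) t := by
      simpa using (hasDerivAt_id t).const_mul (p * x)
    exact (hasDerivAt_upperGamma ha hs).comp t h2
  have h3 := ((hasDerivAt_const t (Real.Gamma (lam + 1))).div h1 hG.ne').log
    (div_pos hG0 hG).ne'
  refine ⟨_, ?_, h3⟩
  simp only [Pi.div_apply, zero_mul, zero_sub, neg_mul, mul_neg, neg_neg]
  positivity

theorem strictMonoOn_psi : StrictMonoOn (psi p lam x) (Ioi 0) := by
  refine strictMonoOn_of_deriv_pos (convex_Ioi 0) (fun t ht => ?_) fun t ht => ?_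
  · obtain ⟨d, -, hd⟩ := exists_hasDerivAt_psi hp hlam hx ht
    exact hd.continuousAt.continuousWithinAt
  · rw [interior_Ioi] at ht
    obtain ⟨d, hd0, hd⟩ := exists_hasDerivAt_psi hp hlam hx ht
    rwa [hd.deriv]

theorem bijOn_psi : BijOn (psi p lam x) (Ioi 0) (Ioi 0) := by
  have ha : 0 < lam + 1 := by linarith
  have hp0 : 0 < p := by linarith
  have hG0 := Real.Gamma_pos_of_pos ha
  refine ⟨fun t ht => ?_, (strictMonoOn_psi hp hlam hx).injOn, fun y hy => ?_⟩
  · have ht : 0 < t := ht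
    have hs : 0 < p * x * t := by positivity
    exact Real.log_pos ((one_lt_div (upperGamma_pos ha hs.le)).2
      (upperGamma_lt_Gamma ha hs))
  · have hy : 0 < y := hy
    -- Surjectivity: `ψ_λ(x, t) = y` means `Γ(λ+1, pxt) = Γ(λ+1) e^{-y}`, which the intermediate
    -- value theorem solves for `s = pxt`.
    have hv : 0 < Real.Gamma (lam + 1) * Real.exp (-y) := by positivity
    obtain ⟨S, hS, hS0⟩ := (((tendsto_upperGamma ha).eventually (gt_mem_nhds hv)).and
      (Filter.eventually_ge_atTop 0)).exists
    have hmem : Real.Gamma (lam + 1) * Real.exp (-y) ∈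
        Icc (upperGamma (lam + 1) S) (upperGamma (lam + 1) 0) := by
      refine ⟨hS.le, ?_⟩
      rw [upperGamma_zero _ ha]
      exact mul_le_of_le_one_right hG0.le (Real.exp_le_one_iff.2 (by linarith))
    obtain ⟨s, hs, hsy⟩ := intermediate_value_Icc' hS0 (continuousOn_upperGamma ha S) hmem
    have hs0 : 0 < s := by
      refine lt_of_le_of_ne hs.1 fun h0 => ?_
      rw [← h0, upperGamma_zero _ ha] at hsy
      have : Real.exp (-y) < 1 := Real.exp_lt_one_iff.2 (by linarith)
      nlinarith
    refine ⟨s / (p * x), div_pos hs0 (by positivity), ?_⟩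
    rw [psi, mul_div_cancel₀ _ (by positivity), hsy, div_mul_cancel_left₀ hG0.ne', Real.exp_neg,
      inv_inv, Real.log_exp]

theorem invOn_beta : InvOn (beta p lam x) (psi p lam x) (Ioi 0) (Ioi 0) :=
  (bijOn_psi hp hlam hx).invOn_invFunOn

/-- The change of variables formula for the indicator of a measurable null set `N` gives `∫ |ψ'|
1_N(ψ) = 0`. Since `ψ' > 0`, the preimage of `N` is null. -/
theorem ae_comp_psi {P : ℝ → Prop} (h : ∀ᵐ y ∂(volume.restrict (Ioi (0 : ℝ))), P y) :
    ∀ᵐ t ∂(volume.restrict (Ioi (0 : ℝ))), P (psi p lam x t) := by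
  have hd : ∀ t ∈ Ioi (0 : ℝ),
      HasDerivWithinAt (psi p lam x) (deriv (psi p lam x) t) (Ioi 0) t := fun t ht => by
    obtain ⟨d, -, hd⟩ := exists_hasDerivAt_psi hp hlam hx ht
    exact hd.differentiableAt.hasDerivAt.hasDerivWithinAt
  have hbij := bijOn_psi hp hlam hx
  set N := toMeasurable (volume.restrict (Ioi (0 : ℝ))) {y | ¬P y}
  have hN : volume.restrict (Ioi (0 : ℝ)) N = 0 := by
    rw [measure_toMeasurable]; exact h
  have hcv := lintegral_image_eq_lintegral_abs_deriv_mul measurableSet_Ioi hd hbij.injOn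
    (N.indicator 1)
  rw [hbij.image_eq, lintegral_indicator_one (measurableSet_toMeasurable _ _), hN, eq_comm,
    lintegral_eq_zero_iff'] at hcv
  · filter_upwards [hcv, ae_restrict_mem measurableSet_Ioi] with t ht ht0
    by_contra hP
    have hmem : psi p lam x t ∈ N := subset_toMeasurable _ _ hP
    obtain ⟨d, hd0, hd⟩ := exists_hasDerivAt_psi hp hlam hx ht0
    simp [hmem, hd.deriv, hd0.ne'] at ht
  · have hc : ContinuousOn (psi p lam x) (Ioi 0) := fun t ht => (hd t ht).continuousWithinAt
    exact (measurable_deriv _).abs.ennreal_ofReal.aemeasurable.mul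
      ((measurable_one.indicator (measurableSet_toMeasurable _ _)).comp_aemeasurable
        (hc.aemeasurable measurableSet_Ioi))

/-- If `P` fails at `β(y)`, then `y = ψ(β(y))` lies in the image of a null set under a
differentiable map, and such an image is null. -/
theorem ae_comp_beta {P : ℝ → Prop} (h : ∀ᵐ t ∂(volume.restrict (Ioi (0 : ℝ))), P t) :
    ∀ᵐ y ∂(volume.restrict (Ioi (0 : ℝ))), P (beta p lam x y) := by
  have hbij := bijOn_psi hp hlam hx
  have hinv := invOn_beta hp hlam hx
  rw [ae_restrict_iff' measurableSet_Ioi] at h ⊢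
  have h0 : volume {t | ¬(t ∈ Ioi (0 : ℝ) → P t)} = 0 := h
  have hdiff : DifferentiableOn ℝ (psi p lam x) {t | ¬(t ∈ Ioi (0 : ℝ) → P t)} := fun t ht => by
    simp only [mem_ofPred_eq, Classical.not_imp] at ht
    obtain ⟨d, -, hd⟩ := exists_hasDerivAt_psi hp hlam hx ht.1
    exact hd.differentiableAt.differentiableWithinAt
  refine measure_mono_null (fun y hy => ?_)
    (addHaar_image_eq_zero_of_differentiableOn_of_addHaar_eq_zero volume hdiff h0)
  simp only [mem_compl_iff, mem_ofPred_eq, Classical.not_imp] at hy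
  refine ⟨beta p lam x y, ?_, hinv.2 hy.1⟩
  simp only [mem_ofPred_eq, Classical.not_imp]
  exact ⟨hbij.surjOn.mapsTo_invFunOn hy.1, hy.2⟩

/-- On a vertical line, `U_{2,λ}` takes `c θ_{λ,p}(|x|) e^{-|x|t}`, and nothing else, to
`c e^{-y/p}`. -/
theorem ae_weight_mul_comp_beta_eq_iff (c : ℂ) (v : ℝ → ℂ) :
    (∀ᵐ y ∂(volume.restrict (Ioi (0 : ℝ))),
      (((theta p lam x)⁻¹ * Real.exp (-y / p + x * beta p lam x y) : ℝ) : ℂ) *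
        v (beta p lam x y) = c * (Real.exp (-y / p) : ℂ)) ↔
    ∀ᵐ t ∂(volume.restrict (Ioi (0 : ℝ))),
      v t = c * (theta p lam x : ℂ) * (Real.exp (-(x * t)) : ℂ) := by
  have hth := theta_pos hp hlam hx
  -- Here `y` and `t` are unrelated: the factor `e^{-y/p}` cancels, leaving a condition on `t`
  -- alone, which is then transported along `t = β_λ(x, y)`.
  have key : ∀ y t : ℝ, ((((theta p lam x)⁻¹ * Real.exp (-y / p + x * t) : ℝ) : ℂ) * v t =
      c * (Real.exp (-y / p) : ℂ)) ↔
      v t = c * (theta p lam x : ℂ) * (Real.exp (-(x * t)) : ℂ) := by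
    intro y t
    have h1 : (theta p lam x : ℂ) ≠ 0 := by exact_mod_cast hth.ne'
    have h2 : (Real.exp (-y / p) : ℂ) ≠ 0 := by exact_mod_cast (Real.exp_pos _).ne'
    have h3 : (Real.exp (x * t) : ℂ) ≠ 0 := by exact_mod_cast (Real.exp_pos _).ne'
    rw [Real.exp_add, Real.exp_neg]
    push_cast only [Complex.ofReal_mul, Complex.ofReal_inv]
    field_simp
  simp only [key]
  refine ⟨fun h => ?_, fun h => ae_comp_beta hp hlam hx h⟩
  filter_upwards [ae_comp_psi hp hlam hx h, ae_restrict_mem measurableSet_Ioi] with t ht ht0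
  rwa [(invOn_beta hp hlam hx).1 ht0] at ht

end

/-! ### The Fourier transform on the line -/

theorem sqrt_two_pi_ne_zero : (Real.sqrt (2 * Real.pi) : ℂ) ≠ 0 := by
  have : Real.sqrt (2 * Real.pi) ≠ 0 := by positivity
  exact_mod_cast this

theorem sqrt_two_pi_mul_self :
    (Real.sqrt (2 * Real.pi) : ℂ) * (Real.sqrt (2 * Real.pi) : ℂ) = 2 * Real.pi := by
  rw [← Complex.ofReal_mul, Real.mul_self_sqrt (by positivity)]
  push_cast
  ring

theorem fourierS_eq (φ : 𝓢(ℝ, ℂ)) (u : ℝ) :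
    fourierS φ u = (Real.sqrt (2 * Real.pi) : ℂ)⁻¹ *
      (FourierTransform.fourier (φ : ℝ → ℂ)) (u * (2 * Real.pi)⁻¹) := by
  simp [fourierS, dilation, SchwartzMap.fourier_coe, mul_comm, -Nat.ofNat_nonneg, -Real.sqrt_mul]

/-- The inverse of the Fourier transform `fourierS` on `𝒮(ℝ)`. -/
def fourierSInv : 𝓢(ℝ, ℂ) →L[ℂ] 𝓢(ℝ, ℂ) :=
  (Real.sqrt (2 * Real.pi) : ℂ) •
    (((FourierTransform.fourierCLE ℂ 𝓢(ℝ, ℂ)).symm : 𝓢(ℝ, ℂ) →L[ℂ] 𝓢(ℝ, ℂ)) ∘L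
      SchwartzMap.compCLMOfContinuousLinearEquiv ℂ dilation.symm)

theorem fourierSInv_fourierS (φ : 𝓢(ℝ, ℂ)) : fourierSInv (fourierS φ) = φ := by
  have h : SchwartzMap.compCLMOfContinuousLinearEquiv ℂ dilation.symm (fourierS φ) =
      (Real.sqrt (2 * Real.pi) : ℂ)⁻¹ • FourierTransform.fourier φ := by
    ext x
    simp [fourierS]
  change (Real.sqrt (2 * Real.pi) : ℂ) • (FourierTransform.fourierCLE ℂ 𝓢(ℝ, ℂ)).symm
    (SchwartzMap.compCLMOfContinuousLinearEquiv ℂ dilation.symm (fourierS φ)) = φ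
  rw [h, map_smul, FourierTransform.fourierCLE_symm_apply,
    FourierTransform.fourierInv_fourier_eq, smul_inv_smul₀ sqrt_two_pi_ne_zero]

/-- Fourier inversion, brought to the present normalization by the substitution `u = 2πv`. -/
theorem integral_exp_mul_fourierS (φ : 𝓢(ℝ, ℂ)) (x : ℝ) :
    ∫ u : ℝ, fourierS φ u * Complex.exp (Complex.I * x * u) =
      (Real.sqrt (2 * Real.pi) : ℂ) * φ x := by
  have hinv : φ x = ∫ v : ℝ, Complex.exp (↑(2 * Real.pi * (v * x)) * Complex.I) •
      (FourierTransform.fourier (φ : ℝ → ℂ)) v := by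
    have h : FourierTransform.fourierInv (FourierTransform.fourier φ : 𝓢(ℝ, ℂ)) = φ :=
      FourierTransform.fourierInv_fourier_eq φ
    rw [← congrArg (fun ψ : 𝓢(ℝ, ℂ) => ψ x) h, SchwartzMap.fourierInv_coe, Real.fourierInv_eq']
    simp [SchwartzMap.fourier_coe, mul_comm]
  have hpi : (2 * Real.pi)⁻¹ ≠ 0 := by positivity
  have hsub := Measure.integral_comp_mul_right (fun v : ℝ =>
    Complex.exp (↑(2 * Real.pi * (v * x)) * Complex.I) •
      (FourierTransform.fourier (φ : ℝ → ℂ)) v) (2 * Real.pi)⁻¹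
  rw [← hinv, inv_inv, abs_of_pos (by positivity)] at hsub
  have h1 : ∀ u : ℝ, fourierS φ u * Complex.exp (Complex.I * x * u) =
      (Real.sqrt (2 * Real.pi) : ℂ)⁻¹ *
      (Complex.exp (↑(2 * Real.pi * (u * (2 * Real.pi)⁻¹ * x)) * Complex.I) •
      (FourierTransform.fourier (φ : ℝ → ℂ)) (u * (2 * Real.pi)⁻¹)) := by
    intro u
    have h2 : (2 * Real.pi * (u * (2 * Real.pi)⁻¹ * x)) = u * x := by field_simp
    rw [fourierS_eq, h2, smul_eq_mul, Complex.ofReal_mul]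
    ring_nf
  simp only [h1]
  rw [integral_const_mul, hsub, Complex.real_smul, ← mul_assoc]
  congr 1
  push_cast
  rw [← sqrt_two_pi_mul_self, inv_mul_cancel_left₀ sqrt_two_pi_ne_zero]

/-- Multiplication by the variable on `𝒮(ℝ)`. -/
def mulVar : 𝓢(ℝ, ℂ) →L[ℂ] 𝓢(ℝ, ℂ) := SchwartzMap.smulLeftCLM ℂ fun x : ℝ => (x : ℂ)

theorem mulVar_apply (φ : 𝓢(ℝ, ℂ)) (x : ℝ) : mulVar φ x = x * φ x := by
  rw [mulVar, SchwartzMap.smulLeftCLM_apply_apply (by fun_prop), smul_eq_mul]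

/-- This is how the `x`-derivative in the Cauchy–Riemann equation becomes multiplication by the
frequency. -/
theorem derivCLM_fourierS (φ : 𝓢(ℝ, ℂ)) :
    SchwartzMap.derivCLM ℂ ℂ (fourierS φ) = -Complex.I • fourierS (mulVar φ) := by
  ext u
  have h1 : Integrable fun x : ℝ => x • φ x := by
    refine (mulVar φ).integrable.congr (Filter.Eventually.of_forall fun x => ?_)
    simp [mulVar_apply]
  have h2 := Real.hasDerivAt_fourier φ.integrable h1 (u * (2 * Real.pi)⁻¹)
  have h3 : HasDerivAt (fun u : ℝ => u * (2 * Real.pi)⁻¹) (2 * Real.pi)⁻¹ u := by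
    simpa using (hasDerivAt_id u).mul_const (2 * Real.pi)⁻¹
  have h4 := (h2.scomp u h3).const_mul (Real.sqrt (2 * Real.pi) : ℂ)⁻¹
  have h5 : ⇑(fourierS φ) = fun u => (Real.sqrt (2 * Real.pi) : ℂ)⁻¹ *
      (FourierTransform.fourier (φ : ℝ → ℂ)) (u * (2 * Real.pi)⁻¹) :=
    funext (fourierS_eq φ)
  have h6 : (fun x : ℝ => (-2 * Real.pi * Complex.I * x) • φ x) =
      (-2 * Real.pi * Complex.I) • ⇑(mulVar φ) := by
    ext x
    simp [mulVar_apply, mul_assoc]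
  rw [SchwartzMap.derivCLM_apply, h5]
  refine h4.deriv.trans ?_
  have hpi : (Real.pi : ℂ) ≠ 0 := by exact_mod_cast Real.pi_ne_zero
  have h7 : (-2 * Real.pi * Complex.I) • ⇑(mulVar φ) =
    ⇑((-2 * Real.pi * Complex.I) • mulVar φ) := rfl
  rw [smul_apply, fourierS_eq, h6, h7, ← SchwartzMap.fourier_coe,
    FourierTransform.fourier_smul, smul_apply, SchwartzMap.fourier_coe,
    Complex.real_smul]
  simp only [smul_eq_mul]
  push_cast
  field_simp

theorem integrable_mul_mul_exp {f g : ℝ → ℂ} {μ ν : Measure ℝ} [SFinite μ] [SFinite ν]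
    (hf : Integrable f μ) (hg : Integrable g ν) (s : ℝ) :
    Integrable (fun z : ℝ × ℝ => f z.1 * (g z.2 * Complex.exp (Complex.I * s * z.1 * z.2)))
      (μ.prod ν) := by
  refine (hf.mul_prod hg).mono ?_ (Filter.Eventually.of_forall fun z => ?_)
  · exact hf.1.comp_fst.mul (hg.1.comp_snd.mul (by fun_prop))
  · have : ‖Complex.exp (Complex.I * s * z.1 * z.2)‖ = 1 := by
      rw [show Complex.I * s * z.1 * z.2 = ((s * z.1 * z.2 : ℝ) : ℂ) * Complex.I by
        push_cast; ring]
      exact Complex.norm_exp_ofReal_mul_I _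
    simp [this]

/-- The multiplication formula, by Fubini. The parameter `s` is taken to be `1` or `-1`, to cover
both signs of the exponent. -/
theorem integral_mul_integral_exp_swap {f g : ℝ → ℂ} {μ ν : Measure ℝ} [SFinite μ] [SFinite ν]
    (hf : Integrable f μ) (hg : Integrable g ν) (s : ℝ) :
    ∫ x : ℝ, f x * ∫ ξ : ℝ, g ξ * Complex.exp (Complex.I * s * x * ξ) ∂ν ∂μ =
      ∫ ξ : ℝ, g ξ * ∫ x : ℝ, f x * Complex.exp (Complex.I * s * x * ξ) ∂μ ∂ν := by
  simp only [← integral_const_mul]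
  rw [integral_integral_swap (integrable_mul_mul_exp hf hg s)]
  refine integral_congr_ae (Filter.Eventually.of_forall fun ξ =>
    integral_congr_ae (Filter.Eventually.of_forall fun x => ?_))
  simp only
  ring

theorem continuous_integral_mul_exp {G : ℝ → ℂ} (hG : Integrable G) :
    Continuous fun x : ℝ => ∫ ξ : ℝ, G ξ * Complex.exp (-(Complex.I * x * ξ)) := by
  refine continuous_of_dominated (bound := fun ξ => ‖G ξ‖)
    (fun x => hG.1.mul (by fun_prop)) (fun x => Filter.Eventually.of_forall fun ξ => ?_) hG.norm
    (Filter.Eventually.of_forall fun ξ => by fun_prop)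
  rw [norm_mul, show -(Complex.I * x * ξ) = ((-(x * ξ) : ℝ) : ℂ) * Complex.I by
      push_cast; ring, Complex.norm_exp_ofReal_mul_I, mul_one]

/-- Fourier inversion for integrable functions with integrable inverse transform. -/
theorem ae_eq_of_eq_integral_exp {k G : ℝ → ℂ} (hk : Integrable k) (hG : Integrable G)
    (h : ∀ ξ : ℝ, G ξ = ∫ x : ℝ, k x * Complex.exp (Complex.I * x * ξ)) :
    ∀ᵐ x : ℝ, ∫ ξ : ℝ, G ξ * Complex.exp (-(Complex.I * x * ξ)) = 2 * Real.pi * k x := by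
  refine ae_eq_of_integral_contDiff_smul_eq
    (continuous_integral_mul_exp hG).locallyIntegrable
    (hk.const_mul _).locallyIntegrable fun g hg hgc => ?_
  have hg1 : HasCompactSupport (Complex.ofRealCLM ∘ g) := hgc.comp_left rfl
  have hg2 : ContDiff ℝ ((⊤ : ℕ∞) : WithTop ℕ∞) (Complex.ofRealCLM ∘ g) :=
    Complex.ofRealCLM.contDiff.comp hg
  set φ : 𝓢(ℝ, ℂ) := hg1.toSchwartzMap hg2
  have hφ : ∀ x (w : ℂ), g x • w = φ x * w := fun x w => Complex.real_smul
  simp only [hφ]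
  have h1 := integral_mul_integral_exp_swap (φ.integrable (μ := volume)) hG (-1)
  have h2 := integral_mul_integral_exp_swap hk ((fourierS φ).integrable (μ := volume)) 1
  have e1 : ∀ x ξ : ℝ, Complex.exp (Complex.I * ((-1 : ℝ) : ℂ) * x * ξ) =
      Complex.exp (-(Complex.I * x * ξ)) := fun x ξ => by
    congr 1; push_cast; ring
  simp only [e1] at h1
  simp only [Complex.ofReal_one, mul_one] at h2
  rw [h1]
  have h3 : ∀ ξ : ℝ, ∫ x : ℝ, φ x * Complex.exp (-(Complex.I * x * ξ)) =
      (Real.sqrt (2 * Real.pi) : ℂ) * fourierS φ ξ := fun ξ => by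
    rw [fourierS_apply, mul_inv_cancel_left₀ sqrt_two_pi_ne_zero]
    refine integral_congr_ae (Filter.Eventually.of_forall fun x => ?_)
    simp only
    rw [mul_comm, mul_right_comm]
  have h4 : ∀ x : ℝ, ∫ ξ : ℝ, fourierS φ ξ * Complex.exp (Complex.I * x * ξ) =
      (Real.sqrt (2 * Real.pi) : ℂ) * φ x := fun x => integral_exp_mul_fourierS φ x
  simp only [h3]
  simp only [h4, ← h] at h2
  calc ∫ ξ, G ξ * ((Real.sqrt (2 * Real.pi) : ℂ) * fourierS φ ξ)
      = (Real.sqrt (2 * Real.pi) : ℂ) * ∫ ξ, fourierS φ ξ * G ξ := by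
        rw [← integral_const_mul]; congr 1; ext ξ; ring
    _ = (Real.sqrt (2 * Real.pi) : ℂ) * ∫ x, k x * ((Real.sqrt (2 * Real.pi) : ℂ) * φ x) := by
        rw [h2]
    _ = _ := by
        rw [← integral_const_mul]; congr 1; ext x
        rw [← sqrt_two_pi_mul_self]; ring

/-! ### Compactly supported functions are dense in `𝒮(ℝ)` -/

/-- For `i = 0` the difference vanishes when `|x| ≤ n + 1`, and elsewhere it is at most `1 ≤ (1 +
|x|)/(n + 1)`. For `i ≥ 1` each derivative brings out a factor `(n + 1)⁻¹`. The price of a uniform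
rate is the weight `1 + |x|`, that is, one more power of `x` in the Schwartz seminorms. -/
theorem exists_bound_iteratedFDeriv_cutoff (χ : ContDiffBump (0 : ℝ)) (hχ : χ.rIn = 1) (i : ℕ) :
    ∃ M : ℝ, 0 ≤ M ∧ ∀ (n : ℕ) (x : ℝ),
      ‖iteratedFDeriv ℝ i (fun y : ℝ => χ ((n + 1 : ℝ)⁻¹ * y) - 1) x‖ ≤
        M * (1 + ‖x‖) * (n + 1 : ℝ)⁻¹ := by
  rcases Nat.eq_zero_or_pos i with rfl | hi
  · refine ⟨1, zero_le_one, fun n x => ?_⟩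
    have hn : (0 : ℝ) < n + 1 := by positivity
    rw [norm_iteratedFDeriv_zero, one_mul]
    by_cases hx : ‖x‖ ≤ n + 1
    · have : χ ((n + 1 : ℝ)⁻¹ * x) = 1 := χ.one_of_mem_closedBall (by
        rw [hχ, mem_closedBall_zero_iff, norm_mul, norm_inv, Real.norm_of_nonneg hn.le,
          inv_mul_le_iff₀ hn]
        linarith)
      rw [this, sub_self, norm_zero]
      positivity
    · have h1 : ‖χ ((n + 1 : ℝ)⁻¹ * x) - 1‖ ≤ 1 := by
        rw [Real.norm_eq_abs, abs_sub_comm, abs_of_nonneg (sub_nonneg.2 χ.le_one)]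
        linarith [χ.nonneg' ((n + 1 : ℝ)⁻¹ * x)]
      refine h1.trans ?_
      rw [← div_eq_mul_inv, one_le_div hn]
      linarith
  · obtain ⟨M, hM⟩ := (χ.contDiff (n := i)).continuous_iteratedFDeriv (m := i) le_rfl
      |>.bounded_above_of_compact_support (χ.hasCompactSupport.iteratedFDeriv i)
    refine ⟨M, (norm_nonneg _).trans (hM 0), fun n x => ?_⟩
    have hn : (0 : ℝ) < n + 1 := by positivity
    have hn1 : (n + 1 : ℝ)⁻¹ ≤ 1 := inv_le_one_of_one_le₀ (by linarith [n.cast_nonneg (α := ℝ)])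
    have hd : iteratedDeriv i (fun y : ℝ => χ ((n + 1 : ℝ)⁻¹ * y) - 1) x =
        (n + 1 : ℝ)⁻¹ ^ i * iteratedDeriv i χ ((n + 1 : ℝ)⁻¹ * x) := by
      rw [← congrFun (iteratedDeriv_comp_const_mul χ.contDiff ((n + 1 : ℝ)⁻¹)) x]
      obtain ⟨j, rfl⟩ := Nat.exists_eq_succ_of_ne_zero hi.ne'
      simp only [Nat.succ_eq_add_one, iteratedDeriv_succ', deriv_sub_const_fun]
    rw [norm_iteratedFDeriv_eq_norm_iteratedDeriv, hd, norm_mul,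
      ← norm_iteratedFDeriv_eq_norm_iteratedDeriv, norm_pow, norm_inv, Real.norm_of_nonneg hn.le]
    have h1 : (n + 1 : ℝ)⁻¹ ^ i ≤ (n + 1 : ℝ)⁻¹ :=
      pow_le_of_le_one (by positivity) hn1 hi.ne'
    have hM0 := (norm_nonneg _).trans (hM 0)
    calc (n + 1 : ℝ)⁻¹ ^ i * ‖iteratedFDeriv ℝ i χ ((n + 1 : ℝ)⁻¹ * x)‖
        ≤ (n + 1 : ℝ)⁻¹ * M := by gcongr; exact hM _
      _ ≤ (n + 1 : ℝ)⁻¹ * (M * (1 + ‖x‖)) := by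
        gcongr
        exact le_mul_of_one_le_right hM0 (by linarith [norm_nonneg x])
      _ = _ := mul_comm _ _

/-- `IsGivenBy` tests only against compactly supported `φ`, whereas the Fourier transform leaves
that class; this density bridges the gap. -/
theorem exists_tendsto_hasCompactSupport (φ : 𝓢(ℝ, ℂ)) :
    ∃ Φ : ℕ → 𝓢(ℝ, ℂ), (∀ n, HasCompactSupport (Φ n)) ∧
      Filter.Tendsto Φ Filter.atTop (nhds φ) := by
  let χ : ContDiffBump (0 : ℝ) := ⟨1, 2, one_pos, one_lt_two⟩
  let c : ℕ → ℝ → ℝ := fun n y => χ ((n + 1 : ℝ)⁻¹ * y)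
  have hcs : ∀ n, ContDiff ℝ ((⊤ : ℕ∞) : WithTop ℕ∞) (c n) := fun n =>
    χ.contDiff.comp (contDiff_const.mul contDiff_id)
  have hcc : ∀ n, HasCompactSupport (c n) := fun n => by
    have hn : (n + 1 : ℝ)⁻¹ ≠ 0 := by positivity
    exact χ.hasCompactSupport.comp_homeomorph (Homeomorph.mulLeft₀ _ hn)
  have h1 : ∀ n, HasCompactSupport fun x => c n x • φ x := fun n => (hcc n).smul_right
  have h2 : ∀ n, ContDiff ℝ ((⊤ : ℕ∞) : WithTop ℕ∞) fun x => c n x • φ x := fun n =>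
    (hcs n).smul (φ.smooth _)
  refine ⟨fun n => (h1 n).toSchwartzMap (h2 n), h1, ?_⟩
  rw [(schwartz_withSeminorms ℝ ℝ ℂ).tendsto_nhds]
  rintro ⟨k, m⟩ ε hε
  choose M hM0 hM using exists_bound_iteratedFDeriv_cutoff χ rfl
  -- The Leibniz rule, with the weight `1 + |x|` of the cutoff bound split between the seminorms of
  -- orders `k` and `k + 1`.
  set C : ℝ := ∑ i ∈ Finset.range (m + 1), (m.choose i : ℝ) * (M i *
    (SchwartzMap.seminorm ℝ k (m - i) φ + SchwartzMap.seminorm ℝ (k + 1) (m - i) φ)) with hC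
  have hC0 : 0 ≤ C := Finset.sum_nonneg fun i _ => by
    have := hM0 i
    positivity
  have hbound : ∀ n : ℕ, SchwartzMap.seminorm ℝ k m ((h1 n).toSchwartzMap (h2 n) - φ) ≤
      C * (n + 1 : ℝ)⁻¹ := by
    intro n
    refine SchwartzMap.seminorm_le_bound ℝ k m _ (by positivity) fun x => ?_
    have hfun : ⇑((h1 n).toSchwartzMap (h2 n) - φ) = fun x => (c n x - 1) • φ x := by
      ext x
      change c n x • φ x - φ x = _
      rw [sub_smul, one_smul]
    have hl := norm_iteratedFDeriv_smul_le (𝕜 := ℝ) (f := fun x => c n x - 1) (g := φ)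
      ((hcs n).sub contDiff_const) (φ.smooth _) x (n := m) (mod_cast le_top)
    rw [hfun]
    refine (mul_le_mul_of_nonneg_left hl (by positivity)).trans ?_
    rw [Finset.mul_sum, hC, Finset.sum_mul]
    refine Finset.sum_le_sum fun i _ => ?_
    have hs1 := SchwartzMap.le_seminorm ℝ k (m - i) φ x
    have hs2 := SchwartzMap.le_seminorm ℝ (k + 1) (m - i) φ x
    have hMi := hM0 i
    have hn : (0 : ℝ) ≤ (n + 1 : ℝ)⁻¹ := by positivity
    calc ‖x‖ ^ k * ((m.choose i : ℝ) * ‖iteratedFDeriv ℝ i (fun x => c n x - 1) x‖ *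
          ‖iteratedFDeriv ℝ (m - i) φ x‖)
        ≤ ‖x‖ ^ k * ((m.choose i : ℝ) * (M i * (1 + ‖x‖) * (n + 1 : ℝ)⁻¹) *
          ‖iteratedFDeriv ℝ (m - i) φ x‖) := by
          gcongr
          exact hM i n x
      _ = (m.choose i : ℝ) * (M i * (‖x‖ ^ k * ‖iteratedFDeriv ℝ (m - i) φ x‖ +
          ‖x‖ ^ (k + 1) * ‖iteratedFDeriv ℝ (m - i) φ x‖)) * (n + 1 : ℝ)⁻¹ := by ring
      _ ≤ _ := by gcongr
  have hlim : Filter.Tendsto (fun n : ℕ => C * (n + 1 : ℝ)⁻¹) Filter.atTop (nhds 0) := by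
    simpa using (tendsto_one_div_add_atTop_nhds_zero_nat (𝕜 := ℝ)).const_mul C
  filter_upwards [hlim.eventually (gt_mem_nhds hε)] with n hn
  exact (hbound n).trans_lt hn

theorem DtDual.continuous_eval (u : DtDual) (h : 𝓓(halfLine, ℂ)) :
    Continuous fun φ => u.eval φ h := by
  have hu : Continuous fun a : 𝓢(ℝ, ℂ) × 𝓓(halfLine, ℂ) => u.1 a.1 a.2 := u.2
  exact hu.comp (continuous_id.prodMk continuous_const)

/-! ### `U_{1,λ}` is surjective -/

/-- The map `h ↦ h / ν_λ` from test functions to `L^r(ℝ₊, ν_λ)`. -/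
def divDensityLp {lam : ℝ} (hlam : -1 < lam) (r : ℝ≥0∞) :
    𝓓(halfLine, ℂ) →ₗ[ℂ] Lp ℂ r (nu lam) where
  toFun h := (memLp_divDensity hlam r h).toLp _
  map_add' h k := by
    rw [← MemLp.toLp_add]
    congr 1
    ext y
    simp [divDensity, add_mul]
  map_smul' c h := by
    rw [RingHom.id_apply, ← MemLp.toLp_const_smul]
    congr 1
    ext y
    simp [divDensity, mul_assoc]

/-- Continuity may be checked on functions supported in a fixed compact `K`. There the `L^r` norm is
at most the sup norm of the function, times a bound for the inverse density on `K`, times the norm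
of `1_K`. -/
theorem continuous_divDensityLp {lam : ℝ} (hlam : -1 < lam) (r : ℝ≥0∞) [Fact (1 ≤ r)] :
    Continuous (divDensityLp hlam r) := by
  rw [TestFunction.continuous_iff_continuous_comp]
  intro K hK
  have hKsub : (K : Set ℝ) ⊆ Ioi 0 := hK
  obtain ⟨C, hC⟩ := K.isCompact.exists_bound_of_continuousOn (f := fun y => (nuDensity lam y)⁻¹)
    (((continuousOn_nuDensity lam).mono hKsub).inv₀ fun y hy => (nuDensity_pos hlam (hKsub hy)).ne')
  let ι : Lp ℝ r (nu lam) :=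
    indicatorConstLp r K.isCompact.measurableSet (nu_lt_top lam K.isCompact hKsub).ne (1 : ℝ)
  let B := ContDiffMapSupportedIn.toBoundedContinuousFunctionCLM ℂ (E := ℝ) (F := ℂ)
    (n := ⊤) (K := K)
  have hbound : ∀ f : ContDiffMapSupportedIn ℝ ℂ ⊤ K,
      ‖divDensityLp hlam r (TestFunction.ofSupportedIn hK f)‖ ≤ (‖B f‖ * C) * ‖ι‖ := by
    intro f
    refine Lp.norm_le_mul_norm_of_ae_le_mul ?_
    filter_upwards [(memLp_divDensity hlam r (TestFunction.ofSupportedIn hK f)).coeFn_toLp,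
      indicatorConstLp_coeFn (p := r) (hs := K.isCompact.measurableSet)
        (hμs := (nu_lt_top lam K.isCompact hKsub).ne) (c := (1 : ℝ))] with y h1 h2
    change ‖(memLp_divDensity hlam r (TestFunction.ofSupportedIn hK f)).toLp _ y‖ ≤
      ‖B f‖ * C * ‖ι y‖
    rw [h1, h2]
    have hval : TestFunction.ofSupportedIn hK f y = f y := rfl
    by_cases hy : y ∈ (K : Set ℝ)
    · simp only [divDensity, hval, norm_mul, hy, indicator_of_mem, norm_one, mul_one,
        Complex.norm_real]
      have h3 : ‖f y‖ ≤ ‖B f‖ := (B f).norm_coe_le_norm y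
      have h4 := hC y hy
      gcongr
    · have h3 : f y = 0 := f.zero_on_compl hy
      simp [divDensity, hval, h3, hy]
  have hlin : Continuous ((divDensityLp hlam r) ∘ₗ
      ((TestFunction.ofSupportedInCLM ℂ hK :
        ContDiffMapSupportedIn ℝ ℂ ⊤ K →L[ℂ] 𝓓(halfLine, ℂ)) : ContDiffMapSupportedIn ℝ ℂ ⊤ K →ₗ[ℂ] _)) := by
    refine continuous_of_continuousAt_zero _ ?_
    rw [ContinuousAt, map_zero, tendsto_zero_iff_norm_tendsto_zero]
    have hlim : Filter.Tendsto (fun f => (‖B f‖ * C) * ‖ι‖) (nhds 0) (nhds 0) := by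
      have : Continuous fun f => (‖B f‖ * C) * ‖ι‖ :=
        (B.continuous.norm.mul continuous_const).mul continuous_const
      simpa using this.tendsto 0
    exact squeeze_zero (fun _ => norm_nonneg _) hbound hlim
  exact hlin

theorem pairX_eq_integral_nu {p lam : ℝ} (hlam : -1 < lam) (v : XSpace p lam)
    (h : 𝓓(halfLine, ℂ)) : pairX v h = ∫ y, v y * divDensity lam h y ∂(nu lam) := by
  rw [integral_nu hlam, pairX]
  refine setIntegral_congr_fun measurableSet_Ioi fun y hy => ?_
  have hne : ((nuDensity lam y : ℝ) : ℂ) ≠ 0 := by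
    exact_mod_cast (nuDensity_pos hlam hy).ne'
  simp only [divDensity, Complex.ofReal_inv]
  field_simp

/-- Membership in `𝒟_t(Π)'` asks for joint continuity. It follows because the form factors through
the continuous maps of `𝒮(ℝ)` into `L^{q'}` and of test functions into `L^{p'}(ν_λ)`, followed by
two Hölder pairings. -/
theorem continuous_pairMixed {q p lam : ℝ} [Fact (1 ≤ q)] [Fact (1 ≤ p)] (hlam : -1 < lam)
    (g : MixedLp q p lam) :
    Continuous fun a : 𝓢(ℝ, ℂ) × 𝓓(halfLine, ℂ) => pairMixed g a.1 a.2 := by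
  let r : ℝ≥0∞ := (1 - (ENNReal.ofReal p)⁻¹)⁻¹
  have hr : (ENNReal.ofReal p).HolderConjugate r :=
    ENNReal.HolderConjugate.inv_one_sub_inv' (factOneLeOfReal p).out
  have hr1 : Fact (1 ≤ r) := by simp [fact_iff, r]
  let s : ℝ≥0∞ := (1 - (ENNReal.ofReal q)⁻¹)⁻¹
  have hs : (ENNReal.ofReal q).HolderConjugate s :=
    ENNReal.HolderConjugate.inv_one_sub_inv' (factOneLeOfReal q).out
  have hs' : s.HolderConjugate (ENNReal.ofReal q) := hs.symm
  have hs1 : Fact (1 ≤ s) := by simp [fact_iff, s]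
  let A : XSpace p lam →L[ℂ] Lp ℂ r (nu lam) →L[ℂ] ℂ :=
    (ContinuousLinearMap.mul ℂ ℂ).lpPairing (nu lam) (ENNReal.ofReal p) r
  let B : Lp ℂ s (volume : Measure ℝ) →L[ℂ] MixedLp q p lam →L[ℂ] XSpace p lam :=
    (ContinuousLinearMap.lsmul ℂ ℂ).lpPairing volume s (ENNReal.ofReal q)
  have hform : ∀ (φ : 𝓢(ℝ, ℂ)) (h : 𝓓(halfLine, ℂ)), pairMixed g φ h =
      A (B (SchwartzMap.toLpCLM ℂ ℂ s volume φ) g) (divDensityLp hlam r h) := by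
    intro φ h
    rw [pairMixed_eq hlam, ContinuousLinearMap.lpPairing_eq_integral,
      ContinuousLinearMap.lpPairing_eq_integral]
    have h1 : ∫ x, (ContinuousLinearMap.lsmul ℂ ℂ) (SchwartzMap.toLpCLM ℂ ℂ s volume φ x) (g x) =
        ∫ x, φ x • g x := by
      refine integral_congr_ae ?_
      filter_upwards [φ.coeFn_toLp s volume] with x hx
      rw [SchwartzMap.toLpCLM_apply, hx, ContinuousLinearMap.lsmul_apply]
    rw [h1]
    generalize ∫ x, φ x • g x = v
    have h2 : ∫ y, (ContinuousLinearMap.mul ℂ ℂ) (v y) (divDensityLp hlam r h y) ∂(nu lam)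
        = ∫ y, v y * divDensity lam h y ∂(nu lam) := by
      refine integral_congr_ae ?_
      filter_upwards [(memLp_divDensity hlam r h).coeFn_toLp] with y hy
      rw [← hy]
      rfl
    rw [h2, pairX_eq_integral_nu hlam]
  simp only [hform]
  have h1 : Continuous fun a : 𝓢(ℝ, ℂ) × 𝓓(halfLine, ℂ) =>
      A (B (SchwartzMap.toLpCLM ℂ ℂ s volume a.1) g) :=
    A.continuous.comp (((B.flip g).continuous.comp
      (SchwartzMap.toLpCLM ℂ ℂ s volume).continuous).comp continuous_fst)
  exact h1.clm_apply ((continuous_divDensityLp hlam r).comp continuous_snd)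

theorem pairMixed_add_left {q p lam : ℝ} [Fact (1 ≤ q)] [Fact (1 ≤ p)]
    (hlam : -1 < lam) (g : MixedLp q p lam) (φ ψ : 𝓢(ℝ, ℂ)) (h : 𝓓(halfLine, ℂ)) :
    pairMixed g (φ + ψ) h = pairMixed g φ h + pairMixed g ψ h := by
  obtain ⟨T, hT⟩ := exists_pairX_clm (p := p) hlam h
  simp only [pairMixed_eq hlam, ← hT]
  rw [← map_add, ← integral_add (integrable_smul_mixed g φ) (integrable_smul_mixed g ψ)]
  simp only [add_apply, add_smul]

theorem pairMixed_smul_left {q p lam : ℝ} [Fact (1 ≤ q)] [Fact (1 ≤ p)]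
    (hlam : -1 < lam) (g : MixedLp q p lam) (c : ℂ) (φ : 𝓢(ℝ, ℂ)) (h : 𝓓(halfLine, ℂ)) :
    pairMixed g (c • φ) h = c * pairMixed g φ h := by
  obtain ⟨T, hT⟩ := exists_pairX_clm (p := p) hlam h
  simp only [pairMixed_eq hlam, ← hT]
  rw [← smul_eq_mul, ← map_smul, ← integral_smul]
  simp only [smul_apply, smul_assoc]

theorem integrable_mul_divDensity {p lam : ℝ} [Fact (1 ≤ p)] (hlam : -1 < lam)
    (v : XSpace p lam) (h : 𝓓(halfLine, ℂ)) :
    Integrable (fun y => v y * divDensity lam h y) (nu lam) := by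
  have hr : (ENNReal.ofReal p).HolderConjugate ((1 - (ENNReal.ofReal p)⁻¹)⁻¹) :=
    ENNReal.HolderConjugate.inv_one_sub_inv' (factOneLeOfReal p).out
  exact (Lp.memLp v).integrable_mul
    (memLp_divDensity hlam ((1 - (ENNReal.ofReal p)⁻¹)⁻¹) h)

theorem integrableOn_pairX {p lam : ℝ} [Fact (1 ≤ p)] (hlam : -1 < lam)
    (v : XSpace p lam) (h : 𝓓(halfLine, ℂ)) :
    IntegrableOn (fun y => v y * h y) (Ioi 0) := by
  refine ((integrable_nu_iff hlam _).1 (integrable_mul_divDensity hlam v h)).congr_fun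
    (fun y hy => ?_) measurableSet_Ioi
  have hne : ((nuDensity lam y : ℝ) : ℂ) ≠ 0 := by
    exact_mod_cast (nuDensity_pos hlam hy).ne'
  simp only [divDensity, Complex.ofReal_inv, Complex.real_smul]
  field_simp

theorem pairX_add_right {p lam : ℝ} [Fact (1 ≤ p)] (hlam : -1 < lam)
    (v : XSpace p lam) (h k : 𝓓(halfLine, ℂ)) : pairX v (h + k) = pairX v h + pairX v k := by
  simp only [pairX, FunLike.coe_add, Pi.add_apply, mul_add]
  exact integral_add (integrableOn_pairX hlam v h) (integrableOn_pairX hlam v k)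

theorem pairX_smul_right {p lam : ℝ} (v : XSpace p lam) (c : ℂ) (h : 𝓓(halfLine, ℂ)) :
    pairX v (c • h) = c * pairX v h := by
  simp only [pairX, FunLike.coe_smul, Pi.smul_apply, smul_eq_mul, ← integral_const_mul]
  congr 1
  ext y
  ring

theorem integrable_mul_pairX {q p lam : ℝ} [Fact (1 ≤ q)] [Fact (1 ≤ p)] (hlam : -1 < lam)
    (g : MixedLp q p lam) (φ : 𝓢(ℝ, ℂ)) (h : 𝓓(halfLine, ℂ)) :
    Integrable fun x => φ x * pairX (g x) h := by
  obtain ⟨T, hT⟩ := exists_pairX_clm (p := p) hlam h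
  refine (T.integrable_comp (integrable_smul_mixed g φ)).congr
    (Filter.Eventually.of_forall fun x => ?_)
  simp only
  rw [map_smul, hT, smul_eq_mul]

theorem pairMixed_add_right {q p lam : ℝ} [Fact (1 ≤ q)] [Fact (1 ≤ p)] (hlam : -1 < lam)
    (g : MixedLp q p lam) (φ : 𝓢(ℝ, ℂ)) (h k : 𝓓(halfLine, ℂ)) :
    pairMixed g φ (h + k) = pairMixed g φ h + pairMixed g φ k := by
  simp only [pairMixed_eq hlam, pairX_add_right hlam]

theorem pairMixed_smul_right {q p lam : ℝ} [Fact (1 ≤ q)] [Fact (1 ≤ p)] (hlam : -1 < lam)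
    (g : MixedLp q p lam) (c : ℂ) (φ : 𝓢(ℝ, ℂ)) (h : 𝓓(halfLine, ℂ)) :
    pairMixed g φ (c • h) = c * pairMixed g φ h := by
  simp only [pairMixed_eq hlam, pairX_smul_right]

/-- The distribution in `𝒟_t(Π)'` whose transform under `π^{-1/2} ^` is `g`. -/
def mixedInvFourier {q p lam : ℝ} [Fact (1 ≤ q)] [Fact (1 ≤ p)] (hlam : -1 < lam)
    (g : MixedLp q p lam) : DtDual :=
  ⟨(Real.sqrt Real.pi : ℂ) • (LinearMap.mk₂ ℂ (pairMixed g) (pairMixed_add_left hlam g)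
      (fun c φ h => pairMixed_smul_left hlam g c φ h) (pairMixed_add_right hlam g)
      (pairMixed_smul_right hlam g) ∘ₗ (fourierSInv : 𝓢(ℝ, ℂ) →ₗ[ℂ] 𝓢(ℝ, ℂ))), by
    have h : Continuous fun a : 𝓢(ℝ, ℂ) × 𝓓(halfLine, ℂ) => pairMixed g (fourierSInv a.1) a.2 :=
      (continuous_pairMixed hlam g).comp
        ((fourierSInv.continuous.comp continuous_fst).prodMk continuous_snd)
    exact h.const_smul (Real.sqrt Real.pi : ℂ)⟩

/-- Each `g` defines a distribution by pairing, and precomposing it with the inverse Fourier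
transform on `𝒮(ℝ)` gives a preimage up to the factor `√π`. -/
theorem U1_surjective {q p lam : ℝ} [Fact (1 ≤ q)] [Fact (1 ≤ p)] [hlam : Fact (-1 < lam)] :
    Function.Surjective (U1 : FourierSpace q p lam →ₗ[ℂ] MixedLp q p lam) := by
  intro g
  have hc : (Real.sqrt Real.pi : ℂ) ≠ 0 := by
    have : Real.sqrt Real.pi ≠ 0 := by positivity
    exact_mod_cast this
  have h : ∀ φ h, (Real.sqrt Real.pi : ℂ)⁻¹ *
      (partialFourier (mixedInvFourier hlam.out g)).eval φ h = pairMixed g φ h := fun φ h => by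
    have h1 : (partialFourier (mixedInvFourier hlam.out g)).eval φ h =
        (Real.sqrt Real.pi : ℂ) * pairMixed g (fourierSInv (fourierS φ)) h := rfl
    rw [h1, fourierSInv_fourierS, inv_mul_cancel_left₀ hc]
  refine ⟨⟨mixedInvFourier hlam.out g, g, h⟩, eq_of_pairMixed fun φ k => ?_⟩
  rw [U1_spec, ← h]

/-! ### Functions on the half-line as elements of the mixed norm space -/

theorem measurable_theta (p lam : ℝ) : Measurable (theta p lam) := by
  unfold theta
  fun_prop

section

variable {q p lam : ℝ} [hq : Fact (1 ≤ q)] [hp : Fact (1 ≤ p)] [hlam : Fact (-1 < lam)]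

/-- The function `x ↦ φ(x) θ_{λ,p}(x) e^{-x ·}` on `ℝ₊`, extended by zero. -/
def rayFun (p lam : ℝ) [Fact (1 ≤ p)] [Fact (-1 < lam)] (φ : ℝ → ℂ) (x : ℝ) : XSpace p lam :=
  (φ x * (theta p lam x : ℂ)) • expVec p lam x

/-- The fibrewise identity behind the isometry: `θ_{λ,p}(x) e^{-x·}` has norm one. -/
theorem norm_rayFun (φ : ℝ → ℂ) (x : ℝ) :
    ‖rayFun p lam φ x‖ = ‖(Ioi (0 : ℝ)).indicator φ x‖ := by
  by_cases hx : 0 < x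
  · have hth := theta_pos hp.out hlam.out hx
    rw [rayFun, norm_smul, norm_expVec hx, indicator_of_mem (mem_Ioi.2 hx), norm_mul,
      Complex.norm_real, Real.norm_of_nonneg hth.le, mul_inv_cancel_right₀ hth.ne']
  · rw [rayFun, expVec_of_nonpos (not_lt.1 hx), smul_zero, norm_zero,
      indicator_of_notMem (by simpa using hx), norm_zero]

theorem aestronglyMeasurable_rayFun {φ : ℝ → ℂ}
    (hφ : AEStronglyMeasurable φ (volume.restrict (Ioi 0))) :
    AEStronglyMeasurable (rayFun p lam φ) volume := by
  have h1 : (Ioi (0 : ℝ)).indicator (rayFun p lam φ) = rayFun p lam φ := by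
    refine indicator_eq_self.2 fun x hx => ?_
    by_contra h0
    exact hx (by rw [rayFun, expVec_of_nonpos (not_lt.1 h0), smul_zero])
  rw [← h1, aestronglyMeasurable_indicator_iff measurableSet_Ioi]
  exact (hφ.mul (Complex.measurable_ofReal.comp
    (measurable_theta p lam)).aestronglyMeasurable).smul
    ((continuousOn_expVec (p := p) (lam := lam)).aestronglyMeasurable measurableSet_Ioi)

theorem eLpNorm_rayFun (φ : ℝ → ℂ) (r : ℝ≥0∞) :
    eLpNorm (rayFun p lam φ) r volume = eLpNorm φ r (volume.restrict (Ioi 0)) := by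
  rw [← eLpNorm_indicator_eq_eLpNorm_restrict measurableSet_Ioi]
  exact eLpNorm_congr_norm_ae (Filter.Eventually.of_forall (norm_rayFun φ))

theorem memLp_rayFun {φ : ℝ → ℂ} {r : ℝ≥0∞} (hφ : MemLp φ r (volume.restrict (Ioi 0))) :
    MemLp (rayFun p lam φ) r volume :=
  ⟨aestronglyMeasurable_rayFun hφ.1, by rw [eLpNorm_rayFun]; exact hφ.2⟩

variable (q p lam) in
/-- The isometric embedding `φ ↦ (x ↦ φ(x) θ_{λ,p}(x) e^{-x ·})` of `L^q(ℝ₊)` into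
`L^q(ℝ, L^p(ℝ₊, ν_λ))`. -/
def rayEmbedding : LqHalfLine q →ₗᵢ[ℂ] MixedLp q p lam where
  toFun φ := (memLp_rayFun (Lp.memLp φ)).toLp _
  map_add' φ ψ := by
    rw [← MemLp.toLp_add, MemLp.toLp_eq_toLp_iff]
    filter_upwards [(ae_restrict_iff' measurableSet_Ioi).1 (Lp.coeFn_add φ ψ)] with x hx
    by_cases h0 : 0 < x
    · rw [Pi.add_apply, rayFun, hx h0, rayFun, rayFun, ← add_smul, Pi.add_apply, add_mul]
    · simp only [Pi.add_apply, rayFun, expVec_of_nonpos (not_lt.1 h0), smul_zero, add_zero]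
  map_smul' c φ := by
    rw [RingHom.id_apply, ← MemLp.toLp_const_smul, MemLp.toLp_eq_toLp_iff]
    filter_upwards [(ae_restrict_iff' measurableSet_Ioi).1 (Lp.coeFn_smul c φ)] with x hx
    by_cases h0 : 0 < x
    · rw [Pi.smul_apply, rayFun, hx h0, rayFun, smul_smul, Pi.smul_apply, smul_eq_mul, mul_assoc]
    · simp only [Pi.smul_apply, rayFun, expVec_of_nonpos (not_lt.1 h0), smul_zero]
  norm_map' φ := by
    change ‖(memLp_rayFun (Lp.memLp φ)).toLp _‖ = ‖φ‖
    rw [Lp.norm_toLp, eLpNorm_rayFun, Lp.norm_def]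

theorem coeFn_rayEmbedding (φ : LqHalfLine q) :
    rayEmbedding q p lam φ =ᵐ[volume] rayFun p lam φ :=
  MemLp.coeFn_toLp (memLp_rayFun (Lp.memLp φ))

end

/-! ### The Paley–Wiener integral -/

/-- Raise `t ≤ e^t` at `t = cx/(2a)` to the power `a`: half of the exponential absorbs the power of
`x`. -/
theorem rpow_mul_exp_le {a c x : ℝ} (ha : 0 < a) (hc : 0 < c) (hx : 0 < x) :
    x ^ a * Real.exp (-(c * x)) ≤ (2 * a / c) ^ a * Real.exp (-(c / 2 * x)) := by
  have h1 : c * x / (2 * a) ≤ Real.exp (c * x / (2 * a)) := by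
    linarith [Real.add_one_le_exp (c * x / (2 * a))]
  have h2 := Real.rpow_le_rpow (by positivity) h1 ha.le
  rw [← Real.exp_mul, show c * x / (2 * a) * a = c / 2 * x by field_simp,
    show c * x / (2 * a) = x / (2 * a / c) by field_simp,
    Real.div_rpow hx.le (by positivity), div_le_iff₀ (by positivity)] at h2
  have h3 : Real.exp (-(c * x)) = Real.exp (-(c / 2 * x)) * Real.exp (-(c / 2 * x)) := by
    rw [← Real.exp_add]; ring_nf
  have h4 : Real.exp (c / 2 * x) * Real.exp (-(c / 2 * x)) = 1 := by
    rw [← Real.exp_add]; simp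
  calc x ^ a * Real.exp (-(c * x))
      ≤ Real.exp (c / 2 * x) * (2 * a / c) ^ a *
        (Real.exp (-(c / 2 * x)) * Real.exp (-(c / 2 * x))) := by rw [h3]; gcongr
    _ = (2 * a / c) ^ a * Real.exp (-(c / 2 * x)) *
        (Real.exp (c / 2 * x) * Real.exp (-(c / 2 * x))) := by ring
    _ = _ := by rw [h4, mul_one]

theorem memLp_exp_neg_mul {c : ℝ} (hc : 0 < c) (r : ℝ≥0∞) :
    MemLp (fun x : ℝ => Real.exp (-(c * x))) r (volume.restrict (Ioi 0)) := by
  rcases eq_or_ne r 0 with rfl | h0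
  · exact memLp_zero_iff_aestronglyMeasurable.2 (by fun_prop)
  rcases eq_or_ne r ∞ with rfl | hr
  · refine memLp_top_of_bound (by fun_prop) 1 ?_
    filter_upwards [ae_restrict_mem measurableSet_Ioi] with x hx
    have hx : 0 < x := hx
    rw [Real.norm_eq_abs, Real.abs_exp]
    exact Real.exp_le_one_iff.2 (by nlinarith)
  · rw [← integrable_norm_rpow_iff (by fun_prop) h0 hr]
    have hpos : 0 < r.toReal := ENNReal.toReal_pos h0 hr
    have h := exp_neg_integrableOn_Ioi 0 (mul_pos hpos hc)
    refine h.congr_fun (fun x _ => ?_) measurableSet_Ioi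
    simp only [Real.norm_eq_abs, Real.abs_exp, ← Real.exp_mul]
    ring_nf

/-- Hölder's inequality: the power times the exponential lies in every `L^r`, in particular for the
conjugate exponent of `q`, which is `∞` when `q = 1`. -/
theorem integrableOn_mul_rpow_mul_exp {q a c : ℝ} [Fact (1 ≤ q)] {φ : ℝ → ℂ}
    (hφ : MemLp φ (ENNReal.ofReal q) (volume.restrict (Ioi 0))) (ha : 0 < a) (hc : 0 < c) :
    IntegrableOn (fun x : ℝ => φ x * ((x ^ a : ℝ) : ℂ) * (Real.exp (-(c * x)) : ℂ)) (Ioi 0) := by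
  have hr : (ENNReal.ofReal q).HolderConjugate ((1 - (ENNReal.ofReal q)⁻¹)⁻¹) :=
    ENNReal.HolderConjugate.inv_one_sub_inv' (factOneLeOfReal q).out
  have h1 : MemLp (fun x : ℝ => ((x ^ a * Real.exp (-(c * x)) : ℝ) : ℂ))
      ((1 - (ENNReal.ofReal q)⁻¹)⁻¹) (volume.restrict (Ioi 0)) := by
    refine ((memLp_exp_neg_mul (half_pos hc) _).const_mul ((2 * a / c) ^ a)).mono
      (Measurable.aestronglyMeasurable (by fun_prop)) ?_
    filter_upwards [ae_restrict_mem measurableSet_Ioi] with x hx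
    have hx : 0 < x := hx
    rw [Complex.norm_real, Real.norm_of_nonneg (by positivity), Real.norm_of_nonneg (by positivity)]
    exact rpow_mul_exp_le ha hc hx
  refine (hφ.integrable_mul h1).congr (Filter.Eventually.of_forall fun x => ?_)
  simp only [Pi.mul_apply]
  push_cast
  ring

theorem norm_exp_I_mul_mul (x : ℝ) (z : ℂ) :
    ‖Complex.exp (Complex.I * x * z)‖ = Real.exp (-(z.im * x)) := by
  rw [Complex.norm_exp]
  congr 1
  simp [mul_comm]

theorem integrableOn_paleyWiener {q a : ℝ} [Fact (1 ≤ q)] {φ : ℝ → ℂ}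
    (hφ : MemLp φ (ENNReal.ofReal q) (volume.restrict (Ioi 0))) (ha : 0 < a) {z : ℂ}
    (hz : z ∈ halfPlane) :
    IntegrableOn (fun ξ : ℝ => φ ξ * ((ξ ^ a : ℝ) : ℂ) * Complex.exp (Complex.I * ξ * z))
      (Ioi 0) := by
  refine Integrable.mono (integrableOn_mul_rpow_mul_exp hφ ha hz) ?_ (Filter.Eventually.of_forall fun x => ?_)
  · refine (hφ.1.mul (Measurable.aestronglyMeasurable (by fun_prop))).mul ?_
    exact Continuous.aestronglyMeasurable (by fun_prop)
  · rw [norm_mul, norm_exp_I_mul_mul, norm_mul _ (Real.exp _ : ℂ), Complex.norm_real (Real.exp _),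
      Real.norm_eq_abs, Real.abs_exp]

theorem differentiableOn_integral_exp {q a : ℝ} [Fact (1 ≤ q)] {φ : ℝ → ℂ}
    (hφ : MemLp φ (ENNReal.ofReal q) (volume.restrict (Ioi 0))) (ha : 0 < a) :
    DifferentiableOn ℂ (fun z : ℂ => ∫ ξ in Ioi (0 : ℝ),
      φ ξ * ((ξ ^ a : ℝ) : ℂ) * Complex.exp (Complex.I * ξ * z)) halfPlane := by
  intro z₀ hz₀
  have hz₀ : 0 < z₀.im := hz₀
  -- On this neighbourhood `|e^{iξz}| ≤ e^{-ξ Im z₀ / 2}`. The derivative costs one factor `ξ`, so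
  -- the dominating function has exponent `a + 1`.
  have hs : {z : ℂ | z₀.im / 2 < z.im} ∈ nhds z₀ :=
    (isOpen_lt continuous_const Complex.continuous_im).mem_nhds (half_lt_self hz₀)
  have hmeas : ∀ z : ℂ, AEStronglyMeasurable (fun ξ : ℝ => φ ξ * ((ξ ^ a : ℝ) : ℂ) *
      Complex.exp (Complex.I * ξ * z)) (volume.restrict (Ioi 0)) := fun z =>
    (hφ.1.mul (Measurable.aestronglyMeasurable (by fun_prop))).mul
      (Continuous.aestronglyMeasurable (by fun_prop))
  refine DifferentiableAt.differentiableWithinAt (HasDerivAt.differentiableAt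
    (hasDerivAt_integral_of_dominated_loc_of_deriv_le (μ := volume.restrict (Ioi (0 : ℝ)))
      (F' := fun z ξ => φ ξ * ((ξ ^ a : ℝ) : ℂ) *
        (Complex.exp (Complex.I * ξ * z) * (Complex.I * ξ)))
      (bound := fun ξ : ℝ => ‖φ ξ * ((ξ ^ (a + 1) : ℝ) : ℂ) *
        (Real.exp (-(z₀.im / 2 * ξ)) : ℂ)‖) hs
      (Filter.Eventually.of_forall hmeas) (integrableOn_paleyWiener hφ ha hz₀) ?_ ?_
      (integrableOn_mul_rpow_mul_exp hφ (by positivity) (half_pos hz₀)).norm ?_).2)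
  · exact (hφ.1.mul (Measurable.aestronglyMeasurable (by fun_prop))).mul
      (Continuous.aestronglyMeasurable (by fun_prop))
  · filter_upwards [ae_restrict_mem measurableSet_Ioi] with ξ hξ z hz
    have hξ : 0 < ξ := hξ
    have hz : z₀.im / 2 < z.im := hz
    rw [Real.rpow_add_one hξ.ne']
    simp only [norm_mul, norm_exp_I_mul_mul, Complex.norm_I, one_mul, Complex.norm_real,
      Real.norm_of_nonneg hξ.le, Real.norm_eq_abs, Real.abs_exp]
    rw [mul_assoc, mul_assoc, mul_comm (Real.exp _)]
    rw [mul_assoc]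
    gcongr
  · refine Filter.Eventually.of_forall fun ξ z _ => ?_
    have h1 : HasDerivAt (fun z : ℂ => Complex.I * ξ * z) (Complex.I * ξ) z := by
      simpa using (hasDerivAt_id z).const_mul (Complex.I * ξ)
    exact h1.cexp.const_mul _

theorem differentiableOn_paleyWiener {q p lam : ℝ} [Fact (1 ≤ q)] (hp : 1 ≤ p) (hlam : -1 < lam)
    {φ : ℝ → ℂ} (hφ : MemLp φ (ENNReal.ofReal q) (volume.restrict (Ioi 0))) :
    DifferentiableOn ℂ (paleyWiener p lam φ) halfPlane :=
  (differentiableOn_integral_exp hφ (div_pos (by linarith) (by linarith))).const_mul _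

/-- The Fourier transform in the first variable of the Paley–Wiener integral of `φ`, up to a
constant. -/
def rayKernel (p lam : ℝ) (φ : ℝ → ℂ) (y ξ : ℝ) : ℂ :=
  (Ioi (0 : ℝ)).indicator (fun ξ => φ ξ * (theta p lam ξ : ℂ)) ξ * (Real.exp (-(ξ * y)) : ℂ)

theorem integrable_rayKernel {q p lam y : ℝ} [Fact (1 ≤ q)] (hp : 1 ≤ p) (hlam : -1 < lam)
    {φ : ℝ → ℂ} (hφ : MemLp φ (ENNReal.ofReal q) (volume.restrict (Ioi 0))) (hy : 0 < y) :
    Integrable (rayKernel p lam φ y) := by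
  have h1 : rayKernel p lam φ y = (Ioi (0 : ℝ)).indicator
      fun ξ => φ ξ * (theta p lam ξ : ℂ) * (Real.exp (-(ξ * y)) : ℂ) := by
    ext ξ
    by_cases h : ξ ∈ Ioi (0 : ℝ) <;> simp [rayKernel, h]
  rw [h1, integrable_indicator_iff measurableSet_Ioi]
  have ha : 0 < (lam + 1) / p := div_pos (by linarith) (by linarith)
  refine IntegrableOn.congr_fun (Integrable.const_mul (integrableOn_mul_rpow_mul_exp hφ ha hy)
    ((p ^ ((lam + 1) / p) / (2 ^ lam * Real.Gamma (lam + 2)) ^ (1 / p) : ℝ) : ℂ))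
      (fun ξ hξ => ?_) measurableSet_Ioi
  simp only [theta_eq hp hlam hξ, mul_comm ξ y, Complex.ofReal_mul]
  ring

/-- On a horizontal line the Paley–Wiener integral is an inverse Fourier integral. All constants but
`1/√2` are absorbed in `θ_{λ,p}(ξ)`. -/
theorem paleyWiener_eq {p lam x y : ℝ} (hp : 1 ≤ p) (hlam : -1 < lam) (φ : ℝ → ℂ) :
    paleyWiener p lam φ (x + y * Complex.I) = (Real.sqrt 2 : ℂ)⁻¹ *
      ∫ ξ : ℝ, rayKernel p lam φ y ξ * Complex.exp (Complex.I * ξ * x) := by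
  have h1 : ∀ ξ : ℝ, rayKernel p lam φ y ξ * Complex.exp (Complex.I * ξ * x) =
      (Ioi (0 : ℝ)).indicator (fun ξ : ℝ => φ ξ * (theta p lam ξ : ℂ) *
        Complex.exp (Complex.I * ξ * (x + y * Complex.I))) ξ := by
    intro ξ
    by_cases h : ξ ∈ Ioi (0 : ℝ)
    · rw [indicator_of_mem h, rayKernel, indicator_of_mem h, Complex.ofReal_exp, mul_assoc,
        ← Complex.exp_add]
      congr 2
      push_cast
      linear_combination (-(ξ : ℂ) * y) * Complex.I_mul_I
    · rw [indicator_of_notMem h, rayKernel, indicator_of_notMem h, zero_mul, zero_mul]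
  simp only [h1]
  rw [integral_indicator measurableSet_Ioi, paleyWiener, ← integral_const_mul, ← integral_const_mul]
  refine setIntegral_congr_fun measurableSet_Ioi fun ξ hξ => ?_
  simp only [theta_eq hp hlam hξ]
  push_cast
  field_simp

/-! ### The half-plane as a product -/

theorem measurableSet_halfPlane : MeasurableSet halfPlane :=
  measurableSet_lt measurable_const Complex.measurable_im

theorem measurePreserving_halfPlane :
    MeasurePreserving Complex.measurableEquivRealProd (volume.restrict halfPlane)
      ((volume : Measure ℝ).prod (volume.restrict (Ioi (0 : ℝ)))) := by
  have h := Complex.volume_preserving_equiv_real_prod.restrict_preimage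
    (MeasurableSet.univ.prod (measurableSet_Ioi (a := (0 : ℝ))))
  have h1 : Complex.measurableEquivRealProd ⁻¹' (univ ×ˢ Ioi (0 : ℝ)) = halfPlane := by
    ext z
    simp [halfPlane]
  rw [h1, Measure.volume_eq_prod, ← Measure.prod_restrict, Measure.restrict_univ] at h
  exact h

theorem integrableOn_halfPlane_iff (G : ℂ → ℂ) :
    IntegrableOn G halfPlane ↔ Integrable (fun z : ℝ × ℝ => G (z.1 + z.2 * Complex.I))
      ((volume : Measure ℝ).prod (volume.restrict (Ioi (0 : ℝ)))) := by
  have h := measurePreserving_halfPlane.integrable_comp_emb (g := fun z : ℝ × ℝ =>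
    G (z.1 + z.2 * Complex.I)) Complex.measurableEquivRealProd.measurableEmbedding
  have h1 : ((fun z : ℝ × ℝ => G (z.1 + z.2 * Complex.I)) ∘ Complex.measurableEquivRealProd) = G :=
    funext fun z => congrArg G (Complex.re_add_im z)
  rw [← h, IntegrableOn, h1]

theorem integral_halfPlane (G : ℂ → ℂ) :
    ∫ z in halfPlane, G z = ∫ z : ℝ × ℝ, G (z.1 + z.2 * Complex.I)
      ∂((volume : Measure ℝ).prod (volume.restrict (Ioi (0 : ℝ)))) := by
  have h := measurePreserving_halfPlane.integral_comp
    Complex.measurableEquivRealProd.measurableEmbedding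
    (fun z : ℝ × ℝ => G (z.1 + z.2 * Complex.I))
  rw [← h]
  congr! 2 with z
  simp [Complex.re_add_im]

/-! ### The distribution defined by the Paley–Wiener integral -/

theorem exists_pos_le_of_testFunction (h : 𝓓(halfLine, ℂ)) :
    ∃ δ > 0, ∀ y, h y ≠ 0 → δ ≤ y := by
  rcases (tsupport h).eq_empty_or_nonempty with he | hne
  · refine ⟨1, one_pos, fun y hy => ?_⟩
    have := subset_tsupport h hy
    simp [he] at this
  · obtain ⟨δ, hδ, hmin⟩ := h.hasCompactSupport.isCompact.exists_isLeast hne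
    exact ⟨δ, h.tsupport_subset hδ, fun y hy => hmin (subset_tsupport h hy)⟩

theorem integrable_testFunction (h : 𝓓(halfLine, ℂ)) : Integrable h :=
  h.continuous.integrable_of_hasCompactSupport h.hasCompactSupport

/-- The support of `h` stays at a distance `δ > 0` from the boundary, so `e^{-ξy} ≤ e^{-ξδ}` there,
and the product of a function of `ξ` with `h` dominates. -/
theorem integrable_mul_rayKernel_mul {q p lam : ℝ} [Fact (1 ≤ q)] (hp : 1 ≤ p) (hlam : -1 < lam)
    {φ : ℝ → ℂ} (hφ : MemLp φ (ENNReal.ofReal q) (volume.restrict (Ioi 0)))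
    (χ : 𝓢(ℝ, ℂ)) (h : 𝓓(halfLine, ℂ)) :
    Integrable (fun z : ℝ × ℝ => χ z.1 * (rayKernel p lam φ z.2 z.1 * h z.2))
      ((volume : Measure ℝ).prod (volume.restrict (Ioi (0 : ℝ)))) := by
  obtain ⟨δ, hδ, hle⟩ := exists_pos_le_of_testFunction h
  have h1 := integrable_rayKernel hp hlam hφ hδ
  have h2 : Integrable fun ξ => χ ξ * rayKernel p lam φ δ ξ :=
    h1.bdd_mul χ.continuous.aestronglyMeasurable
      (Filter.Eventually.of_forall χ.toBoundedContinuousFunction.norm_coe_le_norm)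
  refine (h2.mul_prod ((integrable_testFunction h).restrict (s := Ioi 0))).mono ?_ ?_
  · refine χ.continuous.aestronglyMeasurable.comp_fst.mul (AEStronglyMeasurable.mul ?_
      h.continuous.aestronglyMeasurable.comp_snd)
    refine AEStronglyMeasurable.mul (AEStronglyMeasurable.comp_fst (f := (Ioi (0 : ℝ)).indicator
      fun ξ => φ ξ * (theta p lam ξ : ℂ)) ?_) (Continuous.aestronglyMeasurable (by fun_prop))
    rw [aestronglyMeasurable_indicator_iff measurableSet_Ioi]
    exact hφ.1.mul (Complex.measurable_ofReal.comp (measurable_theta p lam)).aestronglyMeasurable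
  · refine Filter.Eventually.of_forall fun z => ?_
    by_cases hz : h z.2 = 0
    · simp [hz]
    by_cases hz1 : z.1 ∈ Ioi (0 : ℝ)
    · have hz1 : 0 < z.1 := hz1
      have hz2 := hle _ hz
      simp only [rayKernel, norm_mul, Complex.norm_real, Real.norm_eq_abs, Real.abs_exp]
      rw [← mul_assoc ‖χ z.1‖]
      gcongr
    · simp [rayKernel, hz1]

section

variable {q p lam : ℝ} [hq : Fact (1 ≤ q)] [hp : Fact (1 ≤ p)] [hlam : Fact (-1 < lam)]

theorem pairX_rayFun (φ : ℝ → ℂ) (x : ℝ) (h : 𝓓(halfLine, ℂ)) :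
    pairX (rayFun p lam φ x) h = ∫ y in Ioi (0 : ℝ), rayKernel p lam φ y x * h y := by
  refine integral_congr_ae ?_
  refine (ae_nu_iff hlam.out).1 ?_
  by_cases hx : 0 < x
  · filter_upwards [Lp.coeFn_smul (φ x * (theta p lam x : ℂ)) (expVec p lam x),
      coeFn_expVec (p := p) (lam := lam) hx] with y h1 h2
    rw [rayFun, h1, Pi.smul_apply, h2, rayKernel, indicator_of_mem (mem_Ioi.2 hx), smul_eq_mul]
  · filter_upwards [Lp.coeFn_zero ℂ (ENNReal.ofReal p) (nu lam)] with y h1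
    rw [rayFun, expVec_of_nonpos (not_lt.1 hx), smul_zero, h1, rayKernel,
      indicator_of_notMem (by simpa using hx), Pi.zero_apply, zero_mul, zero_mul,
      zero_mul]

theorem sqrt_pi_ne_zero : (Real.sqrt Real.pi : ℂ) ≠ 0 := by
  have : Real.sqrt Real.pi ≠ 0 := by positivity
  exact_mod_cast this

theorem eval_fourierS (u : FourierSpace q p lam) (χ : 𝓢(ℝ, ℂ)) (h : 𝓓(halfLine, ℂ)) :
    (u : DtDual).eval (fourierS χ) h = (Real.sqrt Real.pi : ℂ) * pairMixed (U1 u) χ h := by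
  rw [U1_spec, mul_inv_cancel_left₀ sqrt_pi_ne_zero]
  rfl

/-- Every test function is `fourierS χ` for some `χ`. Fubini reduces the claim to a single
horizontal line, where the multiplication formula moves the transform from the kernel to `fourierS
χ`, and inversion returns `√(2π) χ`. -/
theorem isGivenBy_paleyWiener {u : FourierSpace q p lam} {φ : LqHalfLine q}
    (hu : U1 u = rayEmbedding q p lam φ) :
    IsGivenBy (u : DtDual) (paleyWiener p lam φ) := by
  intro ψ h hψ
  have hφ := Lp.memLp φ
  have hF := integrableOn_test (differentiableOn_paleyWiener hp.out hlam.out hφ).continuousOn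
    ψ h hψ
  rw [integral_halfPlane, integral_prod_symm _ ((integrableOn_halfPlane_iff _).1 hF)]
  obtain ⟨χ, rfl⟩ := fourierS_surjective ψ
  rw [eval_fourierS, hu, pairMixed]
  have h1 : ∫ x, χ x * pairX (rayEmbedding q p lam φ x) h =
      ∫ x, ∫ y in Ioi (0 : ℝ), χ x * (rayKernel p lam φ y x * h y) := by
    refine integral_congr_ae ?_
    filter_upwards [coeFn_rayEmbedding (p := p) (lam := lam) φ] with x hx
    rw [hx, pairX_rayFun, integral_const_mul]
  rw [h1, integral_integral_swap (integrable_mul_rayKernel_mul hp.out hlam.out hφ χ h),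
    ← integral_const_mul]
  refine setIntegral_congr_fun measurableSet_Ioi fun y hy => ?_
  have hk := integrable_rayKernel hp.out hlam.out hφ hy
  have h2 := integral_mul_integral_exp_swap ((fourierS χ).integrable (μ := volume)) hk 1
  have e1 : ∀ x ξ : ℝ, Complex.exp (Complex.I * ((1 : ℝ) : ℂ) * x * ξ) =
      Complex.exp (Complex.I * ξ * x) := fun x ξ => by
    congr 1; push_cast; ring
  simp only [e1, integral_exp_mul_fourierS] at h2
  have h3 : ∀ x : ℝ, paleyWiener p lam φ (x + y * Complex.I) *
      (fourierS χ (x + y * Complex.I : ℂ).re * h (x + y * Complex.I : ℂ).im) =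
      ((Real.sqrt 2 : ℂ)⁻¹ * h y) * (fourierS χ x *
        ∫ ξ : ℝ, rayKernel p lam φ y ξ * Complex.exp (Complex.I * ξ * x)) := fun x => by
    rw [paleyWiener_eq hp.out hlam.out]
    simp
    ring
  simp only [h3]
  rw [integral_const_mul, h2]
  -- The `√(2π)` of the inversion formula is the `√2` of the Paley–Wiener constant times the `√π` of
  -- `U1`.
  have h4 : (Real.sqrt (2 * Real.pi) : ℂ) = (Real.sqrt 2 : ℂ) * (Real.sqrt Real.pi : ℂ) := by
    rw [Real.sqrt_mul zero_le_two, Complex.ofReal_mul]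
  have h5 : (Real.sqrt 2 : ℂ) ≠ 0 := by
    have : Real.sqrt 2 ≠ 0 := by positivity
    exact_mod_cast this
  rw [← integral_const_mul, ← integral_const_mul]
  refine integral_congr_ae (Filter.Eventually.of_forall fun ξ => ?_)
  simp only [h4]
  field_simp

end

/-! ### Test functions on the half-line -/

/-- The derivative of a test function. -/
def testDeriv (h : 𝓓(halfLine, ℂ)) : 𝓓(halfLine, ℂ) :=
  ⟨deriv h, (contDiff_infty_iff_deriv.1 h.contDiff).2, h.hasCompactSupport.deriv,
    tsupport_deriv_subset.trans h.tsupport_subset⟩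

theorem testDeriv_apply (h : 𝓓(halfLine, ℂ)) (y : ℝ) : testDeriv h y = deriv h y := rfl

theorem hasDerivAt_testFunction (h : 𝓓(halfLine, ℂ)) (y : ℝ) : HasDerivAt h (testDeriv h y) y :=
  ((contDiff_infty_iff_deriv.1 h.contDiff).1 y).hasDerivAt

/-- The product `y ↦ e^{sy} h(y)`, for a test function `h`. -/
def testMulExp (s : ℝ) (h : 𝓓(halfLine, ℂ)) : 𝓓(halfLine, ℂ) :=
  ⟨fun y => (Real.exp (s * y) : ℂ) * h y,
    (Complex.ofRealCLM.contDiff.comp (Real.contDiff_exp.comp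
      (contDiff_const.mul contDiff_id))).mul h.contDiff,
    h.hasCompactSupport.mul_left, (tsupport_mul_subset_right).trans h.tsupport_subset⟩

theorem testMulExp_apply (s : ℝ) (h : 𝓓(halfLine, ℂ)) (y : ℝ) :
    testMulExp s h y = (Real.exp (s * y) : ℂ) * h y := rfl

theorem testDeriv_testMulExp (s : ℝ) (h : 𝓓(halfLine, ℂ)) :
    testDeriv (testMulExp s h) = (s : ℂ) • testMulExp s h + testMulExp s (testDeriv h) := by
  ext y
  have h1 : HasDerivAt (fun y : ℝ => s * y) s y := by simpa using (hasDerivAt_id y).const_mul s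
  have h2 := (h1.exp.ofReal_comp).mul (hasDerivAt_testFunction h y)
  have h3 : deriv (testMulExp s h) y = _ := h2.deriv
  rw [testDeriv_apply, h3]
  simp only [FunLike.coe_add, FunLike.coe_smul, Pi.add_apply, Pi.smul_apply, testMulExp_apply,
    smul_eq_mul]
  push_cast
  ring

theorem exists_support_subset_Ioo (h : 𝓓(halfLine, ℂ)) :
    ∃ a b, 0 < a ∧ a < b ∧ Function.support h ⊆ Ioo a b := by
  obtain ⟨δ, hδ, hle⟩ := exists_pos_le_of_testFunction h
  obtain ⟨M, hM⟩ := h.hasCompactSupport.isCompact.bddAbove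
  refine ⟨δ / 2, max M δ + 1, half_pos hδ, ?_, fun y hy => ⟨?_, ?_⟩⟩
  · linarith [le_max_right M δ]
  · linarith [hle y hy]
  · linarith [hM (subset_tsupport h hy), le_max_left M δ]

/-- The primitive starting to the left of the support of `k` vanishes to its right as well, because
the total integral is zero. -/
theorem exists_testDeriv_eq (k : 𝓓(halfLine, ℂ)) (hk : ∫ y, k y = 0) :
    ∃ H, testDeriv H = k := by
  obtain ⟨a, b, ha, hab, hsupp⟩ := exists_support_subset_Ioo k
  have hd : ∀ y, HasDerivAt (fun y => ∫ t in a..y, k t) (k y) y := fun y =>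
    intervalIntegral.integral_hasDerivAt_right (k.continuous.intervalIntegrable _ _)
      (k.continuous.stronglyMeasurableAtFilter _ _) k.continuous.continuousAt
  have hderiv : deriv (fun y => ∫ t in a..y, k t) = k := funext fun y => (hd y).deriv
  have hzero : Function.support (fun y => ∫ t in a..y, k t) ⊆ Icc a b := by
    intro y hy
    by_contra hcon
    refine hy ?_
    rcases lt_or_ge y a with h | h
    · refine (intervalIntegral.integral_congr (g := fun _ => (0 : ℂ)) fun t ht => ?_).trans
        intervalIntegral.integral_zero
      by_contra h0
      rw [uIcc_of_ge h.le] at ht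
      exact absurd (hsupp h0).1 (not_lt.2 ht.2)
    · have hb : b < y := by
        by_contra hb
        exact hcon ⟨h, not_lt.1 hb⟩
      change ∫ t in a..y, k t = 0
      rw [intervalIntegral.integral_eq_integral_of_support_subset
        (hsupp.trans fun t ht => ⟨ht.1, (ht.2.trans hb).le⟩), hk]
  have hts : tsupport (fun y => ∫ t in a..y, k t) ⊆ Icc a b :=
    closure_minimal hzero isClosed_Icc
  refine ⟨⟨fun y => ∫ t in a..y, k t, contDiff_infty_iff_deriv.2
    ⟨fun y => (hd y).differentiableAt, by rw [hderiv]; exact k.contDiff⟩,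
    HasCompactSupport.of_support_subset_isCompact isCompact_Icc hzero,
    hts.trans fun y hy => ha.trans_le hy.1⟩, ?_⟩
  ext y
  exact congrFun hderiv y

/-- A nonnegative bump suffices. A single `h₀` for all `s` serves twice: at `s = 0` as a normalizer
of integrals, and at `s = -x` to read off the coefficient of `e^{-x·}` measurably in `x`. -/
theorem exists_testFunction_integral_exp_ne_zero :
    ∃ h : 𝓓(halfLine, ℂ), ∀ s : ℝ, ∫ y in Ioi (0 : ℝ), (Real.exp (s * y) : ℂ) * h y ≠ 0 := by
  let χ : ContDiffBump (2 : ℝ) := ⟨1 / 2, 1, by norm_num, by norm_num⟩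
  have hts : tsupport (fun y => (χ y : ℂ)) ⊆ tsupport χ :=
    closure_mono fun y (hy : (χ y : ℂ) ≠ 0) (hcon : χ y = 0) => hy (by simp [hcon])
  have hpos : tsupport χ ⊆ Ioi 0 := by
    rw [χ.tsupport_eq, Real.closedBall_eq_Icc]
    intro y hy
    have := hy.1
    simp only [mem_Ioi]
    norm_num [χ] at this
    linarith
  refine ⟨⟨fun y => (χ y : ℂ), Complex.ofRealCLM.contDiff.comp χ.contDiff,
    χ.hasCompactSupport.comp_left (g := fun t : ℝ => (t : ℂ)) (by simp), hts.trans hpos⟩,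
    fun s => ?_⟩
  change ∫ y in Ioi (0 : ℝ), (Real.exp (s * y) : ℂ) * (χ y : ℂ) ≠ 0
  rw [setIntegral_eq_integral_of_forall_compl_eq_zero fun y hy => by
    rw [image_eq_zero_of_notMem_tsupport fun hcon => hy (hpos hcon), Complex.ofReal_zero, mul_zero]]
  have h1 : 0 < ∫ y, Real.exp (s * y) * χ y := by
    refine Continuous.integral_pos_of_hasCompactSupport_nonneg_nonzero (x := 2)
      (Continuous.mul (by fun_prop) χ.continuous) χ.hasCompactSupport.mul_left
      (fun y => mul_nonneg (Real.exp_pos _).le χ.nonneg) ?_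
    rw [χ.one_of_mem_closedBall (by simp [χ.rIn_pos.le])]
    positivity
  have h2 : ∫ y, (Real.exp (s * y) : ℂ) * (χ y : ℂ) =
      ((∫ y, Real.exp (s * y) * χ y : ℝ) : ℂ) := by
    rw [← integral_complex_ofReal]
    congr 1
    ext y
    push_cast
    rfl
  rw [h2]
  exact_mod_cast h1.ne'

theorem setIntegral_testFunction (h : 𝓓(halfLine, ℂ)) (f : ℝ → ℂ) :
    ∫ y in Ioi (0 : ℝ), f y * h y = ∫ y, f y * h y :=
  setIntegral_eq_integral_of_forall_compl_eq_zero fun y hy => by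
    rw [image_eq_zero_of_notMem_tsupport fun hcon => hy (h.tsupport_subset hcon), mul_zero]

/-! ### Weak solutions of `∂v/∂y = -xv` in `L^p(ℝ₊, ν_λ)` -/

section

variable {p lam : ℝ} [hp : Fact (1 ≤ p)] [hlam : Fact (-1 < lam)]

theorem integrableOn_of_isCompact (v : XSpace p lam) {K : Set ℝ} (hK : IsCompact K)
    (hsub : K ⊆ Ioi 0) : IntegrableOn v K := by
  have hfin : IsFiniteMeasure ((nu lam).restrict K) := ⟨by simpa using nu_lt_top lam hK hsub⟩
  have h1 : Integrable v ((nu lam).restrict K) :=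
    memLp_one_iff_integrable.1 (((Lp.memLp v).restrict K).mono_exponent (factOneLeOfReal p).out)
  have h2 : Integrable (K.indicator v) (nu lam) := (integrable_indicator_iff hK.measurableSet).2 h1
  rw [integrable_nu_iff hlam.out] at h2
  have h3 := h2.mono_set hsub
  have h4 : ContinuousOn (fun y => (nuDensity lam y)⁻¹) K :=
    ((continuousOn_nuDensity lam).mono hsub).inv₀ fun y hy =>
      (nuDensity_pos hlam.out (hsub hy)).ne'
  refine (IntegrableOn.continuousOn_smul (μ := volume) h3 h4 hK).congr_fun
    (fun y hy => ?_) hK.measurableSet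
  simp only [indicator_of_mem hy]
  rw [inv_smul_smul₀ (nuDensity_pos hlam.out (hsub hy)).ne']

theorem locallyIntegrableOn_coe (v : XSpace p lam) : LocallyIntegrableOn v (Ioi (0 : ℝ)) volume := by
  rw [locallyIntegrableOn_iff isOpen_Ioi.isLocallyClosed]
  exact fun K hsub hK => integrableOn_of_isCompact v hK hsub

/-- The hypothesis is the weak form of `v' = -xv`, so `e^{xy} v` has zero weak derivative. The
functional `k ↦ ⟨v, e^{xy} k⟩` thus kills all derivatives of test functions, that is, all `k` of
integral zero, and is a multiple of `∫ k`. -/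
theorem exists_ae_eq_mul_exp (v : XSpace p lam) (x : ℝ)
    (hv : ∀ h, (x : ℂ) * pairX v h = pairX v (testDeriv h)) :
    ∃ c : ℂ, ∀ᵐ y ∂(volume.restrict (Ioi (0 : ℝ))), v y = c * (Real.exp (-(x * y)) : ℂ) := by
  obtain ⟨h₀, hh₀⟩ := exists_testFunction_integral_exp_ne_zero
  have hh₀ : ∫ y, h₀ y ≠ 0 := by
    have := hh₀ 0
    rw [setIntegral_testFunction] at this
    simpa using this
  set c : ℂ := pairX v (testMulExp x h₀) / ∫ y, h₀ y with hc
  have hzero : ∀ k, ∫ y, k y = 0 → pairX v (testMulExp x k) = 0 := by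
    intro k hk
    obtain ⟨H, rfl⟩ := exists_testDeriv_eq k hk
    have h1 := hv (testMulExp x H)
    rw [testDeriv_testMulExp, pairX_add_right hlam.out, pairX_smul_right] at h1
    exact left_eq_add.1 h1
  have hform : ∀ k, pairX v (testMulExp x k) = c * ∫ y, k y := by
    intro k
    -- Subtracting a multiple of `h₀` makes the integral zero.
    have h1 := hzero (k + (-((∫ y, k y) / ∫ y, h₀ y)) • h₀) (by
      simp only [FunLike.coe_add, FunLike.coe_smul, Pi.add_apply, Pi.smul_apply, smul_eq_mul]
      rw [integral_add (integrable_testFunction k) ((integrable_testFunction h₀).const_mul _),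
        integral_const_mul, neg_mul, div_mul_cancel₀ _ hh₀, add_neg_cancel])
    have h2 : testMulExp x (k + (-((∫ y, k y) / ∫ y, h₀ y)) • h₀) =
        testMulExp x k + (-((∫ y, k y) / ∫ y, h₀ y)) • testMulExp x h₀ := by
      ext y
      simp only [FunLike.coe_add, FunLike.coe_smul, Pi.add_apply, Pi.smul_apply, smul_eq_mul,
        testMulExp_apply]
      ring
    rw [h2, pairX_add_right hlam.out, pairX_smul_right] at h1
    rw [hc]
    linear_combination h1
  refine ⟨c, ?_⟩
  have hexp : ContinuousOn (fun y : ℝ => c * (Real.exp (-(x * y)) : ℂ)) (Ioi 0) := by fun_prop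
  have hloc := (locallyIntegrableOn_coe v).sub (hexp.locallyIntegrableOn measurableSet_Ioi)
  have hae := isOpen_Ioi.ae_eq_zero_of_integral_contDiff_smul_eq_zero hloc (by
    intro k hk hkc hks
    let h : 𝓓(halfLine, ℂ) :=
      ⟨fun y => (k y : ℂ), Complex.ofRealCLM.contDiff.comp hk,
        hkc.comp_left (g := fun t : ℝ => (t : ℂ)) (by simp),
        (closure_mono (fun y (hy : (k y : ℂ) ≠ 0) (hcon : k y = 0) => hy (by simp [hcon]))).trans
          hks⟩
    -- Testing with `e^{-xy} h` undoes the factor `e^{xy}` and shows that `v` and `c e^{-xy}` have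
    -- the same pairing with `h`.
    have h1 := hform (testMulExp (-x) h)
    have h2 : testMulExp x (testMulExp (-x) h) = h := by
      ext y
      rw [testMulExp_apply, testMulExp_apply, ← mul_assoc, ← Complex.ofReal_mul, ← Real.exp_add]
      simp
    have h3 : ∀ y, k y • (v - fun y : ℝ => c * (Real.exp (-(x * y)) : ℂ)) y =
        v y * h y - c * testMulExp (-x) h y := fun y => by
      rw [testMulExp_apply, Complex.real_smul, Pi.sub_apply, neg_mul]
      change (k y : ℂ) * _ = _ * (k y : ℂ) - _ * (_ * (k y : ℂ))
      ring
    rw [h2, pairX, setIntegral_testFunction] at h1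
    have hint : Integrable fun y => v y * h y := by
      refine (integrableOn_iff_integrable_of_support_subset fun y hy => ?_).1
        (integrableOn_pairX hlam.out v h)
      by_contra hcon
      refine hy ?_
      simp only
      rw [image_eq_zero_of_notMem_tsupport fun h0 => hcon (h.tsupport_subset h0), mul_zero]
    simp only [h3]
    rw [integral_sub hint ((integrable_testFunction _).const_mul c), integral_const_mul, h1,
      sub_self])
  filter_upwards [(ae_restrict_iff' measurableSet_Ioi).2 hae] with y hy
  exact sub_eq_zero.1 hy

/-- For `x ≤ 0` one has `e^{-xy} ≥ 1`, so `|v|` dominates the constant `|c|`, which is in `L^p` of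
an infinite measure only if it is zero. -/
theorem eq_zero_of_nonpos (v : XSpace p lam) {x : ℝ} (hx : x ≤ 0)
    (hv : ∀ h, (x : ℂ) * pairX v h = pairX v (testDeriv h)) : v = 0 := by
  obtain ⟨c, hc⟩ := exists_ae_eq_mul_exp v x hv
  have hc' := (ae_nu_iff hlam.out).2 hc
  have hpos : ∀ᵐ y ∂(nu lam), 0 < y := (ae_nu_iff hlam.out).2 (ae_restrict_mem measurableSet_Ioi)
  have h1 : MemLp (fun _ : ℝ => c) (ENNReal.ofReal p) (nu lam) := by
    refine (Lp.memLp v).of_le aestronglyMeasurable_const ?_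
    filter_upwards [hc', hpos] with y hy hy0
    rw [hy, norm_mul, Complex.norm_real, Real.norm_eq_abs, Real.abs_exp]
    exact le_mul_of_one_le_right (norm_nonneg _) (Real.one_le_exp (by nlinarith))
  have hp0 : 0 < p := by linarith [hp.out]
  have h2 : c = 0 := by
    rcases (memLp_const_iff (by simpa using hp0) ENNReal.ofReal_ne_top).1 h1 with h | h
    · exact h
    · exact absurd (nu_univ hlam.out) h.ne
  rw [Lp.eq_zero_iff_ae_eq_zero]
  filter_upwards [hc'] with y hy
  rw [hy, h2, zero_mul, Pi.zero_apply]

theorem exists_eq_smul_expVec (v : XSpace p lam) {x : ℝ} (hx : 0 < x)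
    (hv : ∀ h, (x : ℂ) * pairX v h = pairX v (testDeriv h)) : ∃ c : ℂ, v = c • expVec p lam x := by
  obtain ⟨c, hc⟩ := exists_ae_eq_mul_exp v x hv
  refine ⟨c, Lp.ext ?_⟩
  filter_upwards [(ae_nu_iff hlam.out).2 hc, Lp.coeFn_smul c (expVec p lam x),
    coeFn_expVec (p := p) (lam := lam) hx] with y h1 h2 h3
  rw [h1, h2, Pi.smul_apply, h3, smul_eq_mul]

/-! ### Passing to a common exceptional set -/

/-- The pairs `(h, h')` form a subset of the separable metric space `C(K) × C(K)`, and a subset of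
such a space is separable. The derivative is recorded because the weak equation involves both `h`
and `h'`. -/
theorem exists_countable_dense_testFunctions (K : Set ℝ) (hK : IsCompact K) :
    ∃ s : ℕ → 𝓓(halfLine, ℂ), (∀ n, Function.support (s n) ⊆ K) ∧
      ∀ h : 𝓓(halfLine, ℂ), Function.support h ⊆ K → ∀ ε > 0, ∃ n, ∀ y ∈ K,
        ‖h y - s n y‖ ≤ ε ∧ ‖testDeriv h y - testDeriv (s n) y‖ ≤ ε := by
  have : CompactSpace K := isCompact_iff_compactSpace.1 hK
  let J : {h : 𝓓(halfLine, ℂ) // Function.support h ⊆ K} → C(K, ℂ) × C(K, ℂ) := fun h =>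
    (⟨fun y => h.1 y, h.1.continuous.comp continuous_subtype_val⟩,
      ⟨fun y => testDeriv h.1 y, (testDeriv h.1).continuous.comp continuous_subtype_val⟩)
  have hne : Nonempty (range J) := ⟨⟨_, ⟨0, by simp⟩, rfl⟩⟩
  choose s hs using fun n => (TopologicalSpace.denseSeq (range J) n).2
  refine ⟨fun n => (s n).1, fun n => (s n).2, fun h hh ε hε => ?_⟩
  obtain ⟨n, hn⟩ := (TopologicalSpace.denseRange_denseSeq (range J)).exists_dist_lt
    ⟨J ⟨h, hh⟩, mem_range_self _⟩ hε
  refine ⟨n, fun y hy => ?_⟩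
  rw [Subtype.dist_eq, ← hs n, Prod.dist_eq, max_lt_iff] at hn
  have h1 := (ContinuousMap.dist_apply_le_dist (⟨y, hy⟩ : K)).trans hn.1.le
  have h2 := (ContinuousMap.dist_apply_le_dist (⟨y, hy⟩ : K)).trans hn.2.le
  rw [dist_eq_norm] at h1 h2
  exact ⟨h1, h2⟩

theorem norm_pairX_sub_le (v : XSpace p lam) {K : Set ℝ} (hK : IsCompact K) (hsub : K ⊆ Ioi 0)
    {h k : 𝓓(halfLine, ℂ)} (hh : Function.support h ⊆ K) (hk : Function.support k ⊆ K) {ε : ℝ}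
    (hε : ∀ y ∈ K, ‖h y - k y‖ ≤ ε) :
    ‖pairX v h - pairX v k‖ ≤ ε * ∫ y in K, ‖v y‖ := by
  rw [pairX, pairX, ← integral_sub (integrableOn_pairX hlam.out v h)
    (integrableOn_pairX hlam.out v k)]
  have h0 : ∀ y, y ∉ K → v y * h y - v y * k y = 0 := fun y hy => by
    rw [Function.notMem_support.1 fun h1 => hy (hh h1),
      Function.notMem_support.1 fun h1 => hy (hk h1), sub_self]
  rw [setIntegral_eq_of_subset_of_forall_sdiff_eq_zero measurableSet_Ioi hsub
    fun y hy => h0 y hy.2, ← integral_const_mul]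
  refine norm_integral_le_of_norm_le ((integrableOn_of_isCompact v hK hsub).norm.const_mul ε) ?_
  filter_upwards [ae_restrict_mem hK.measurableSet] with y hy
  rw [← mul_sub, norm_mul, mul_comm]
  exact mul_le_mul_of_nonneg_right (hε y hy) (norm_nonneg _)

/-- The exceptional set of the hypothesis depends on `h`, which ranges over an uncountable family. A
countable family, dense in the sense above on each interval of an exhaustion of `ℝ₊`, gives one null
set. Both sides are continuous for this convergence at fixed `x`, since `g x` is integrable on
compact subsets. -/
theorem ae_forall_testFunction {g : ℝ → XSpace p lam}
    (hg : ∀ h, ∀ᵐ x : ℝ, (x : ℂ) * pairX (g x) h = pairX (g x) (testDeriv h)) :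
    ∀ᵐ x : ℝ, ∀ h, (x : ℂ) * pairX (g x) h = pairX (g x) (testDeriv h) := by
  let K : ℕ → Set ℝ := fun n => Icc (n + 1 : ℝ)⁻¹ (n + 1)
  have hK : ∀ n, IsCompact (K n) := fun n => isCompact_Icc
  have hsub : ∀ n, K n ⊆ Ioi 0 := fun n y hy => lt_of_lt_of_le (by positivity) hy.1
  choose s hs hdense using fun n => exists_countable_dense_testFunctions (K n) (hK n)
  have hall : ∀ᵐ x : ℝ, ∀ n m,
      (x : ℂ) * pairX (g x) (s n m) = pairX (g x) (testDeriv (s n m)) :=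
    ae_all_iff.2 fun n => ae_all_iff.2 fun m => hg _
  filter_upwards [hall] with x hx h
  obtain ⟨a, b, ha, hab, hsupp⟩ := exists_support_subset_Ioo h
  obtain ⟨n, hn⟩ := exists_nat_ge (max a⁻¹ b)
  have hsuppK : tsupport h ⊆ K n := by
    refine closure_minimal (fun y hy => ?_) isClosed_Icc
    have hy' := hsupp hy
    have h1 : a⁻¹ ≤ n + 1 := by linarith [le_max_left a⁻¹ b]
    have h2 : b ≤ n + 1 := by linarith [le_max_right a⁻¹ b]
    exact ⟨(inv_le_of_inv_le₀ ha h1).trans hy'.1.le, hy'.2.le.trans h2⟩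
  have hs' : ∀ m, Function.support (testDeriv (s n m)) ⊆ K n := fun m =>
    support_deriv_subset.trans (closure_minimal (hs n m) isClosed_Icc)
  have hh : Function.support h ⊆ K n := (subset_tsupport h).trans hsuppK
  have hh' : Function.support (testDeriv h) ⊆ K n := support_deriv_subset.trans hsuppK
  set I : ℝ := ∫ y in K n, ‖g x y‖
  have hI : 0 ≤ I := integral_nonneg fun y => norm_nonneg _
  have key : ∀ ε > 0, ‖(x : ℂ) * pairX (g x) h - pairX (g x) (testDeriv h)‖ ≤
      ε * ((|x| + 1) * I) := by
    intro ε hε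
    obtain ⟨m, hm⟩ := hdense n h hh ε hε
    have h1 := norm_pairX_sub_le (g x) (hK n) (hsub n) hh (hs n m) fun y hy => (hm y hy).1
    have h2 := norm_pairX_sub_le (g x) (hK n) (hsub n) hh' (hs' m) fun y hy => (hm y hy).2
    have h3 : (x : ℂ) * pairX (g x) h - pairX (g x) (testDeriv h) =
        (x : ℂ) * (pairX (g x) h - pairX (g x) (s n m)) -
          (pairX (g x) (testDeriv h) - pairX (g x) (testDeriv (s n m))) := by
      linear_combination hx n m
    rw [h3]
    refine (norm_sub_le _ _).trans ?_
    rw [norm_mul, Complex.norm_real, Real.norm_eq_abs]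
    have h4 := mul_le_mul_of_nonneg_left h1 (abs_nonneg x)
    linarith
  rw [← sub_eq_zero, ← norm_le_zero_iff]
  refine le_of_forall_pos_le_add fun ε hε => ?_
  have hpos : 0 < (|x| + 1) * I + 1 := by positivity
  have h1 := key (ε / ((|x| + 1) * I + 1)) (by positivity)
  rw [zero_add]
  refine h1.trans ?_
  rw [div_mul_eq_mul_div, div_le_iff₀ hpos]
  nlinarith

end

/-! ### Analytic elements and the Cauchy–Riemann equation -/

theorem integrable_analytic_test {F : ℂ → ℂ} (hF : ContinuousOn F halfPlane) (φ : 𝓢(ℝ, ℂ))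
    (h : 𝓓(halfLine, ℂ)) (hφ : HasCompactSupport φ) :
    Integrable (fun z : ℂ => F z * (φ z.re * h z.im)) := by
  refine (integrableOn_iff_integrable_of_support_subset fun z hz => ?_).1
    (integrableOn_test hF φ h hφ)
  by_contra hcon
  refine hz ?_
  simp only
  rw [image_eq_zero_of_notMem_tsupport (f := h) fun h0 => hcon (h.tsupport_subset h0), mul_zero,
    mul_zero]

theorem setIntegral_halfPlane_test (F : ℂ → ℂ) (φ : ℝ → ℂ) (h : 𝓓(halfLine, ℂ)) :
    ∫ z in halfPlane, F z * (φ z.re * h z.im) = ∫ z, F z * (φ z.re * h z.im) :=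
  setIntegral_eq_integral_of_forall_compl_eq_zero fun z hz => by
    rw [image_eq_zero_of_notMem_tsupport (f := h) fun h0 => hz (h.tsupport_subset h0), mul_zero,
      mul_zero]

/-- Over the support of `h` this is the product rule, with the complex derivative of `F`
contributing `v F'`. Elsewhere nothing is known of `F`, but the product vanishes in a neighbourhood.
-/
theorem hasLineDerivAt_analytic_test {F : ℂ → ℂ} (hF : DifferentiableOn ℂ F halfPlane)
    (φ : 𝓢(ℝ, ℂ)) (h : 𝓓(halfLine, ℂ)) (z v : ℂ) :
    HasLineDerivAt ℝ (fun z : ℂ => F z * (φ z.re * h z.im))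
      (v * (deriv F z * (φ z.re * h z.im)) +
        (v.re * (F z * (deriv φ z.re * h z.im)) + v.im * (F z * (φ z.re * testDeriv h z.im)))) z v := by
  by_cases hz : z.im ∈ tsupport h
  · have hz0 : z ∈ halfPlane := h.tsupport_subset hz
    have hline : HasDerivAt (fun t : ℝ => z + t • v) v 0 := by
      simpa using ((hasDerivAt_id (0 : ℝ)).smul_const v).const_add z
    have hopen : IsOpen halfPlane := isOpen_lt continuous_const Complex.continuous_im
    have hFz : HasDerivAt F (deriv F z) (z + (0 : ℝ) • v) := by
      simpa using (hF.differentiableAt (hopen.mem_nhds hz0)).hasDerivAt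
    have h1 : HasDerivAt (fun t : ℝ => F (z + t • v)) (deriv F z * v) 0 := hFz.comp 0 hline
    have hre : HasDerivAt (fun t : ℝ => (z + t • v).re) v.re 0 :=
      Complex.reCLM.hasFDerivAt.comp_hasDerivAt 0 hline
    have him : HasDerivAt (fun t : ℝ => (z + t • v).im) v.im 0 :=
      Complex.imCLM.hasFDerivAt.comp_hasDerivAt 0 hline
    have hφz : HasDerivAt φ (deriv φ z.re) (z + (0 : ℝ) • v).re := by simpa using φ.hasDerivAt z.re
    have hhz : HasDerivAt h (testDeriv h z.im) (z + (0 : ℝ) • v).im := by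
      simpa using hasDerivAt_testFunction h z.im
    have h2 : HasDerivAt (fun t : ℝ => φ (z + t • v).re) (v.re • deriv φ z.re) 0 :=
      hφz.scomp 0 hre
    have h3 : HasDerivAt (fun t : ℝ => h (z + t • v).im) (v.im • testDeriv h z.im) 0 :=
      hhz.scomp 0 him
    have h4 := h1.mul (h2.mul h3)
    refine h4.congr_deriv ?_
    have h5 : z + (0 : ℝ) • v = z := by simp
    simp only [Pi.mul_apply, h5]
    simp only [Complex.real_smul]
    ring
  · have h0 : h z.im = 0 := image_eq_zero_of_notMem_tsupport hz
    have h1 : testDeriv h z.im = 0 :=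
      image_eq_zero_of_notMem_tsupport fun hcon => hz (tsupport_deriv_subset hcon)
    rw [h0, h1]
    simp only [mul_zero, add_zero]
    have hev : (fun z : ℂ => F z * (φ z.re * h z.im)) =ᶠ[nhds z] fun _ => 0 := by
      have h2 := Complex.continuous_im.continuousAt.eventually
        (((isClosed_tsupport h).isOpen_compl).mem_nhds hz)
      filter_upwards [h2] with w hw
      rw [image_eq_zero_of_notMem_tsupport (f := h) hw, mul_zero, mul_zero]
    exact (((hasFDerivAt_const (𝕜 := ℝ) (0 : ℂ) z).hasLineDerivAt v)).congr_of_eventuallyEq hev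

/-- A directional derivative of a compactly supported function integrates to zero. The directions
`1` and `i` give two relations containing the same integral of `F'`, which is then eliminated. -/
theorem integral_cauchyRiemann_test {F : ℂ → ℂ} (hF : DifferentiableOn ℂ F halfPlane)
    (φ : 𝓢(ℝ, ℂ)) (h : 𝓓(halfLine, ℂ)) (hφ : HasCompactSupport φ) :
    (∫ z in halfPlane, F z * (SchwartzMap.derivCLM ℂ ℂ φ z.re * h z.im)) +
      Complex.I * ∫ z in halfPlane, F z * (φ z.re * testDeriv h z.im) = 0 := by
  have hopen : IsOpen halfPlane := isOpen_lt continuous_const Complex.continuous_im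
  have hdF : ContinuousOn (deriv F) halfPlane := (hF.deriv hopen).continuousOn
  have hφ' : HasCompactSupport (SchwartzMap.derivCLM ℂ ℂ φ) := hφ.deriv
  have i1 := integrable_analytic_test hF.continuousOn φ h hφ
  have i2 := integrable_analytic_test hdF φ h hφ
  have i3 := integrable_analytic_test hF.continuousOn _ h hφ'
  have i4 := integrable_analytic_test hF.continuousOn φ (testDeriv h) hφ
  have key : ∀ v : ℂ, v * (∫ z, deriv F z * (φ z.re * h z.im)) +
      (v.re * (∫ z, F z * (SchwartzMap.derivCLM ℂ ℂ φ z.re * h z.im)) +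
        v.im * ∫ z, F z * (φ z.re * testDeriv h z.im)) = 0 := by
    intro v
    have i5 := (i2.const_mul v).add ((i3.const_mul (v.re : ℂ)).add (i4.const_mul (v.im : ℂ)))
    -- Integration by parts against the constant function `1`.
    have hB := integral_bilinear_hasLineDerivAt_right_eq_neg_left_of_integrable
      (μ := (volume : Measure ℂ)) (f := fun z : ℂ => F z * (φ z.re * h z.im)) (g := fun _ => (1 : ℂ))
      (g' := fun _ => 0) (v := v) (B := ContinuousLinearMap.mul ℝ ℂ) (by simpa using! i5) (by simp)
      (by simpa using i1) (fun z _ => hasLineDerivAt_analytic_test hF φ h z v)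
      (fun z _ => (hasFDerivAt_const (𝕜 := ℝ) (1 : ℂ) z).hasLineDerivAt v)
    simp only [ContinuousLinearMap.mul_apply', mul_zero, integral_zero, mul_one] at hB
    rw [zero_eq_neg] at hB
    rw [← hB, ← integral_const_mul, ← integral_const_mul, ← integral_const_mul,
      ← integral_add (i3.const_mul _) (i4.const_mul _)]
    exact (integral_add (i2.const_mul _) ((i3.const_mul _).add (i4.const_mul _))).symm
  rw [setIntegral_halfPlane_test, setIntegral_halfPlane_test]
  have k1 := key 1
  have k2 := key Complex.I
  simp only [Complex.one_re, Complex.one_im, Complex.I_re, Complex.I_im, Complex.ofReal_one,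
    Complex.ofReal_zero, one_mul, zero_mul, add_zero, zero_add] at k1 k2
  linear_combination k1 + Complex.I * k2 - (∫ z, deriv F z * (φ z.re * h z.im)) * Complex.I_mul_I

section

variable {q p lam : ℝ} [hq : Fact (1 ≤ q)] [hp : Fact (1 ≤ p)] [hlam : Fact (-1 < lam)]

/-- The weak Cauchy–Riemann equation for all Schwartz `φ`, by density and continuity. It is needed
at `fourierS χ`, whose support need not be compact. -/
theorem eval_derivCLM_add {u : DtDual} {F : ℂ → ℂ} (hF : DifferentiableOn ℂ F halfPlane)
    (hu : IsGivenBy u F) (φ : 𝓢(ℝ, ℂ)) (h : 𝓓(halfLine, ℂ)) :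
    u.eval (SchwartzMap.derivCLM ℂ ℂ φ) h + Complex.I * u.eval φ (testDeriv h) = 0 := by
  obtain ⟨Φ, hΦ, hlim⟩ := exists_tendsto_hasCompactSupport φ
  have hcont : Continuous fun φ => u.eval (SchwartzMap.derivCLM ℂ ℂ φ) h +
      Complex.I * u.eval φ (testDeriv h) :=
    ((u.continuous_eval h).comp (SchwartzMap.derivCLM ℂ ℂ).continuous).add
      (continuous_const.mul (u.continuous_eval (testDeriv h)))
  refine tendsto_nhds_unique ((hcont.tendsto φ).comp hlim) ?_
  refine tendsto_const_nhds.congr fun n => ?_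
  have hΦ' : HasCompactSupport (SchwartzMap.derivCLM ℂ ℂ (Φ n)) := (hΦ n).deriv
  simp only [Function.comp_apply]
  rw [hu _ _ hΦ', hu _ _ (hΦ n), integral_cauchyRiemann_test hF _ _ (hΦ n)]

/-- With `φ = fourierS χ`, the Cauchy–Riemann equation says that `x⟨U1 u x, h⟩ - ⟨U1 u x, h'⟩`
integrates to zero against every `χ`. -/
theorem ae_mul_pairX_eq {u : FourierSpace q p lam} {F : ℂ → ℂ}
    (hF : DifferentiableOn ℂ F halfPlane) (hu : IsGivenBy (u : DtDual) F) (h : 𝓓(halfLine, ℂ)) :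
    ∀ᵐ x : ℝ, (x : ℂ) * pairX (U1 u x) h = pairX (U1 u x) (testDeriv h) := by
  have hpair : ∀ k : 𝓓(halfLine, ℂ), LocallyIntegrable (fun x => pairX (U1 u x) k) := fun k => by
    obtain ⟨T, hT⟩ := exists_pairX_clm (p := p) hlam.out k
    simp only [← hT]
    exact (T.comp_memLp' (Lp.memLp (U1 u))).locallyIntegrable (factOneLeOfReal q).out
  have hloc : LocallyIntegrable fun x : ℝ =>
      (x : ℂ) * pairX (U1 u x) h - pairX (U1 u x) (testDeriv h) := by
    refine LocallyIntegrable.sub ?_ (hpair _)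
    rw [← locallyIntegrableOn_univ]
    exact LocallyIntegrableOn.continuousOn_mul
      ((locallyIntegrableOn_univ (μ := volume)).2 (hpair h))
      Complex.continuous_ofReal.continuousOn isOpen_univ.isLocallyClosed
  have hae := ae_eq_zero_of_integral_contDiff_smul_eq_zero hloc fun k hk hkc => by
    have hk1 : HasCompactSupport (Complex.ofRealCLM ∘ k) := hkc.comp_left rfl
    have hk2 : ContDiff ℝ ((⊤ : ℕ∞) : WithTop ℕ∞) (Complex.ofRealCLM ∘ k) :=
      Complex.ofRealCLM.contDiff.comp hk
    set χ : 𝓢(ℝ, ℂ) := hk1.toSchwartzMap hk2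
    have h1 := eval_derivCLM_add hF hu (fourierS χ) h
    rw [derivCLM_fourierS, ← map_smul, eval_fourierS, eval_fourierS,
      pairMixed_smul_left hlam.out] at h1
    have h2 : pairMixed (U1 u) (mulVar χ) h - pairMixed (U1 u) χ (testDeriv h) = 0 := by
      have h3 : (Complex.I * (Real.sqrt Real.pi : ℂ)) * (pairMixed (U1 u) (mulVar χ) h -
          pairMixed (U1 u) χ (testDeriv h)) = 0 := by linear_combination -h1
      exact (mul_eq_zero.1 h3).resolve_left (mul_ne_zero Complex.I_ne_zero sqrt_pi_ne_zero)
    rw [← h2, pairMixed, pairMixed, ← integral_sub (integrable_mul_pairX hlam.out _ _ _)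
      (integrable_mul_pairX hlam.out _ _ _)]
    congr 1
    ext x
    rw [mulVar_apply]
    change (k x) • _ = _ * (k x : ℂ) * _ - (k x : ℂ) * _
    rw [Complex.real_smul]
    ring
  filter_upwards [hae] with x hx
  exact sub_eq_zero.1 hx

/-- Almost every fibre of `U1 u` is zero or a multiple of `e^{-x·}`. The coefficient inherits
measurability from its formula, and its `L^q` bound from the isometry identity for `rayFun`. -/
theorem exists_rayEmbedding_eq_U1 {u : FourierSpace q p lam} {F : ℂ → ℂ}
    (hF : DifferentiableOn ℂ F halfPlane) (hu : IsGivenBy (u : DtDual) F) :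
    ∃ φ : LqHalfLine q, rayEmbedding q p lam φ = U1 u := by
  have hall := ae_forall_testFunction fun h => ae_mul_pairX_eq hF hu h
  obtain ⟨h₀, hh₀⟩ := exists_testFunction_integral_exp_ne_zero
  have hd : ∀ x, 0 < x → pairX (expVec p lam x) h₀ ≠ 0 := by
    intro x hx
    have h1 : pairX (expVec p lam x) h₀ = ∫ y in Ioi (0 : ℝ), (Real.exp (-x * y) : ℂ) * h₀ y := by
      refine integral_congr_ae ((ae_nu_iff hlam.out).1 ?_)
      filter_upwards [coeFn_expVec (p := p) (lam := lam) hx] with y hy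
      rw [hy, neg_mul]
    rw [h1]
    exact hh₀ _
  obtain ⟨T, hT⟩ := exists_pairX_clm (p := p) hlam.out h₀
  -- If `U1 u x = c e^{-x·}`, pairing with `h₀` recovers `c`; division by `θ_{λ,p}(x)` gives `φ(x)`.
  let φ : ℝ → ℂ := fun x => pairX (U1 u x) h₀ *
    ((pairX (expVec p lam x) h₀)⁻¹ * ((theta p lam x : ℂ))⁻¹)
  have hray : ∀ᵐ x, rayFun p lam φ x = U1 u x := by
    filter_upwards [hall] with x hx
    rcases le_or_gt x 0 with h0 | h0
    · rw [rayFun, expVec_of_nonpos h0, smul_zero, eq_zero_of_nonpos _ h0 hx]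
    · obtain ⟨c, hc⟩ := exists_eq_smul_expVec _ h0 hx
      have hth : (theta p lam x : ℂ) ≠ 0 := by
        exact_mod_cast (theta_pos hp.out hlam.out h0).ne'
      have h1 : φ x * (theta p lam x : ℂ) = c := by
        have h2 : pairX (U1 u x) h₀ = c * pairX (expVec p lam x) h₀ := by
          rw [hc, ← hT, map_smul, hT, smul_eq_mul]
        simp only [φ, h2]
        have := hd x h0
        field_simp
      rw [rayFun, h1, hc]
  have hmeas : AEStronglyMeasurable φ (volume.restrict (Ioi 0)) := by
    refine AEStronglyMeasurable.mul ?_ (AEStronglyMeasurable.mul ?_ ?_)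
    · simp only [← hT]
      exact (T.continuous.comp_aestronglyMeasurable (Lp.aestronglyMeasurable (U1 u))).restrict
    · simp only [← hT]
      refine ContinuousOn.aestronglyMeasurable (ContinuousOn.inv₀
        (T.continuous.comp_continuousOn continuousOn_expVec) fun x hx => ?_) measurableSet_Ioi
      rw [hT]
      exact hd x hx
    · exact (Complex.measurable_ofReal.comp (measurable_theta p lam)).inv.aestronglyMeasurable
  have hLq : MemLp φ (ENNReal.ofReal q) (volume.restrict (Ioi 0)) := by
    refine ⟨hmeas, ?_⟩
    rw [← eLpNorm_rayFun (p := p) (lam := lam), eLpNorm_congr_ae hray]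
    exact (Lp.memLp (U1 u)).2
  refine ⟨hLq.toLp φ, Lp.ext ?_⟩
  filter_upwards [coeFn_rayEmbedding (p := p) (lam := lam) (hLq.toLp φ), hray,
    (ae_restrict_iff' measurableSet_Ioi).1 hLq.coeFn_toLp] with x h1 h2 h3
  rw [h1, ← h2]
  rcases le_or_gt x 0 with h0 | h0
  · rw [rayFun, rayFun, expVec_of_nonpos h0, smul_zero, smul_zero]
  · rw [rayFun, h3 h0, rayFun]

end

/-! ### The isometric isomorphism -/

section

variable {q p lam : ℝ} [hq : Fact (1 ≤ q)] [hp : Fact (1 ≤ p)] [hlam : Fact (-1 < lam)]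

variable (q p lam) in
/-- `U_{1,λ}` as an isometric isomorphism. -/
def U1Equiv : FourierSpace q p lam ≃ₗᵢ[ℂ] MixedLp q p lam :=
  LinearIsometryEquiv.ofSurjective ⟨U1, fun _ => rfl⟩ U1_surjective

theorem U1_U1Equiv_symm (g : MixedLp q p lam) : U1 ((U1Equiv q p lam).symm g) = g :=
  (U1Equiv q p lam).apply_symm_apply g

theorem U1Equiv_symm_mem (φ : LqHalfLine q) :
    (U1Equiv q p lam).symm (rayEmbedding q p lam φ) ∈ AnalyticSpace q p lam :=
  ⟨paleyWiener p lam φ, differentiableOn_paleyWiener hp.out hlam.out (Lp.memLp φ),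
    isGivenBy_paleyWiener (U1_U1Equiv_symm _)⟩

variable (q p lam) in
/-- The operator `φ ↦ U_{1,λ}⁻¹ (x ↦ φ(x) θ_{λ,p}(x) e^{-x ·})`. -/
def paleyWienerLI : LqHalfLine q →ₗᵢ[ℂ] AnalyticSpace q p lam where
  toLinearMap := (((U1Equiv q p lam).symm.toLinearEquiv : MixedLp q p lam →ₗ[ℂ] _) ∘ₗ
    (rayEmbedding q p lam).toLinearMap).codRestrict (AnalyticSpace q p lam) U1Equiv_symm_mem
  norm_map' φ := by
    change ‖(U1Equiv q p lam).symm (rayEmbedding q p lam φ)‖ = ‖φ‖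
    rw [LinearIsometryEquiv.norm_map, LinearIsometry.norm_map]

theorem U1_paleyWienerLI (φ : LqHalfLine q) :
    U1 (paleyWienerLI q p lam φ : FourierSpace q p lam) = rayEmbedding q p lam φ :=
  U1_U1Equiv_symm _

theorem paleyWienerLI_surjective : Function.Surjective (paleyWienerLI q p lam) := by
  rintro ⟨u, F, hF, hu⟩
  obtain ⟨φ, hφ⟩ := exists_rayEmbedding_eq_U1 hF hu
  exact ⟨φ, Subtype.ext (U1_injective ((U1_paleyWienerLI φ).trans hφ))⟩

variable (q p lam) in
/-- The Paley–Wiener isomorphism of `L^q(ℝ₊)` onto `𝒜^{q,p}_λ(Π)`. -/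
def paleyWienerIso : LqHalfLine q ≃ₗᵢ[ℂ] AnalyticSpace q p lam :=
  LinearIsometryEquiv.ofSurjective (paleyWienerLI q p lam) paleyWienerLI_surjective

theorem U1_paleyWienerIso (φ : LqHalfLine q) :
    U1 (paleyWienerIso q p lam φ : FourierSpace q p lam) = rayEmbedding q p lam φ :=
  U1_paleyWienerLI φ

theorem U1_eq_rayEmbedding_symm (f : AnalyticSpace q p lam) :
    U1 (f : FourierSpace q p lam) = rayEmbedding q p lam ((paleyWienerIso q p lam).symm f) := by
  rw [← U1_paleyWienerIso, LinearIsometryEquiv.apply_symm_apply]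

theorem coeFn_rayFun (φ : ℝ → ℂ) {x : ℝ} (hx : 0 < x) :
    ∀ᵐ t ∂(nu lam), rayFun p lam φ x t =
      φ x * (theta p lam x : ℂ) * (Real.exp (-(x * t)) : ℂ) := by
  filter_upwards [Lp.coeFn_smul (φ x * (theta p lam x : ℂ)) (expVec p lam x),
    coeFn_expVec (p := p) (lam := lam) hx] with t h1 h2
  rw [rayFun, h1, Pi.smul_apply, h2, smul_eq_mul]

/-- The indicator and `|x|` treat both signs of `x` at once, in the form that matches the fibres of
`U2`; for `x < 0` both sides are zero. -/
theorem eq_rayFun_iff (φ : ℝ → ℂ) {x : ℝ} (hx : x ≠ 0) (v : XSpace p lam) :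
    v = rayFun p lam φ x ↔ ∀ᵐ t ∂(volume.restrict (Ioi (0 : ℝ))),
      v t = (Ioi (0 : ℝ)).indicator φ x * (theta p lam |x| : ℂ) *
        (Real.exp (-(|x| * t)) : ℂ) := by
  rw [← ae_nu_iff hlam.out, Lp.ext_iff]
  rcases hx.lt_or_gt with h | h
  · rw [rayFun, expVec_of_nonpos h.le, smul_zero, indicator_of_notMem (by simpa using h.le)]
    refine Filter.eventually_congr ?_
    filter_upwards [Lp.coeFn_zero ℂ (ENNReal.ofReal p) (nu lam)] with t ht
    rw [ht, zero_mul, zero_mul, Pi.zero_apply]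
  · rw [abs_of_pos h, indicator_of_mem (mem_Ioi.2 h)]
    refine Filter.eventually_congr ?_
    filter_upwards [coeFn_rayFun (p := p) (lam := lam) φ h] with t ht
    rw [ht]

/-- Both conditions are compared fibre by fibre for `x ≠ 0`, where the substitution `β_λ(|x|, ·)` is
meaningful. -/
theorem eq_paleyWienerIso_iff (φ : LqHalfLine q) (u : FourierSpace q p lam) :
    u = paleyWienerIso q p lam φ ↔
      ∀ᵐ x : ℝ, ∀ᵐ y ∂(volume.restrict (Ioi (0 : ℝ))), Ulam u x y = R0 p φ x y := by
  rw [← U1_injective.eq_iff, U1_paleyWienerIso, Lp.ext_iff]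
  have hne : ∀ᵐ x : ℝ, x ≠ 0 := Measure.ae_ne volume 0
  refine Filter.eventually_congr ?_
  filter_upwards [coeFn_rayEmbedding (p := p) (lam := lam) φ, hne] with x hx hx0
  rw [hx, eq_rayFun_iff _ hx0, ← ae_weight_mul_comp_beta_eq_iff hp.out hlam.out (abs_pos.2 hx0)]
  rfl

theorem exp_mul_exp_rpow {p : ℝ} (hp : 1 ≤ p) (y : ℝ) :
    Real.exp (-y / p) * Real.exp (-y / p) ^ (p - 1) = Real.exp (-y) := by
  have hp0 : p ≠ 0 := by linarith
  rw [← Real.exp_mul, ← Real.exp_add]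
  congr 1
  field_simp
  ring

/-- On `x > 0` one has `U_λ f = φ(x) e^{-y/p}`, and the weight in `R0inv` completes the exponential
to `e^{-y}`, of integral one. -/
theorem paleyWienerIso_symm_ae_eq (f : AnalyticSpace q p lam) :
    (paleyWienerIso q p lam).symm f =ᵐ[volume.restrict (Ioi 0)] Rlam (f : FourierSpace q p lam) := by
  have h := (eq_paleyWienerIso_iff ((paleyWienerIso q p lam).symm f) (f : FourierSpace q p lam)).1
    (by rw [LinearIsometryEquiv.apply_symm_apply])
  filter_upwards [ae_restrict_of_ae h, ae_restrict_mem measurableSet_Ioi] with x hx hx0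
  rw [Rlam, R0inv, indicator_of_mem hx0]
  have h1 : ∫ y in Ioi (0 : ℝ), Ulam (f : FourierSpace q p lam) x y *
      ((Real.exp (-y / p) ^ (p - 1) : ℝ) : ℂ) =
      ∫ y in Ioi (0 : ℝ), (paleyWienerIso q p lam).symm f x * ((Real.exp (-y) : ℝ) : ℂ) := by
    refine integral_congr_ae ?_
    filter_upwards [hx] with y hy
    rw [hy, R0, indicator_of_mem hx0, mul_assoc, ← Complex.ofReal_mul, exp_mul_exp_rpow hp.out]
  rw [h1, integral_const_mul, integral_complex_ofReal, integral_exp_neg_Ioi_zero,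
    Complex.ofReal_one, mul_one]

/-! ### The integral formula for the inverse -/

/-- The computation shared by all readings of the inner integral: `∫ e^{-pxη} dν_λ = θ^{-p}`, and
`θ^{p-1} · θ · θ^{-p} = 1`. -/
theorem integral_formula {x : ℝ} (hx : 0 < x) (c : ℂ) {G : ℝ → ℂ}
    (hG : ∀ᵐ η ∂(nu lam), G η = (Real.sqrt 2 : ℂ) * Real.pi * c * (theta p lam x : ℂ) *
      (Real.exp (-(p * x * η)) : ℂ)) :
    Integrable G (nu lam) ∧
      c = (((Real.sqrt 2)⁻¹ * theta p lam x ^ (p - 1) : ℝ) : ℂ) *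
        ((Real.pi : ℂ)⁻¹ * ∫ η, G η ∂(nu lam)) := by
  have hpx : 0 < p * x := mul_pos (by linarith [hp.out]) hx
  have hth := theta_pos hp.out hlam.out hx
  refine ⟨((integrable_exp_nu hlam.out hpx).ofReal.const_mul _).congr
    (hG.mono fun η h => h.symm), ?_⟩
  rw [integral_congr_ae hG, integral_const_mul, integral_complex_ofReal,
    integral_exp_nu_eq_theta hp.out hlam.out hx, Real.rpow_sub_one hth.ne']
  have h1 : (Real.sqrt 2 : ℂ) ≠ 0 := by
    have : Real.sqrt 2 ≠ 0 := by positivity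
    exact_mod_cast this
  have h2 : (Real.pi : ℂ) ≠ 0 := by exact_mod_cast Real.pi_ne_zero
  have h3 : (theta p lam x : ℂ) ≠ 0 := by exact_mod_cast hth.ne'
  have h4 : ((theta p lam x ^ p : ℝ) : ℂ) ≠ 0 := by
    exact_mod_cast (Real.rpow_pos_of_pos hth p).ne'
  push_cast only [Complex.ofReal_mul, Complex.ofReal_inv, Complex.ofReal_div]
  field_simp

/-- The conjugate in `e^{-ix \bar ω}` contributes `e^{-xη}`, so the total damping is `e^{-x(p-1)η}`.
Together with the `e^{-xη}` of the transform of `f` it makes `e^{-pxη}`. -/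
theorem inverseKernel_eq (p x ξ η : ℝ) :
    inverseKernel p x (ξ + η * Complex.I) =
      Complex.exp (-(Complex.I * x * ξ)) * (Real.exp (-(x * (p - 1) * η)) : ℂ) := by
  have h1 : (ξ + η * Complex.I : ℂ).im = η := by simp
  have h2 : (starRingEnd ℂ) (ξ + η * Complex.I : ℂ) = ξ - η * Complex.I := by
    simp [sub_eq_add_neg]
  rw [inverseKernel, h1, h2, Complex.ofReal_exp, Complex.ofReal_exp, ← Complex.exp_add,
    ← Complex.exp_add]
  congr 1
  push_cast
  linear_combination ((x : ℂ) * η) * Complex.I_mul_I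

theorem ae_integral_formula (f : AnalyticSpace q p lam) :
    ∀ᵐ x ∂(volume.restrict (Ioi (0 : ℝ))),
      Integrable (fun η : ℝ => lineIntegral (f : FourierSpace q p lam) x η *
        inverseKernel p x (η * Complex.I)) (nu lam) ∧
      (paleyWienerIso q p lam).symm f x =
        (((Real.sqrt 2)⁻¹ * theta p lam x ^ (p - 1) : ℝ) : ℂ) *
          ((Real.pi : ℂ)⁻¹ * ∫ η : ℝ, lineIntegral (f : FourierSpace q p lam) x η *
            inverseKernel p x (η * Complex.I) ∂(nu lam)) := by
  set φ := (paleyWienerIso q p lam).symm f with hφ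
  have hU : ∀ᵐ x : ℝ, U1 (f : FourierSpace q p lam) x = rayFun p lam φ x := by
    rw [U1_eq_rayEmbedding_symm]
    exact coeFn_rayEmbedding φ
  filter_upwards [ae_restrict_of_ae hU, ae_restrict_mem measurableSet_Ioi] with x hx hx0
  have hx0 : 0 < x := hx0
  refine integral_formula hx0 (φ x) ?_
  filter_upwards [coeFn_rayFun (p := p) (lam := lam) φ hx0] with η hη
  have h1 := inverseKernel_eq p x 0 η
  rw [Complex.ofReal_zero, zero_add, mul_zero, neg_zero, Complex.exp_zero, one_mul] at h1
  have h2 : Real.exp (-(p * x * η)) = Real.exp (-(x * η)) * Real.exp (-(x * (p - 1) * η)) := by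
    rw [← Real.exp_add]; ring_nf
  have h3 : (Real.sqrt Real.pi : ℂ) * (Real.sqrt Real.pi : ℂ) = Real.pi := by
    rw [← Complex.ofReal_mul, Real.mul_self_sqrt Real.pi_pos.le]
  rw [lineIntegral, hx, hη, h1, h2, Real.sqrt_mul zero_le_two, Complex.ofReal_mul,
    Complex.ofReal_mul (Real.exp _), ← h3]
  ring

end

/-! ### Uniqueness of the analytic representative -/

/-- If `F` and `G` differ at `z₀`, a rotation makes their difference have positive real part on a
small box, and a product of two bumps supported there separates the distributions. -/
theorem eqOn_of_isGivenBy {u : DtDual} {F G : ℂ → ℂ} (hF : ContinuousOn F halfPlane)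
    (hG : ContinuousOn G halfPlane) (huF : IsGivenBy u F) (huG : IsGivenBy u G) :
    EqOn F G halfPlane := by
  intro z₀ hz₀
  by_contra hne
  have hopen : IsOpen halfPlane := isOpen_lt continuous_const Complex.continuous_im
  set w : ℂ := (starRingEnd ℂ) (F z₀ - G z₀)
  have hD : ContinuousOn (fun z => (w * (F z - G z)).re) halfPlane :=
    Complex.continuous_re.comp_continuousOn (continuousOn_const.mul (hF.sub hG))
  have hz₀pos : 0 < (w * (F z₀ - G z₀)).re := by
    rw [← Complex.normSq_eq_conj_mul_self, Complex.ofReal_re]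
    exact Complex.normSq_pos.2 (sub_ne_zero.2 hne)
  have hnhds : {z | z ∈ halfPlane ∧ 0 < (w * (F z - G z)).re} ∈ nhds z₀ :=
    Filter.inter_mem (hopen.mem_nhds hz₀)
      ((hD.continuousAt (hopen.mem_nhds hz₀)).eventually (lt_mem_nhds hz₀pos))
  obtain ⟨ε, hε, hball⟩ := Metric.mem_nhds_iff.1 hnhds
  -- A box of half-side `ε / 4` lies in the ball of radius `ε`, since the norm is at most `|Re| +
  -- |Im|`.
  have hδ : 0 < ε / 4 := by positivity
  have hmem : ∀ z : ℂ, |z.re - z₀.re| ≤ ε / 4 → |z.im - z₀.im| ≤ ε / 4 →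
      z ∈ halfPlane ∧ 0 < (w * (F z - G z)).re := by
    intro z h1 h2
    refine hball ?_
    rw [Metric.mem_ball, dist_eq_norm]
    refine (Complex.norm_le_abs_re_add_abs_im _).trans_lt ?_
    rw [Complex.sub_re, Complex.sub_im]
    linarith
  let χ₁ : ContDiffBump z₀.re := ⟨ε / 8, ε / 4, by positivity, by linarith⟩
  let χ₂ : ContDiffBump z₀.im := ⟨ε / 8, ε / 4, by positivity, by linarith⟩
  have hc₁ : HasCompactSupport fun x => (χ₁ x : ℂ) :=
    χ₁.hasCompactSupport.comp_left (g := fun t : ℝ => (t : ℂ)) (by simp)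
  have hts : tsupport (fun y => (χ₂ y : ℂ)) ⊆ tsupport χ₂ :=
    closure_mono fun y (hy : (χ₂ y : ℂ) ≠ 0) (hcon : χ₂ y = 0) => hy (by simp [hcon])
  have hpos : tsupport χ₂ ⊆ Ioi 0 := by
    rw [χ₂.tsupport_eq]
    intro y hy
    rw [Metric.mem_closedBall, Real.dist_eq] at hy
    have h1 := (hmem (z₀.re + y * Complex.I) (by simp [hδ.le]) (by simpa using hy)).1
    simpa [halfPlane] using h1
  let φ : 𝓢(ℝ, ℂ) := hc₁.toSchwartzMap (Complex.ofRealCLM.contDiff.comp χ₁.contDiff)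
  let h : 𝓓(halfLine, ℂ) := ⟨fun y => (χ₂ y : ℂ), Complex.ofRealCLM.contDiff.comp χ₂.contDiff,
    χ₂.hasCompactSupport.comp_left (g := fun t : ℝ => (t : ℂ)) (by simp), hts.trans hpos⟩
  have i1 := integrable_analytic_test hF φ h hc₁
  have i2 := integrable_analytic_test hG φ h hc₁
  have hint0 : ∫ z, w * (F z * (φ z.re * h z.im) - G z * (φ z.re * h z.im)) = 0 := by
    rw [integral_const_mul, integral_sub i1 i2, ← setIntegral_halfPlane_test,
      ← setIntegral_halfPlane_test, ← huF φ h hc₁, ← huG φ h hc₁, sub_self, mul_zero]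
  have hre : ∀ z : ℂ, (w * (F z * (φ z.re * h z.im) - G z * (φ z.re * h z.im))).re =
      (w * (F z - G z)).re * (χ₁ z.re * χ₂ z.im) := by
    intro z
    have h1 : w * (F z * (φ z.re * h z.im) - G z * (φ z.re * h z.im)) =
        w * (F z - G z) * ((χ₁ z.re * χ₂ z.im : ℝ) : ℂ) := by
      rw [Complex.ofReal_mul]
      change w * (F z * ((χ₁ z.re : ℂ) * (χ₂ z.im : ℂ)) - G z * ((χ₁ z.re : ℂ) * (χ₂ z.im : ℂ))) = _
      ring
    rw [h1, Complex.re_mul_ofReal]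
  have hint := (i1.sub i2).const_mul w
  have hsum : ∫ z : ℂ, (w * (F z - G z)).re * (χ₁ z.re * χ₂ z.im) = 0 := by
    have h1 := integral_re hint
    simp only [Pi.sub_apply, RCLike.re_to_complex, hint0, hre, Complex.zero_re] at h1
    exact h1
  have hnonneg : ∀ z : ℂ, 0 ≤ (w * (F z - G z)).re * (χ₁ z.re * χ₂ z.im) := by
    intro z
    by_cases h1 : |z.re - z₀.re| ≤ ε / 4 ∧ |z.im - z₀.im| ≤ ε / 4
    · exact mul_nonneg (hmem z h1.1 h1.2).2.le (mul_nonneg χ₁.nonneg χ₂.nonneg)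
    · have h2 : χ₁ z.re * χ₂ z.im = 0 := by
        rcases not_and_or.1 h1 with h | h
        · rw [χ₁.zero_of_le_dist (by rw [Real.dist_eq]; exact (not_le.1 h).le), zero_mul]
        · rw [χ₂.zero_of_le_dist (by rw [Real.dist_eq]; exact (not_le.1 h).le), mul_zero]
      rw [h2, mul_zero]
  have hint' : Integrable fun z : ℂ => (w * (F z - G z)).re * (χ₁ z.re * χ₂ z.im) := by
    refine hint.re.congr (Filter.Eventually.of_forall fun z => ?_)
    exact hre z
  have hlt := (integral_pos_iff_support_of_nonneg hnonneg hint').2 ?_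
  · exact hlt.ne' hsum
  have hO : IsOpen (Metric.ball z₀.re (ε / 4) ×ℂ Metric.ball z₀.im (ε / 4)) :=
    Metric.isOpen_ball.reProdIm Metric.isOpen_ball
  refine (hO.measure_pos volume ⟨z₀, ?_⟩).trans_le (measure_mono fun z hz => ?_)
  · exact ⟨Metric.mem_ball_self hδ, Metric.mem_ball_self hδ⟩
  · have h1 := hz.1
    have h2 := hz.2
    have h3 : 0 < χ₁ z.re := χ₁.pos_of_mem_ball h1
    have h4 : 0 < χ₂ z.im := χ₂.pos_of_mem_ball h2
    rw [mem_preimage, Metric.mem_ball, Real.dist_eq] at h1 h2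
    exact (mul_pos (hmem z h1.le h2.le).2 (mul_pos h3 h4)).ne'

/-! ### The integral formula with Lebesgue integrals -/

theorem continuous_line {F : ℂ → ℂ} (hF : ContinuousOn F halfPlane) {η : ℝ} (hη : 0 < η) :
    Continuous fun ξ : ℝ => F (ξ + η * Complex.I) := by
  refine hF.comp_continuous (by fun_prop) fun ξ => ?_
  simpa [halfPlane] using hη

section

variable {q p lam : ℝ} [hq : Fact (1 ≤ q)] [hp : Fact (1 ≤ p)] [hlam : Fact (-1 < lam)]

/-- `L¹` inversion on a single line; the null set still depends on `η`. -/
theorem ae_integral_line_eq {φ : ℝ → ℂ}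
    (hφ : MemLp φ (ENNReal.ofReal q) (volume.restrict (Ioi 0))) {F : ℂ → ℂ}
    (hF : EqOn F (paleyWiener p lam φ) halfPlane) {η : ℝ} (hη : 0 < η)
    (hint : Integrable fun ξ : ℝ => F (ξ + η * Complex.I)) :
    ∀ᵐ x : ℝ, ∫ ξ : ℝ, F (ξ + η * Complex.I) * Complex.exp (-(Complex.I * x * ξ)) =
      (Real.sqrt 2 : ℂ) * Real.pi * rayKernel p lam φ η x := by
  have hk := (integrable_rayKernel hp.out hlam.out hφ hη).const_mul (Real.sqrt 2 : ℂ)⁻¹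
  have h := ae_eq_of_eq_integral_exp hk hint fun ξ => by
    have hmem : (ξ + η * Complex.I : ℂ) ∈ halfPlane := by simpa [halfPlane] using hη
    simp only [hF hmem, paleyWiener_eq hp.out hlam.out, ← integral_const_mul, mul_assoc]
  filter_upwards [h] with x hx
  rw [hx]
  have h1 : (Real.sqrt 2 : ℂ) * (Real.sqrt 2 : ℂ) = 2 := by
    rw [← Complex.ofReal_mul, Real.mul_self_sqrt zero_le_two, Complex.ofReal_ofNat]
  have h2 : (Real.sqrt 2 : ℂ) ≠ 0 := fun h0 => by simp [h0] at h1
  rw [← h1]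
  field_simp

/-- For two lines the right-hand sides differ by the continuous factor `e^{x(η₀ - η)}`. The
transforms on the left are continuous in `x`, so the same relation between them holds everywhere,
and the null set of one line `η₀` serves all `η`. -/
theorem ae_forall_integral_line_eq {φ : ℝ → ℂ}
    (hφ : MemLp φ (ENNReal.ofReal q) (volume.restrict (Ioi 0))) {F : ℂ → ℂ}
    (hF : EqOn F (paleyWiener p lam φ) halfPlane) :
    ∀ᵐ x : ℝ, ∀ η : ℝ, 0 < η → Integrable (fun ξ : ℝ => F (ξ + η * Complex.I)) →
      ∫ ξ : ℝ, F (ξ + η * Complex.I) * Complex.exp (-(Complex.I * x * ξ)) =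
        (Real.sqrt 2 : ℂ) * Real.pi * rayKernel p lam φ η x := by
  by_cases hex : ∃ η : ℝ, 0 < η ∧ Integrable fun ξ : ℝ => F (ξ + η * Complex.I)
  swap
  · exact Filter.Eventually.of_forall fun x η hη hint => absurd ⟨η, hη, hint⟩ hex
  obtain ⟨η₀, hη₀, hint₀⟩ := hex
  have h₀ := ae_integral_line_eq hφ hF hη₀ hint₀
  filter_upwards [h₀] with x hx η hη hint
  have hker : ∀ x : ℝ, rayKernel p lam φ η x =
      rayKernel p lam φ η₀ x * (Real.exp (x * η₀ - x * η) : ℂ) := fun x => by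
    rw [rayKernel, rayKernel, mul_assoc, ← Complex.ofReal_mul, ← Real.exp_add]
    ring_nf
  have heq : (fun x : ℝ => ∫ ξ : ℝ, F (ξ + η * Complex.I) * Complex.exp (-(Complex.I * x * ξ))) =
      fun x : ℝ => (∫ ξ : ℝ, F (ξ + η₀ * Complex.I) * Complex.exp (-(Complex.I * x * ξ))) *
        (Real.exp (x * η₀ - x * η) : ℂ) := by
    refine (Continuous.ae_eq_iff_eq volume (continuous_integral_mul_exp hint)
      ((continuous_integral_mul_exp hint₀).mul (by fun_prop))).1 ?_
    filter_upwards [h₀, ae_integral_line_eq hφ hF hη hint] with y h1 h2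
    rw [Pi.mul_apply, h1, h2, hker]
    ring
  rw [congrFun heq x, hx, hker x, mul_assoc]

theorem ae_lebesgue_formula {φ : ℝ → ℂ}
    (hφ : MemLp φ (ENNReal.ofReal q) (volume.restrict (Ioi 0))) {F : ℂ → ℂ}
    (hF : EqOn F (paleyWiener p lam φ) halfPlane)
    (hint : ∀ᵐ η : ℝ ∂(volume.restrict (Ioi (0 : ℝ))),
      Integrable fun ξ : ℝ => F (ξ + η * Complex.I)) :
    ∀ᵐ x ∂(volume.restrict (Ioi (0 : ℝ))),
      Integrable (fun η : ℝ => ∫ ξ : ℝ, F (ξ + η * Complex.I) *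
        inverseKernel p x (ξ + η * Complex.I)) (nu lam) ∧
      φ x = (((Real.sqrt 2)⁻¹ * theta p lam x ^ (p - 1) : ℝ) : ℂ) *
        ((Real.pi : ℂ)⁻¹ * ∫ η : ℝ, (∫ ξ : ℝ, F (ξ + η * Complex.I) *
          inverseKernel p x (ξ + η * Complex.I)) ∂(nu lam)) := by
  filter_upwards [ae_restrict_of_ae (ae_forall_integral_line_eq hφ hF),
    ae_restrict_mem measurableSet_Ioi] with x hx hx0
  refine integral_formula hx0 (φ x) ?_
  rw [ae_nu_iff hlam.out]
  filter_upwards [hint, ae_restrict_mem measurableSet_Ioi] with η hη hη0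
  simp only [inverseKernel_eq, ← mul_assoc]
  rw [integral_mul_const, hx η hη0 hη, rayKernel, indicator_of_mem hx0]
  have h2 : Real.exp (-(p * x * η)) = Real.exp (-(x * η)) * Real.exp (-(x * (p - 1) * η)) := by
    rw [← Real.exp_add]; ring_nf
  rw [h2, Complex.ofReal_mul (Real.exp _)]
  ring

end

/-! ### Integration against `μ_λ` as iterated integration -/

theorem integrable_mu_iff {lam : ℝ} (hlam : -1 < lam) (G : ℂ → ℂ) :
    Integrable G (mu lam) ↔ Integrable (fun z : ℝ × ℝ =>
      (Real.pi⁻¹ * nuDensity lam z.2) • G (z.1 + z.2 * Complex.I))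
      ((volume : Measure ℝ).prod (volume.restrict (Ioi (0 : ℝ)))) := by
  have hmeas : Measurable fun z : ℂ => ENNReal.ofReal (Real.pi⁻¹ * nuDensity lam z.im) :=
    (((measurable_nuDensity lam).comp Complex.measurable_im).const_mul _).ennreal_ofReal
  rw [mu, integrable_withDensity_iff_integrable_smul' hmeas
    (Filter.Eventually.of_forall fun _ => ENNReal.ofReal_lt_top)]
  have h := integrableOn_halfPlane_iff fun z => (Real.pi⁻¹ * nuDensity lam z.im) • G z
  simp only [Complex.add_im, Complex.ofReal_im, Complex.mul_im, Complex.ofReal_re, Complex.I_im,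
    Complex.I_re, mul_one, mul_zero, add_zero, zero_add] at h
  rw [← h]
  refine integrableOn_congr_fun (fun z hz => ?_) measurableSet_halfPlane
  have := nuDensity_pos hlam hz
  rw [ENNReal.toReal_ofReal (by positivity)]

theorem integral_mu {lam : ℝ} (hlam : -1 < lam) {G : ℂ → ℂ} (hG : Integrable G (mu lam)) :
    ∫ z, G z ∂(mu lam) =
      (Real.pi : ℂ)⁻¹ * ∫ η, (∫ ξ : ℝ, G (ξ + η * Complex.I)) ∂(nu lam) := by
  have hmeas : Measurable fun z : ℂ => ENNReal.ofReal (Real.pi⁻¹ * nuDensity lam z.im) :=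
    (((measurable_nuDensity lam).comp Complex.measurable_im).const_mul _).ennreal_ofReal
  have h1 : ∫ z, G z ∂(mu lam) = ∫ z in halfPlane, (Real.pi⁻¹ * nuDensity lam z.im) • G z := by
    rw [mu, integral_withDensity_eq_integral_toReal_smul hmeas
      (Filter.Eventually.of_forall fun _ => ENNReal.ofReal_lt_top)]
    refine setIntegral_congr_fun measurableSet_halfPlane fun z hz => ?_
    have := nuDensity_pos hlam hz
    rw [ENNReal.toReal_ofReal (by positivity)]
  have h2 := (integrable_mu_iff hlam G).1 hG
  rw [h1, integral_halfPlane, integral_nu_smul hlam, ← integral_const_mul]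
  simp only [Complex.add_im, Complex.ofReal_im, Complex.mul_im, Complex.ofReal_re, Complex.I_im,
    Complex.I_re, mul_one, mul_zero, add_zero, zero_add]
  rw [integral_prod_symm _ h2]
  refine integral_congr_ae (Filter.Eventually.of_forall fun η => ?_)
  simp only [Complex.real_smul]
  rw [integral_const_mul]
  push_cast
  ring

/-- On a horizontal line the modulus of the kernel is a positive constant, so integrability of
almost every section passes to `F` itself. The conclusion no longer involves `x`. -/
theorem ae_integrable_line_of_integrable_mu {lam p x : ℝ} (hlam : -1 < lam) {F : ℂ → ℂ}
    (hF : ContinuousOn F halfPlane)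
    (hint : Integrable (fun ω : ℂ => F ω * inverseKernel p x ω) (mu lam)) :
    ∀ᵐ η : ℝ ∂(volume.restrict (Ioi (0 : ℝ))),
      Integrable fun ξ : ℝ => F (ξ + η * Complex.I) := by
  filter_upwards [((integrable_mu_iff hlam _).1 hint).prod_left_ae,
    ae_restrict_mem measurableSet_Ioi] with η hη hη0
  have hd := nuDensity_pos hlam hη0
  have hc : (0 : ℝ) < Real.pi⁻¹ * nuDensity lam η * Real.exp (-(x * (p - 1) * η)) := by positivity
  refine (hη.norm.const_mul (Real.pi⁻¹ * nuDensity lam η *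
    Real.exp (-(x * (p - 1) * η)))⁻¹).mono' (continuous_line hF hη0).aestronglyMeasurable
    (Filter.Eventually.of_forall fun ξ => le_of_eq ?_)
  have h1 : ‖Complex.exp (-(Complex.I * x * ξ))‖ = 1 := by
    rw [show -(Complex.I * x * ξ) = ((-(x * ξ) : ℝ) : ℂ) * Complex.I by
      push_cast; ring, Complex.norm_exp_ofReal_mul_I]
  rw [norm_smul, norm_mul (F _), inverseKernel_eq, norm_mul (Complex.exp _), h1, one_mul,
    Complex.norm_real,
    Real.norm_of_nonneg (Real.exp_pos _).le, Real.norm_of_nonneg (by positivity),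
    eq_inv_mul_iff_mul_eq₀ hc.ne']
  ring

end

end MixedFourier

/-! ### The Paley–Wiener theorem -/

theorem mainTheorem1 (p q lam : ℝ) [Fact (1 ≤ p)] [Fact (1 ≤ q)] [Fact (-1 < lam)] :
    ∃ e : LqHalfLine q ≃ₗᵢ[ℂ] AnalyticSpace q p lam,
      -- `e φ` is the analytic function given by the absolutely convergent integral
      (∀ φ : LqHalfLine q,
        (∀ z ∈ halfPlane, IntegrableOn (fun ξ : ℝ =>
          φ ξ * ((ξ ^ ((lam + 1) / p) : ℝ) : ℂ) * Complex.exp (Complex.I * ξ * z)) (Ioi 0)) ∧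
        DifferentiableOn ℂ (paleyWiener p lam φ) halfPlane ∧
        IsGivenBy (e φ : FourierSpace q p lam) (paleyWiener p lam φ)) ∧
      -- `e = U_λ⁻¹ R_0`
      (∀ (φ : LqHalfLine q) (u : FourierSpace q p lam),
        u = e φ ↔ ∀ᵐ x : ℝ, ∀ᵐ y ∂(volume.restrict (Ioi (0 : ℝ))), Ulam u x y = R0 p φ x y) ∧
      -- the inverse of `e` is `R_λ = R_0^{-1} U_λ`
      (∀ f : AnalyticSpace q p lam,
        e.symm f =ᵐ[volume.restrict (Ioi 0)] Rlam (f : FourierSpace q p lam)) ∧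
      -- the integral formula for `R_λ`, the integral over the horizontal lines being understood as
      -- the Fourier transform of the distribution `f` in the first variable
      (∀ f : AnalyticSpace q p lam, ∀ᵐ x ∂(volume.restrict (Ioi (0 : ℝ))),
        Integrable (fun η : ℝ => lineIntegral (f : FourierSpace q p lam) x η *
          inverseKernel p x (η * Complex.I)) (nu lam) ∧
        e.symm f x = (((Real.sqrt 2)⁻¹ * theta p lam x ^ (p - 1) : ℝ) : ℂ) *
          ((Real.pi : ℂ)⁻¹ * ∫ η : ℝ, lineIntegral (f : FourierSpace q p lam) x η *
            inverseKernel p x (η * Complex.I) ∂(nu lam))) ∧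
      -- the same formula with Lebesgue integrals, whenever these converge
      (∀ (f : AnalyticSpace q p lam) (F : ℂ → ℂ), DifferentiableOn ℂ F halfPlane →
        IsGivenBy (f : FourierSpace q p lam) F →
        ((∀ᵐ η : ℝ ∂(volume.restrict (Ioi (0 : ℝ))),
            Integrable fun ξ : ℝ => F (ξ + η * Complex.I)) →
          ∀ᵐ x ∂(volume.restrict (Ioi (0 : ℝ))),
            Integrable (fun η : ℝ => ∫ ξ : ℝ, F (ξ + η * Complex.I) *
              inverseKernel p x (ξ + η * Complex.I)) (nu lam) ∧
            e.symm f x = (((Real.sqrt 2)⁻¹ * theta p lam x ^ (p - 1) : ℝ) : ℂ) *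
              ((Real.pi : ℂ)⁻¹ * ∫ η : ℝ, (∫ ξ : ℝ, F (ξ + η * Complex.I) *
                inverseKernel p x (ξ + η * Complex.I)) ∂(nu lam))) ∧
        (∀ᵐ x ∂(volume.restrict (Ioi (0 : ℝ))),
          Integrable (fun ω : ℂ => F ω * inverseKernel p x ω) (mu lam) →
            e.symm f x = (((Real.sqrt 2)⁻¹ * theta p lam x ^ (p - 1) : ℝ) : ℂ) *
              ∫ ω : ℂ, F ω * inverseKernel p x ω ∂(mu lam))) := by
  have hp : 1 ≤ p := Fact.out
  have hlam : -1 < lam := Fact.out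
  have ha : 0 < (lam + 1) / p := div_pos (by linarith) (by linarith)
  refine ⟨paleyWienerIso q p lam, fun φ => ⟨fun z hz => integrableOn_paleyWiener (Lp.memLp φ) ha hz,
    differentiableOn_paleyWiener hp hlam (Lp.memLp φ),
    isGivenBy_paleyWiener (U1_paleyWienerIso φ)⟩, eq_paleyWienerIso_iff,
    paleyWienerIso_symm_ae_eq, ae_integral_formula, fun f F hF hfF => ?_⟩
  have hφ := Lp.memLp ((paleyWienerIso q p lam).symm f)
  have hEq : EqOn F (paleyWiener p lam ((paleyWienerIso q p lam).symm f)) halfPlane :=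
    eqOn_of_isGivenBy hF.continuousOn (differentiableOn_paleyWiener hp hlam hφ).continuousOn hfF
      (isGivenBy_paleyWiener (U1_eq_rayEmbedding_symm f))
  refine ⟨fun hint => ae_lebesgue_formula hφ hEq hint, ?_⟩
  -- Integrability over `Π` at one `x₀` already makes `F` integrable on almost every line, so the
  -- iterated formula holds for almost every `x`. At those `x` where the integral over `Π`
  -- converges, Fubini identifies the two. If there is no such `x₀`, the claim is vacuous.
  by_cases hex : ∃ x, Integrable (fun ω : ℂ => F ω * inverseKernel p x ω) (mu lam)
  · obtain ⟨x₀, hx₀⟩ := hex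
    filter_upwards [ae_lebesgue_formula hφ hEq
      (ae_integrable_line_of_integrable_mu hlam hF.continuousOn hx₀)] with x hx hint
    rw [integral_mu hlam hint]
    exact hx.2
  · exact Filter.Eventually.of_forall fun x hint => absurd ⟨x, hint⟩ hex
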